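/- Let $k$ be an algebraically closed field, let $S=k[x_0,\dots,x_r]$, and let $X\subset\mathbb P^r_k$ be a closed subscheme with homogeneous ideal $I_X=\bigoplus_{d\ge 0} H^0(\mathbb P^r,\mathcal I_X(d))\subset S$. For an integer $p\ge 1$, say that $X$ satisfies $\mathbf N_{2,p}$ if $X$ is nondegenerate (that is, $I_X$ contains no nonzero linear form), $I_X$ is generated by quadrics, and, in the minimal graded free resolution $$\cdots\to F_t\xrightarrow{\ \varphi_t\ }F_{t-1}\to\cdots\xrightarrow{\ \varphi_1\ }F_0\to I_X\to 0,$$ the map $\varphi_t$ is represented by a matrix of linear forms for all $1\le t\le p-1$; equivalently, $F_t$ is a direct sum of copies of $S(-t-2)$ for all $0\le t\le p-1$. Theorem 1.1. Let $X\subset\mathbb P^r_k$ be a closed subscheme satisfying $\mathbf N_{2,p}$ with $p\ge 1$, and let $\Lambda\subset\mathbb P^r_k$ be a (nonempty) linear subspace of dimension $\le p$. Let $X\cap\Lambda$ be the scheme-theoretic intersection, regarded as a closed subscheme of $\Lambda$ with ideal sheaf $\mathcal I_{X\cap\Lambda,\Lambda}\subset\mathcal O_\Lambda$. If $\dim(X\cap\Lambda)\le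 1$, then $\mathcal I_{X\cap\Lambda,\Lambda}$ is $2$-regular in the sense of Castelnuovo and Mumford, i.e. $H^q(\Lambda,\mathcal I_{X\cap\Lambda,\Lambda}(2-q))=0$ for all $q\ge 1$. In particular, if $X\cap\Lambda$ is finite, then $\operatorname{length}(X\cap\Lambda)\le\dim\Lambda+1$. -/

import Mathlib

open AlgebraicGeometry CategoryTheory CategoryTheory.Limits MvPolynomial

universe u

noncomputable section

namespace LinearSyzygies

attribute [local instance] MvPolynomial.gradedAlgebra

/-- The homogeneous coordinate ring `k[x_0, …, x_n]` of projective `n`-space. -/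
abbrev CoordRing (k : Type u) [Field k] (n : ℕ) : Type u := MvPolynomial (Fin (n + 1)) k

/-- The standard grading of `k[x_0, …, x_n]`. -/
abbrev grading (k : Type u) [Field k] (n : ℕ) : ℕ → Submodule k (CoordRing k n) :=
  homogeneousSubmodule (Fin (n + 1)) k

/-- Projective `n`-space over `k`, as the scheme `Proj k[x_0, …, x_n]`. -/
abbrev ProjSpace (k : Type u) [Field k] (n : ℕ) : Scheme.{u} := Proj (grading k n)

variable {k : Type u} [Field k] {n : ℕ}

/-- The open subscheme `D₊(f)` of projective space. -/
abbrev dPlus (f : CoordRing k n) : (ProjSpace k n).Opens := Proj.basicOpen (grading k n) f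

/-! ### Ideal sheaf and homogeneous ideal of a closed subscheme -/

/-- For a morphism `ι : Z ⟶ ℙⁿ` (in practice a closed immersion) and a form `f`, the sections over
`D₊(f)` of the ideal sheaf `𝓘_Z = ker (𝒪_{ℙⁿ} → ι_* 𝒪_Z)`, as an ideal of the ring
`k[x_0, …, x_n]_(f)` of fractions of degree zero. -/
def idealSections {Z : Scheme.{u}} (ι : Z ⟶ ProjSpace k n) (f : CoordRing k n) :
    Ideal (HomogeneousLocalization.Away (grading k n) f) :=
  RingHom.ker ((ι.app (dPlus f)).hom.comp (Proj.awayToSection (grading k n) f).hom)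

lemma X_mem_grading (i : Fin (n + 1)) : (X i : CoordRing k n) ∈ grading k n 1 :=
  (mem_homogeneousSubmodule 1 _).2 (isHomogeneous_X k i)

/-- The homogeneous ideal `I_Z` of a closed subscheme `Z` of `ℙⁿ`: it is generated by the forms `f`,
say of degree `d`, that vanish on `Z`, i.e. such that `f / x_i ^ d` is a section of the ideal sheaf
of `Z` over `D₊(x_i)` for every `i`. -/
def homogeneousIdeal {Z : Scheme.{u}} (ι : Z ⟶ ProjSpace k n) : Ideal (CoordRing k n) :=
  Ideal.span {f | ∃ (d : ℕ) (hf : f ∈ grading k n d), ∀ i : Fin (n + 1),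
    HomogeneousLocalization.Away.mk (grading k n) (X_mem_grading i) d f
      (by simpa using hf) ∈ idealSections ι (X i)}

/-! ### Minimal free resolutions and the condition `N_{2,p}` -/

/-- A minimal graded free resolution
`⋯ → F_2 → F_1 → F_0 → I → 0` of an ideal `I` of `S = k[x_0, …, x_n]`, where
`F_t = ⨁_j S(-deg t j)` has rank `rank t`, the map `F_0 → I` is given by `gen`, and
`φ_{t+1} : F_{t+1} → F_t` by the matrix `diff t`. -/
structure MinimalFreeResolution (I : Ideal (CoordRing k n)) where
  rank : ℕ → ℕ
  deg : (t : ℕ) → Fin (rank t) → ℕ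
  gen : Fin (rank 0) → CoordRing k n
  diff : (t : ℕ) → Matrix (Fin (rank t)) (Fin (rank (t + 1))) (CoordRing k n)
  /-- `F_0 → I` preserves degrees -/
  gen_homogeneous : ∀ j, (gen j).IsHomogeneous (deg 0 j)
  /-- `F_{t+1} → F_t` preserves degrees -/
  diff_homogeneous : ∀ t i j, diff t i j = 0 ∨
    ∃ e, deg t i + e = deg (t + 1) j ∧ (diff t i j).IsHomogeneous e
  /-- `F_0 → I` is onto -/
  span_gen : Ideal.span (Set.range gen) = I
  /-- exactness at `F_0` -/
  exact_zero : ∀ v : Fin (rank 0) → CoordRing k n,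
    v ⬝ᵥ gen = 0 ↔ ∃ w, (diff 0).mulVec w = v
  /-- exactness at `F_{t+1}` -/
  exact_succ : ∀ t, ∀ v : Fin (rank (t + 1)) → CoordRing k n,
    (diff t).mulVec v = 0 ↔ ∃ w, (diff (t + 1)).mulVec w = v
  /-- minimality: the entries of the matrices lie in the ideal `(x_0, …, x_n)` -/
  minimal : ∀ t i j, constantCoeff (diff t i j) = 0

/-- The condition `N_{2,p}` for a homogeneous ideal `I` and `p ≥ 1`: `I` contains no nonzero linear
form, it is generated by quadrics, and in its minimal free resolution the matrices
`φ_1, …, φ_{p-1}` consist of linear forms; in other words `F_t` is a direct sum of copies of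
`S(-t-2)` for `0 ≤ t ≤ p - 1`. -/
def SatisfiesN2 (I : Ideal (CoordRing k n)) (p : ℕ) : Prop :=
  (∀ l ∈ I, l.IsHomogeneous 1 → l = 0) ∧
    ∃ F : MinimalFreeResolution I, ∀ t < p, ∀ j, F.deg t j = t + 2

/-! ### Linear subspaces -/

section Linear

variable {m r : ℕ}

/-- The graded homomorphism `k[x_0, …, x_r] → k[y_0, …, y_m]` with `x_i ↦ ∑_j (b j)_i y_j`. -/
def linearSubst (b : Fin (m + 1) → Fin (r + 1) → k) :
    GradedRingHom (grading k r) (grading k m) where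
  toRingHom := (aeval fun i => ∑ j, C (b j i) * X j : CoordRing k r →ₐ[k] CoordRing k m).toRingHom
  map_mem {d f} hf := by
    have h := ((mem_homogeneousSubmodule d f).1 hf).aeval (S := k)
      (fun i => ∑ j, C (b j i) * (X j : CoordRing k m)) (n := 1) (fun i => by
        refine IsHomogeneous.sum _ _ _ fun j _ => ?_
        simpa using (isHomogeneous_C (Fin (m + 1)) (b j i)).mul (isHomogeneous_X k j))
    rw [one_mul] at h
    exact (mem_homogeneousSubmodule d _).2 h

lemma linearSubst_X (b : Fin (m + 1) → Fin (r + 1) → k) (i : Fin (r + 1)) :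
    linearSubst b (X i) = ∑ j, C (b j i) * X j :=
  aeval_X _ _

lemma linearSubst_C (b : Fin (m + 1) → Fin (r + 1) → k) (a : k) :
    linearSubst b (C a) = C a :=
  aeval_C _ _

lemma linearSubst_surjective {b : Fin (m + 1) → Fin (r + 1) → k} (hb : LinearIndependent k b) :
    Function.Surjective (linearSubst b) := by
  obtain ⟨L, hL⟩ := (Fintype.linearCombination k b).exists_leftInverse_of_injective
    (LinearMap.ker_eq_bot.2 (linearIndependent_iff_injective_fintypeLinearCombination.1 hb))
  have key : ∀ l : Fin (m + 1), ∃ f, linearSubst b f = X l := by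
    intro l
    refine ⟨∑ i, C (L (Pi.single i 1) l) * X i, ?_⟩
    have hbj : ∀ j, ∑ i, b j i * L (Pi.single i 1) l = (Pi.single j 1 : Fin (m + 1) → k) l := by
      intro j
      have h1 : L (b j) = Pi.single j 1 := by
        have := LinearMap.congr_fun hL (Pi.single j 1)
        simpa [Fintype.linearCombination_apply_single] using this
      rw [← h1]
      conv_rhs => rw [pi_eq_sum_univ (b j)]
      rw [map_sum, Finset.sum_apply]
      refine Finset.sum_congr rfl fun i _ => ?_
      have h2 : (fun a => if i = a then (1 : k) else 0) = Pi.single i 1 := by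
        ext a; simp [Pi.single_apply, eq_comm]
      rw [map_smul, Pi.smul_apply, smul_eq_mul, h2]
    rw [map_sum]
    simp_rw [map_mul, linearSubst_C, linearSubst_X, Finset.mul_sum]
    rw [Finset.sum_comm]
    have h3 : ∀ j : Fin (m + 1), ∑ i : Fin (r + 1),
        (C (L (Pi.single i 1) l) * (C (b j i) * X j) : CoordRing k m) =
          C ((Pi.single j 1 : Fin (m + 1) → k) l) * X j := by
      intro j
      rw [← hbj j, map_sum, Finset.sum_mul]
      refine Finset.sum_congr rfl fun i _ => ?_
      rw [map_mul]; ring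
    rw [Finset.sum_congr rfl fun j _ => h3 j, Finset.sum_eq_single l]
    · simp
    · intro j _ hj
      simp [hj.symm]
    · simp
  intro g
  induction g using MvPolynomial.induction_on with
  | C a => exact ⟨C a, linearSubst_C b a⟩
  | add p q hp hq =>
    obtain ⟨p', rfl⟩ := hp
    obtain ⟨q', rfl⟩ := hq
    exact ⟨p' + q', map_add _ _ _⟩
  | mul_X p l hp =>
    obtain ⟨p', rfl⟩ := hp
    obtain ⟨f, hf⟩ := key l
    exact ⟨p' * f, by rw [map_mul, hf]⟩

lemma irrelevant_le_map_linearSubst {b : Fin (m + 1) → Fin (r + 1) → k}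
    (hb : LinearIndependent k b) :
    HomogeneousIdeal.irrelevant (grading k m) ≤
      (HomogeneousIdeal.irrelevant (grading k r)).map (linearSubst b) := by
  rw [HomogeneousIdeal.irrelevant_le]
  intro i hi x hx
  obtain ⟨f, rfl⟩ := linearSubst_surjective hb x
  have h : linearSubst b (DirectSum.decompose (grading k r) f i : CoordRing k r) =
      linearSubst b f := by
    rw [map_directSumDecompose (grading k r) (grading k m)]
    exact DirectSum.decompose_of_mem_same (grading k m) hx
  rw [← h]
  exact Ideal.mem_map_of_mem _
    (HomogeneousIdeal.mem_irrelevant_of_mem _ hi (DirectSum.decompose (grading k r) f i).2)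

/-- For linearly independent vectors `b_0, …, b_m` of `k^{r+1}`, the closed immersion
`ℙᵐ ⟶ ℙʳ`, `(y_0 : … : y_m) ↦ ∑ y_j b_j`, whose image is the `m`-dimensional linear subspace
spanned by the points `[b_0], …, [b_m]`. -/
def linearSubspace (b : Fin (m + 1) → Fin (r + 1) → k) (hb : LinearIndependent k b) :
    ProjSpace k m ⟶ ProjSpace k r :=
  Proj.map (linearSubst b) (irrelevant_le_map_linearSubst hb)

end Linear

/-! ### Cohomology of twists of an ideal sheaf, and regularity -/

/-- The field of fractions of `k[x_0, …, x_n]`; it contains `k[x_0, …, x_n]_f` for all `f ≠ 0`. -/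
abbrev FracField (k : Type u) [Field k] (n : ℕ) : Type u := FractionRing (CoordRing k n)

/-- The variable `x_i` as an element of the field of fractions. -/
def fracX (i : Fin (n + 1)) : FracField k n := algebraMap (CoordRing k n) (FracField k n) (X i)

/-- The monomial `∏_{i ∈ σ} x_i`; the intersection of the opens `D₊(x_i)`, `i ∈ σ`, is `D₊` of it.
-/
def faceMonomial (k : Type u) [Field k] {n : ℕ} (σ : Finset (Fin (n + 1))) : CoordRing k n :=
  ∏ i ∈ σ, X i

lemma faceMonomial_ne_zero (σ : Finset (Fin (n + 1))) : faceMonomial k σ ≠ 0 :=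
  Finset.prod_ne_zero_iff.2 fun i _ => X_ne_zero i

lemma isUnit_algebraMap {f : CoordRing k n} (hf : f ≠ 0) :
    IsUnit (algebraMap (CoordRing k n) (FracField k n) f) :=
  isUnit_iff_ne_zero.2 ((map_ne_zero_iff _ (IsFractionRing.injective _ _)).2 hf)

/-- The inclusion of the ring of fractions `a / f ^ N` of degree zero in the field of fractions. -/
def awayToFrac (f : CoordRing k n) (hf : f ≠ 0) :
    HomogeneousLocalization.Away (grading k n) f →+* FracField k n :=
  (Localization.awayLift (algebraMap (CoordRing k n) (FracField k n)) f
    (isUnit_algebraMap hf)).comp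
      (algebraMap (HomogeneousLocalization.Away (grading k n) f) (Localization.Away f))

/-- The sections over `⋂_{i ∈ σ} D₊(x_i)` of the twisted ideal sheaf `𝓘_Z(d) = 𝓘_Z ⊗ 𝒪(d)`, for a
nonempty set `σ` of indices. On this open set `𝒪(d)` is freely generated by `x_i ^ d` for each
`i ∈ σ`, so that the sections of `𝓘_Z(d)` are the products of `x_i ^ d` with sections of `𝓘_Z`. -/
def twistedSections {Z : Scheme.{u}} (ι : Z ⟶ ProjSpace k n) (d : ℤ) (σ : Finset (Fin (n + 1))) :
    AddSubgroup (FracField k n) where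
  carrier := {s | ∀ i ∈ σ, ∃ g ∈ idealSections ι (faceMonomial k σ),
    s = fracX i ^ d * awayToFrac _ (faceMonomial_ne_zero σ) g}
  zero_mem' i _ := ⟨0, zero_mem _, by simp⟩
  add_mem' {s t} hs ht i hi := by
    obtain ⟨g, hg, rfl⟩ := hs i hi
    obtain ⟨h, hh, e⟩ := ht i hi
    exact ⟨g + h, add_mem hg hh, by rw [e, map_add, mul_add]⟩
  neg_mem' {s} hs i hi := by
    obtain ⟨g, hg, rfl⟩ := hs i hi
    exact ⟨-g, neg_mem hg, by rw [map_neg, mul_neg]⟩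

lemma faceMonomial_mem (σ : Finset (Fin (n + 1))) : faceMonomial k σ ∈ grading k n σ.card := by
  have h := IsHomogeneous.prod (R := k) σ (fun i => (X i : CoordRing k n)) (fun _ => 1)
    (fun i _ => isHomogeneous_X k i)
  rw [mem_homogeneousSubmodule]
  simpa [faceMonomial] using h

lemma awayToFrac_mk (f : CoordRing k n) (hf : f ≠ 0) {d : ℕ} (hd : f ∈ grading k n d) (N : ℕ)
    (a : CoordRing k n) (ha : a ∈ grading k n (N • d)) :
    awayToFrac f hf (HomogeneousLocalization.Away.mk (grading k n) hd N a ha) =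
      algebraMap _ (FracField k n) a / algebraMap _ (FracField k n) f ^ N := by
  have h0 := (isUnit_algebraMap hf).ne_zero
  simp only [awayToFrac, RingHom.comp_apply, HomogeneousLocalization.algebraMap_apply,
    HomogeneousLocalization.Away.val_mk]
  rw [Localization.mk_eq_mk', Localization.awayLift, IsLocalization.Away.lift,
    IsLocalization.lift_mk'_spec]
  rw [map_pow]
  field_simp

lemma awayToFrac_awayMap {f g x : CoordRing k n} (hf : f ≠ 0) (hx0 : x ≠ 0) {d e : ℕ}
    (hd : f ∈ grading k n d) (hg : g ∈ grading k n e) (hx : x = f * g)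
    (a : HomogeneousLocalization.Away (grading k n) f) :
    awayToFrac x hx0 (HomogeneousLocalization.awayMap (grading k n) hg hx a) =
      awayToFrac f hf a := by
  obtain ⟨N, a, ha, rfl⟩ := HomogeneousLocalization.Away.mk_surjective (grading k n) hd a
  rw [HomogeneousLocalization.awayMap_mk, awayToFrac_mk, awayToFrac_mk]
  subst hx
  have h1 := (isUnit_algebraMap (left_ne_zero_of_mul hx0)).ne_zero
  have h2 := (isUnit_algebraMap (right_ne_zero_of_mul hx0)).ne_zero
  simp only [map_mul, map_pow, mul_pow]
  field_simp

/-- Sections of the ideal sheaf restrict to sections of the ideal sheaf. -/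
lemma awayMap_mem_idealSections {Z : Scheme.{u}} (ι : Z ⟶ ProjSpace k n) {f g x : CoordRing k n}
    {e : ℕ} (hg : g ∈ grading k n e) (hx : x = f * g)
    {a : HomogeneousLocalization.Away (grading k n) f} (ha : a ∈ idealSections ι f) :
    HomogeneousLocalization.awayMap (grading k n) hg hx a ∈ idealSections ι x := by
  have hle : dPlus x ≤ dPlus f := Proj.basicOpen_mono (grading k n) f x ⟨g, hx⟩
  have h1 : (Proj.awayToSection (grading k n) x).hom
      (HomogeneousLocalization.awayMap (grading k n) hg hx a) =
      ((ProjSpace k n).presheaf.map (homOfLE hle).op).hom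
        ((Proj.awayToSection (grading k n) f).hom a) :=
    congr($(Proj.awayMap_awayToSection (grading k n) hg hx).hom a)
  have h2 := congr($(ι.naturality (homOfLE hle).op).hom
    ((Proj.awayToSection (grading k n) f).hom a))
  have ha' : (ι.app (dPlus f)).hom ((Proj.awayToSection (grading k n) f).hom a) = 0 := ha
  change (ι.app (dPlus x)).hom ((Proj.awayToSection (grading k n) x).hom _) = 0
  rw [h1]
  refine Eq.trans h2 ?_
  exact (congrArg (Z.presheaf.map ((TopologicalSpace.Opens.map ι.base).map
    (homOfLE hle).op.unop).op).hom ha').trans (RingHom.map_zero _)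

/-- On `⋂_{i ∈ τ} D₊(x_i)` the function `x_j / x_i` is regular for `i ∈ τ`. -/
lemma exists_awayToFrac_eq (τ : Finset (Fin (n + 1))) {i : Fin (n + 1)} (hi : i ∈ τ)
    (j : Fin (n + 1)) : ∃ u : HomogeneousLocalization.Away (grading k n) (faceMonomial k τ),
      awayToFrac _ (faceMonomial_ne_zero τ) u = fracX j / fracX i := by
  have hprod : X i * faceMonomial k (τ.erase i) = faceMonomial k τ :=
    Finset.mul_prod_erase τ _ hi
  have hmem : X j * faceMonomial k (τ.erase i) ∈ grading k n (1 • τ.card) := by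
    have := SetLike.mul_mem_graded (X_mem_grading (k := k) j) (faceMonomial_mem (k := k)
      (τ.erase i))
    rwa [Finset.card_erase_of_mem hi, Nat.add_sub_cancel' (Finset.card_pos.2 ⟨i, hi⟩),
      ← one_smul ℕ τ.card] at this
  refine ⟨HomogeneousLocalization.Away.mk (grading k n) (faceMonomial_mem τ) 1 _ hmem, ?_⟩
  have h1 := (isUnit_algebraMap (faceMonomial_ne_zero (k := k) (τ.erase i))).ne_zero
  have h2 := (isUnit_algebraMap (X_ne_zero (R := k) i)).ne_zero
  rw [awayToFrac_mk, ← hprod, map_mul, map_mul, pow_one, fracX, fracX]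
  field_simp

/-- Sections over a set of the form `⋂_{i ∈ σ} D₊(x_i)` restrict to smaller such sets; inside the
field of fractions the restriction map is the inclusion. -/
lemma twistedSections_mono {Z : Scheme.{u}} (ι : Z ⟶ ProjSpace k n) (d : ℤ)
    {σ τ : Finset (Fin (n + 1))} (hσ : σ.Nonempty) (h : σ ⊆ τ) :
    twistedSections ι d σ ≤ twistedSections ι d τ := by
  intro s hs i hi
  obtain ⟨j, hj⟩ := hσ
  obtain ⟨g, hg, rfl⟩ := hs j hj
  have hx : faceMonomial k τ = faceMonomial k σ * faceMonomial k (τ \ σ) := by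
    rw [mul_comm]; exact (Finset.prod_sdiff h).symm
  have hXi : (fracX i : FracField k n) ≠ 0 := (isUnit_algebraMap (X_ne_zero i)).ne_zero
  have hXj : (fracX j : FracField k n) ≠ 0 := (isUnit_algebraMap (X_ne_zero j)).ne_zero
  obtain ⟨v, hv⟩ : ∃ v : HomogeneousLocalization.Away (grading k n) (faceMonomial k τ),
      awayToFrac _ (faceMonomial_ne_zero τ) v = (fracX j / fracX i) ^ d := by
    obtain ⟨N, rfl | rfl⟩ := d.eq_nat_or_neg
    · obtain ⟨u, hu⟩ := exists_awayToFrac_eq (k := k) τ hi j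
      exact ⟨u ^ N, by rw [map_pow, hu, zpow_natCast]⟩
    · obtain ⟨u, hu⟩ := exists_awayToFrac_eq (k := k) τ (h hj) i
      exact ⟨u ^ N, by rw [map_pow, hu, zpow_neg, zpow_natCast, ← inv_pow, inv_div]⟩
  refine ⟨v * HomogeneousLocalization.awayMap (grading k n) (faceMonomial_mem _) hx g,
    Ideal.mul_mem_left _ _ (awayMap_mem_idealSections ι _ hx hg), ?_⟩
  rw [map_mul, hv, awayToFrac_awayMap (faceMonomial_ne_zero σ) _ (faceMonomial_mem σ), div_zpow]
  have := zpow_ne_zero d hXi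
  field_simp

/-- The `q`-dimensional faces: sets of `q + 1` indices. -/
abbrev Face (n q : ℕ) : Type := {σ : Finset (Fin (n + 1)) // σ.card = q + 1}

/-- The face of `τ` opposite to its vertex `i`. -/
def Face.erase {q : ℕ} (τ : Face n (q + 1)) (i : {i // i ∈ τ.1}) : Face n q :=
  ⟨τ.1.erase i.1, by rw [Finset.card_erase_of_mem i.2, τ.2]; rfl⟩

lemma Face.nonempty {q : ℕ} (σ : Face n q) : σ.1.Nonempty :=
  Finset.card_pos.1 (by rw [σ.2]; exact q.succ_pos)

/-- The `q`-th term of the alternating Čech complex of `𝓘_Z(d)` for the standard affine cover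
`D₊(x_0), …, D₊(x_n)` of `ℙⁿ`. -/
abbrev CechCochain {Z : Scheme.{u}} (ι : Z ⟶ ProjSpace k n) (d : ℤ) (q : ℕ) : Type u :=
  (σ : Face n q) → twistedSections ι d σ.1

/-- The Čech differential: `(δ c)(i_0 < … < i_{q+1}) = ∑_a (-1)^a c(i_0, …, î_a, …, i_{q+1})`. -/
def cechDiff {Z : Scheme.{u}} (ι : Z ⟶ ProjSpace k n) (d : ℤ) (q : ℕ) :
    CechCochain ι d q →+ CechCochain ι d (q + 1) where
  toFun c τ := ∑ i : {i // i ∈ τ.1}, (-1 : ℤ) ^ (τ.1.filter (· < i.1)).card •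
    AddSubgroup.inclusion (twistedSections_mono ι d (τ.erase i).nonempty (Finset.erase_subset _ _))
      (c (τ.erase i))
  map_zero' := by ext τ; simp
  map_add' c c' := by
    ext τ
    simp [Finset.sum_add_distrib]

/-- The Čech coboundaries in degree `q`. -/
def cechCoboundaries {Z : Scheme.{u}} (ι : Z ⟶ ProjSpace k n) (d : ℤ) :
    (q : ℕ) → AddSubgroup (CechCochain ι d q)
  | 0 => ⊥
  | q + 1 => (cechDiff ι d q).range

/-- The cohomology group `H^q(ℙⁿ, 𝓘_Z(d))`, computed by the Čech complex of the standard affine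
cover. -/
def IdealCohomology {Z : Scheme.{u}} (ι : Z ⟶ ProjSpace k n) (d : ℤ) (q : ℕ) : Type u :=
  (cechDiff ι d q).ker ⧸ (cechCoboundaries ι d q).addSubgroupOf (cechDiff ι d q).ker

/-- The ideal sheaf `𝓘_Z` of a closed subscheme `Z` of `ℙⁿ` is `s`-regular in the sense of
Castelnuovo and Mumford: `H^q(ℙⁿ, 𝓘_Z(s - q)) = 0` for all `q ≥ 1`. -/
def IsCMRegular {Z : Scheme.{u}} (ι : Z ⟶ ProjSpace k n) (s : ℤ) : Prop :=
  ∀ q : ℕ, 1 ≤ q → Subsingleton (IdealCohomology ι (s - q) q)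

end LinearSyzygies

end

open LinearSyzygies

/-!
Fix linearly independent `b_0, …, b_m`, let `I` be the homogeneous ideal of `X ⊆ ℙʳ`, let
`R = k[y_0, …, y_m]` be the coordinate ring of `Λ`, and let `J ⊆ R` be the restriction of `I` to
`Λ`. The ideal `J` need not be saturated, but it defines `X ∩ Λ`, in the strong sense that the
sections of `𝓘_{X ∩ Λ}(d)` over `⋂_{i ∈ σ} D₊(y_i)` are the elements of degree `d` of the
localization of `J` at `∏_{i ∈ σ} y_i` (`mem_twistedSections_iff`). All cohomology is therefore Čech
cohomology of graded submodules of vector spaces over the field of fractions of `R`, indexed by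
finite sets `σ` of vertices; the empty set is included, so that `Hⁱ` sits at `card σ = i + 1`.

Restrict the minimal resolution of `I` to `Λ`. It becomes a complex `⋯ → V_1 → V_0 → J → 0` of free
modules, with `V_t` generated in degree `t + 2` for `t < p`. It need not be exact, but its homology
is killed by `J`: multiplication by an element of `I` is homotopic to zero on the
resolution `⋯ → F_1 → F_0 → S` of `S / I`. Hence the homology has support in `X ∩ Λ`, which has
dimension at most one, and by dévissage along homogeneous primes (`acyclic_of_torsion`) it has no
cohomology beyond `H¹`. So the vanishing of the groups `H^q(𝓘_{X ∩ Λ}(2 - q))` can be read off along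
the complex, as if it were exact, from `H^{q+t}(Λ, 𝒪(-q - t)) = 0` for the modules `V_t` with `t < p`
(`acyclic_bot_top`); beyond these, the cohomological index exceeds `m ≤ p`, and everything vanishes
(`MinimalFreeResolution.acyclic_idealFamily`).

If `X ∩ Λ` is finite, it lies in `D₊(l)` for some linear form `l`. The vanishing of
`H¹(𝓘_{X ∩ Λ}(1))` shows that every function on it is of the form `l' / l` with a linear form `l'`
(`exists_linear_sub_mem`), so there are at most `m + 1` linearly independent functions.
-/

namespace LinearSyzygies

noncomputable section

attribute [local instance] MvPolynomial.gradedAlgebra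

/-! ### The simplicial coboundary -/

section Coboundary

variable {ι E F : Type*} [LinearOrder ι] [AddCommGroup E] [AddCommGroup F]

/-- The sign `(-1)^a`, where `a` is the position of `i` in the finite set `τ`. -/
def faceSign (i : ι) (τ : Finset ι) : ℤ := (-1) ^ (τ.filter (· < i)).card

lemma faceSign_mul_self (i : ι) (τ : Finset ι) : faceSign i τ * faceSign i τ = 1 := by
  rw [faceSign, ← mul_pow]; simp

lemma faceSign_insert {i j : ι} {τ : Finset ι} (hj : j ∉ τ) :
    faceSign i (insert j τ) = if j < i then -faceSign i τ else faceSign i τ := by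
  unfold faceSign
  rw [Finset.filter_insert]
  split_ifs with h
  · rw [Finset.card_insert_of_notMem (by simp [hj]), pow_succ]; simp
  · rfl

/-- The coboundary of a cochain on all finite sets of vertices, the empty set included. -/
def coboundary : (Finset ι → E) →+ (Finset ι → E) where
  toFun c τ := ∑ i ∈ τ, faceSign i τ • c (τ.erase i)
  map_zero' := by ext; simp
  map_add' c c' := by ext; simp [Finset.sum_add_distrib]

lemma coboundary_apply (c : Finset ι → E) (τ : Finset ι) :
    coboundary c τ = ∑ i ∈ τ, faceSign i τ • c (τ.erase i) := rfl

lemma coboundary_comp (φ : E →+ F) (c : Finset ι → E) (τ : Finset ι) :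
    coboundary (fun σ => φ (c σ)) τ = φ (coboundary c τ) := by
  simp [coboundary_apply]

lemma faceSign_swap {i j : ι} {τ : Finset ι} (hi : i ∈ τ) (hj : j ∈ τ) (hij : i ≠ j) :
    faceSign i τ * faceSign j (τ.erase i) = -(faceSign j τ * faceSign i (τ.erase j)) := by
  obtain ⟨ρ, hiρ, rfl⟩ : ∃ ρ, i ∉ ρ ∧ insert i ρ = τ := ⟨τ.erase i, by simp, by simp [hi]⟩
  obtain ⟨ρ, hjρ, rfl⟩ : ∃ ρ', j ∉ ρ' ∧ insert j ρ' = ρ :=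
    ⟨ρ.erase j, by simp,
      Finset.insert_erase ((Finset.mem_insert.1 hj).resolve_left hij.symm)⟩
  have hiρ' : i ∉ ρ := fun h => hiρ (Finset.mem_insert_of_mem h)
  rw [Finset.erase_insert hiρ, Finset.insert_comm,
    Finset.erase_insert (by simp [hjρ, hij.symm]),
    faceSign_insert (i := i) (by simp [hjρ, hij.symm]), faceSign_insert (i := i) hiρ',
    Finset.insert_comm, faceSign_insert (i := j) hiρ, faceSign_insert (i := j) hjρ]
  rcases lt_or_gt_of_ne hij with h | h <;> simp [h, h.not_gt, mul_comm]

lemma coboundary_coboundary (c : Finset ι → E) : coboundary (coboundary c) = 0 := by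
  ext τ
  simp only [coboundary_apply, Finset.smul_sum, smul_smul, Pi.zero_apply]
  rw [Finset.sum_sigma']
  refine Finset.sum_involution (fun p _ => ⟨p.2, p.1⟩) ?_ ?_ ?_ ?_
  · rintro ⟨i, j⟩ h
    simp only [Finset.mem_sigma, Finset.mem_erase] at h
    simp only
    rw [Finset.erase_right_comm, faceSign_swap h.1 h.2.2 (Ne.symm h.2.1), neg_smul,
      neg_add_cancel]
  · rintro ⟨i, j⟩ h _ e
    simp only [Finset.mem_sigma, Finset.mem_erase] at h
    simp only [Sigma.mk.injEq] at e
    exact h.2.1 e.1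
  · rintro ⟨i, j⟩ h
    simp only [Finset.mem_sigma, Finset.mem_erase] at h ⊢
    exact ⟨h.2.2, Ne.symm h.2.1, h.1⟩
  · rintro ⟨i, j⟩ h
    rfl

/-- Contraction of a cochain against the vertex `j`: the homotopy that contracts the cochains of a
cone with apex `j`. -/
def contraction (j : ι) (c : Finset ι → E) (σ : Finset ι) : E :=
  if j ∈ σ then 0 else faceSign j σ • c (insert j σ)

lemma coboundary_contraction_of_mem {j : ι} {τ : Finset ι} (hj : j ∈ τ) (c : Finset ι → E) :
    coboundary (contraction j c) τ = c τ := by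
  rw [coboundary_apply, Finset.sum_eq_single j]
  · have h : faceSign j (τ.erase j) = faceSign j τ := by
      conv_rhs => rw [← Finset.insert_erase hj, faceSign_insert (by simp)]
      simp
    simp [contraction, Finset.insert_erase hj, smul_smul, h, faceSign_mul_self]
  · intro i _ hij
    simp [contraction, hj, hij.symm]
  · exact fun h => absurd hj h

lemma coboundary_contraction_of_notMem {j : ι} {τ : Finset ι} (hj : j ∉ τ) (c : Finset ι → E) :
    coboundary (contraction j c) τ = c τ - faceSign j τ • coboundary c (insert j τ) := by
  rw [coboundary_apply (c := c), Finset.sum_insert hj, Finset.erase_insert hj, faceSign_insert hj,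
    if_neg (lt_irrefl j), smul_add, smul_smul, faceSign_mul_self, one_smul, sub_add_cancel_left,
    coboundary_apply, Finset.smul_sum, ← Finset.sum_neg_distrib]
  refine Finset.sum_congr rfl fun i hi => ?_
  have hij : i ≠ j := fun h => hj (h ▸ hi)
  have hj' : j ∉ τ.erase i := fun h => hj (Finset.mem_of_mem_erase h)
  have h := faceSign_swap (i := i) (j := j) (τ := insert j τ) (by simp [hi]) (by simp) hij
  have h1 : faceSign j (insert j (τ.erase i)) = faceSign j (τ.erase i) := by
    rw [faceSign_insert hj', if_neg (lt_irrefl j)]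
  have h2 : faceSign j (insert j τ) = faceSign j τ := by
    rw [faceSign_insert hj, if_neg (lt_irrefl j)]
  rw [Finset.erase_insert hj, Finset.erase_insert_of_ne hij.symm, h1, h2] at h
  rw [contraction, if_neg hj', Finset.erase_insert_of_ne hij.symm, smul_smul, smul_smul,
    ← neg_smul]
  congr 1
  have hs := faceSign_mul_self i τ
  have ht := faceSign_mul_self i (insert j τ)
  rw [faceSign_insert hj] at h ht ⊢
  split_ifs at h ht ⊢ with hlt
  · linear_combination (-1 : ℤ) * h
  · linear_combination h

end Coboundary

end

end LinearSyzygies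

namespace LinearSyzygies

noncomputable section

attribute [local instance] MvPolynomial.gradedAlgebra

/-! ### Graded families and their sections over the standard open sets -/

section Families

variable {k : Type u} [Field k] {n : ℕ} {E : Type*} [AddCommGroup E]
  [Module (CoordRing k n) E]

/-- A graded module over `k[x_0, …, x_n]` whose homogeneous pieces lie in a fixed module `E`. The
pieces need not be independent in `E`: only the action of forms on them is recorded. -/
structure GradedFamily (k : Type u) [Field k] (n : ℕ) (E : Type*) [AddCommGroup E]
    [Module (CoordRing k n) E] where
  piece : ℤ → AddSubgroup E
  smul_mem : ∀ {d : ℤ} {e : ℕ} {f : CoordRing k n} {x : E},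
    f ∈ grading k n e → x ∈ piece d → f • x ∈ piece (d + e)

namespace GradedFamily

instance : LE (GradedFamily k n E) := ⟨fun U V => ∀ d, U.piece d ≤ V.piece d⟩

instance : Bot (GradedFamily k n E) := ⟨⟨fun _ => ⊥, by
  intro d e f x _ hx
  rw [AddSubgroup.mem_bot] at hx ⊢
  rw [hx, smul_zero]⟩⟩

lemma bot_le (V : GradedFamily k n E) : ⊥ ≤ V := fun d x hx => by
  rw [(AddSubgroup.mem_bot.1 hx : x = 0)]; exact zero_mem _

variable (V : GradedFamily k n E)

lemma mem_piece_of_eq {d d' : ℤ} (h : d = d') {x : E} (hx : x ∈ V.piece d) : x ∈ V.piece d' :=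
  h ▸ hx

lemma X_smul_mem {d : ℤ} {x : E} (i : Fin (n + 1)) (hx : x ∈ V.piece d) :
    (X i : CoordRing k n) • x ∈ V.piece (d + 1) :=
  V.mem_piece_of_eq (by simp) (V.smul_mem (X_mem_grading i) hx)

lemma faceMonomial_pow_mem (σ : Finset (Fin (n + 1))) (N : ℕ) :
    faceMonomial k σ ^ N ∈ grading k n (N * σ.card) := by
  simpa using SetLike.pow_mem_graded N (faceMonomial_mem (k := k) σ)

lemma pow_smul_mem_of_le {σ : Finset (Fin (n + 1))} {d : ℤ} {N M : ℕ} {x : E} (h : N ≤ M)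
    (hx : faceMonomial k σ ^ N • x ∈ V.piece (d + (N * σ.card : ℕ))) :
    faceMonomial k σ ^ M • x ∈ V.piece (d + (M * σ.card : ℕ)) := by
  obtain ⟨L, rfl⟩ := Nat.exists_eq_add_of_le' h
  rw [pow_add, mul_smul]
  refine V.mem_piece_of_eq ?_ (V.smul_mem (faceMonomial_pow_mem σ L) hx)
  push_cast; ring

/-- The sections in degree `d` over `⋂_{i ∈ σ} D₊(x_i)` of the module `V`: those elements of `E`
that are carried into `V` by a power of `∏_{i ∈ σ} x_i`. This is the localization of `V` when the
variables act bijectively on `E`. -/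
def sections (σ : Finset (Fin (n + 1))) (d : ℤ) : AddSubgroup E where
  carrier := {x | ∃ N : ℕ, faceMonomial k σ ^ N • x ∈ V.piece (d + (N * σ.card : ℕ))}
  zero_mem' := ⟨0, by rw [smul_zero]; exact zero_mem _⟩
  add_mem' := by
    rintro x y ⟨N, hN⟩ ⟨M, hM⟩
    refine ⟨N + M, ?_⟩
    rw [smul_add]
    exact add_mem (V.pow_smul_mem_of_le (by omega) hN) (V.pow_smul_mem_of_le (by omega) hM)
  neg_mem' := by
    rintro x ⟨N, hN⟩
    exact ⟨N, by rw [smul_neg]; exact neg_mem hN⟩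

variable {V}

lemma mem_sections {σ : Finset (Fin (n + 1))} {d : ℤ} {x : E} : x ∈ V.sections σ d ↔
    ∃ N : ℕ, faceMonomial k σ ^ N • x ∈ V.piece (d + (N * σ.card : ℕ)) := Iff.rfl

lemma mem_sections_empty {d : ℤ} {x : E} : x ∈ V.sections ∅ d ↔ x ∈ V.piece d := by
  simp [mem_sections, faceMonomial]

lemma piece_le_sections (σ : Finset (Fin (n + 1))) (d : ℤ) : V.piece d ≤ V.sections σ d :=
  fun x hx => ⟨0, by simpa using hx⟩

lemma sections_mono {U : GradedFamily k n E} (h : U ≤ V) (σ : Finset (Fin (n + 1))) (d : ℤ) :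
    U.sections σ d ≤ V.sections σ d := fun _ ⟨N, hN⟩ => ⟨N, h _ hN⟩

lemma sections_face_mono {σ τ : Finset (Fin (n + 1))} (h : σ ⊆ τ) (d : ℤ) :
    V.sections σ d ≤ V.sections τ d := by
  rintro x ⟨N, hN⟩
  refine ⟨N, ?_⟩
  have h1 : faceMonomial k τ = faceMonomial k (τ \ σ) * faceMonomial k σ :=
    (Finset.prod_sdiff h).symm
  rw [h1, mul_pow, mul_smul]
  refine V.mem_piece_of_eq ?_ (V.smul_mem (faceMonomial_pow_mem (τ \ σ) N) hN)
  have := Finset.card_sdiff_add_card_eq_card h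
  rw [← this]; push_cast; ring

lemma smul_mem_sections {σ : Finset (Fin (n + 1))} {d : ℤ} {e : ℕ} {f : CoordRing k n} {x : E}
    (hf : f ∈ grading k n e) (hx : x ∈ V.sections σ d) : f • x ∈ V.sections σ (d + e) := by
  obtain ⟨N, hN⟩ := hx
  refine ⟨N, ?_⟩
  rw [smul_comm]
  exact V.mem_piece_of_eq (by ring) (V.smul_mem hf hN)

lemma X_pow_mem_grading (i : Fin (n + 1)) (N : ℕ) : (X i ^ N : CoordRing k n) ∈ grading k n N := by
  simpa using SetLike.pow_mem_graded N (X_mem_grading (k := k) i)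

/-- A section over a smaller open set extends after multiplication by a power of the variable. -/
lemma exists_pow_smul_mem_sections {σ : Finset (Fin (n + 1))} {j : Fin (n + 1)} (hj : j ∉ σ)
    {d : ℤ} {x : E} (hx : x ∈ V.sections (insert j σ) d) :
    ∃ N₀ : ℕ, ∀ N ≥ N₀, (X j ^ N : CoordRing k n) • x ∈ V.sections σ (d + N) := by
  obtain ⟨N₀, hN₀⟩ := hx
  refine ⟨N₀, fun N hN => ⟨N₀, ?_⟩⟩
  obtain ⟨L, rfl⟩ := Nat.exists_eq_add_of_le' hN
  have h1 : faceMonomial k (insert j σ) = X j * faceMonomial k σ := Finset.prod_insert hj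
  have h2 : (faceMonomial k σ ^ N₀) • (X j ^ (L + N₀) : CoordRing k n) • x =
      (X j ^ L : CoordRing k n) • (faceMonomial k (insert j σ)) ^ N₀ • x := by
    rw [h1, smul_smul, smul_smul]; congr 1; ring
  rw [h2]
  refine V.mem_piece_of_eq ?_ (V.smul_mem (X_pow_mem_grading j L) hN₀)
  rw [Finset.card_insert_of_notMem hj]; push_cast; ring

lemma coboundary_mem_sections {c : Finset (Fin (n + 1)) → E} {q : ℕ} {d : ℤ}
    (hc : ∀ σ, σ.card = q → c σ ∈ V.sections σ d) {τ : Finset (Fin (n + 1))}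
    (hτ : τ.card = q + 1) : coboundary c τ ∈ V.sections τ d := by
  rw [coboundary_apply]
  refine sum_mem fun i hi => zsmul_mem ?_ _
  exact sections_face_mono (Finset.erase_subset _ _) _
    (hc _ (by rw [Finset.card_erase_of_mem hi, hτ]; rfl))

end GradedFamily

/-! ### Relative acyclicity -/

open GradedFamily

/-- The cochain `c` in degree `q`, with values in the sections of `V` of degree `d`, is a
coboundary modulo the sections of `U`. Cochains are indexed by all finite sets of vertices, and the
degree `q` is the number of vertices, so that the augmented Čech complex is meant. -/
def IsCoboundary (U V : GradedFamily k n E) (q : ℕ) (d : ℤ) (c : Finset (Fin (n + 1)) → E) : Prop :=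
  ∃ e : Finset (Fin (n + 1)) → E, (∀ σ, σ.card + 1 = q → e σ ∈ V.sections σ d) ∧
    ∀ σ, σ.card = q → c σ - coboundary e σ ∈ U.sections σ d

/-- The cohomology of the augmented Čech complex of `V / U` vanishes for sets of `q` vertices and in
degree `d`; for `q ≥ 2` this says `H^{q-1}(ℙⁿ, (V/U)^~(d)) = 0`. -/
def Acyclic (U V : GradedFamily k n E) (q : ℕ) (d : ℤ) : Prop :=
  ∀ c : Finset (Fin (n + 1)) → E, (∀ σ, σ.card = q → c σ ∈ V.sections σ d) →
    (∀ τ, τ.card = q + 1 → coboundary c τ ∈ U.sections τ d) → IsCoboundary U V q d c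

lemma Acyclic.trans {U W V : GradedFamily k n E} (hUW : U ≤ W) (hWV : W ≤ V) {q : ℕ} {d : ℤ}
    (h₁ : Acyclic U W q d) (h₂ : Acyclic W V q d) : Acyclic U V q d := by
  intro c hc hδ
  obtain ⟨e, he, hce⟩ := h₂ c hc fun τ hτ => sections_mono hUW _ _ (hδ τ hτ)
  obtain ⟨e', he', hce'⟩ := h₁ (c - coboundary e) hce fun τ hτ => by
    rw [map_sub, coboundary_coboundary, sub_zero]; exact hδ τ hτ
  refine ⟨e + e', fun σ hσ => add_mem (he σ hσ) (sections_mono hWV _ _ (he' σ hσ)),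
    fun σ hσ => ?_⟩
  have := hce' σ hσ
  rwa [Pi.sub_apply, sub_sub, ← Pi.add_apply, ← map_add] at this

lemma Acyclic.of_card_lt {U V : GradedFamily k n E} {q : ℕ} (d : ℤ) (hq : n + 1 < q) :
    Acyclic U V q d := fun c _ _ => by
  have h : ∀ σ : Finset (Fin (n + 1)), σ.card ≤ n + 1 := fun σ => by
    simpa using Finset.card_le_univ σ
  exact ⟨0, fun σ _ => zero_mem _, fun σ hσ => by have := h σ; omega⟩

lemma Acyclic.of_sections_le {U V : GradedFamily k n E} {q : ℕ} {d : ℤ}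
    (h : ∀ σ : Finset (Fin (n + 1)), σ.card = q → V.sections σ d ≤ U.sections σ d) :
    Acyclic U V q d := fun c hc _ =>
  ⟨0, fun σ _ => zero_mem _, fun σ hσ => by simpa using h σ hσ (hc σ hσ)⟩

/-- Every Čech cohomology class is killed by a power of each variable. -/
lemma exists_isCoboundary_pow_smul {U V : GradedFamily k n E} (j : Fin (n + 1))
    {q : ℕ} {d : ℤ} {c : Finset (Fin (n + 1)) → E}
    (hc : ∀ σ, σ.card = q → c σ ∈ V.sections σ d)
    (hδ : ∀ τ, τ.card = q + 1 → coboundary c τ ∈ U.sections τ d) :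
    ∃ N : ℕ, IsCoboundary U V q (d + N) (fun σ => (X j ^ N : CoordRing k n) • c σ) := by
  have h1 : ∀ σ : Finset (Fin (n + 1)), ∃ N₀ : ℕ, ∀ N ≥ N₀, j ∉ σ → σ.card + 1 = q →
      (X j ^ N : CoordRing k n) • c (insert j σ) ∈ V.sections σ (d + N) := by
    intro σ
    by_cases h : j ∉ σ ∧ σ.card + 1 = q
    · obtain ⟨N₀, hN₀⟩ := exists_pow_smul_mem_sections h.1
        (hc (insert j σ) (by rw [Finset.card_insert_of_notMem h.1, h.2]))
      exact ⟨N₀, fun N hN _ _ => hN₀ N hN⟩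
    · exact ⟨0, fun N _ h1 h2 => absurd ⟨h1, h2⟩ h⟩
  have h2 : ∀ σ : Finset (Fin (n + 1)), ∃ N₀ : ℕ, ∀ N ≥ N₀, j ∉ σ → σ.card = q →
      (X j ^ N : CoordRing k n) • coboundary c (insert j σ) ∈ U.sections σ (d + N) := by
    intro σ
    by_cases h : j ∉ σ ∧ σ.card = q
    · obtain ⟨N₀, hN₀⟩ := exists_pow_smul_mem_sections h.1
        (hδ (insert j σ) (by rw [Finset.card_insert_of_notMem h.1, h.2]))
      exact ⟨N₀, fun N hN _ _ => hN₀ N hN⟩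
    · exact ⟨0, fun N _ h1 h2 => absurd ⟨h1, h2⟩ h⟩
  choose A hA using h1
  choose B hB using h2
  let N := Finset.univ.sup A + Finset.univ.sup B
  have hAN : ∀ σ, A σ ≤ N := fun σ =>
    (Finset.le_sup (Finset.mem_univ σ)).trans (Nat.le_add_right _ _)
  have hBN : ∀ σ, B σ ≤ N := fun σ =>
    (Finset.le_sup (Finset.mem_univ σ)).trans (Nat.le_add_left _ _)
  have hcb : ∀ τ, coboundary (fun σ => (X j ^ N : CoordRing k n) • contraction j c σ) τ =
      (X j ^ N : CoordRing k n) • coboundary (contraction j c) τ := fun τ =>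
    coboundary_comp (DistribSMul.toAddMonoidHom E (X j ^ N : CoordRing k n)) _ τ
  refine ⟨N, fun σ => (X j ^ N : CoordRing k n) • contraction j c σ, fun σ hσ => ?_,
    fun τ hτ => ?_⟩
  · dsimp only
    by_cases hj : j ∈ σ
    · rw [contraction, if_pos hj, smul_zero]; exact zero_mem _
    · rw [contraction, if_neg hj, smul_comm]
      exact zsmul_mem (hA σ N (hAN σ) hj hσ) _
  · rw [hcb]
    by_cases hj : j ∈ τ
    · rw [coboundary_contraction_of_mem hj, sub_self]; exact zero_mem _
    · rw [coboundary_contraction_of_notMem hj, smul_sub, sub_sub_cancel, smul_comm]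
      exact zsmul_mem (hB τ N (hBN τ) hj hτ) _

/-- The graded family `U + x_j V`. -/
def GradedFamily.supSMul (U V : GradedFamily k n E) (j : Fin (n + 1)) : GradedFamily k n E where
  piece d := U.piece d ⊔
    (V.piece (d - 1)).map (DistribSMul.toAddMonoidHom E (X j : CoordRing k n))
  smul_mem := by
    intro d e f x hf hx
    obtain ⟨u, hu, _, ⟨v, hv, rfl⟩, rfl⟩ := AddSubgroup.mem_sup.1 hx
    rw [smul_add]
    refine AddSubgroup.add_mem_sup (U.smul_mem hf hu) ⟨f • v, ?_, smul_comm _ _ _⟩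
    exact V.mem_piece_of_eq (by ring) (V.smul_mem hf hv)

lemma GradedFamily.mem_supSMul {U V : GradedFamily k n E} {j : Fin (n + 1)} {d : ℤ} {x : E} :
    x ∈ (U.supSMul V j).piece d ↔
      ∃ u ∈ U.piece d, ∃ v ∈ V.piece (d - 1), x = u + (X j : CoordRing k n) • v := by
  constructor
  · intro hx
    obtain ⟨u, hu, _, ⟨v, hv, rfl⟩, rfl⟩ := AddSubgroup.mem_sup.1 hx
    exact ⟨u, hu, v, hv, rfl⟩
  · rintro ⟨u, hu, v, hv, rfl⟩
    exact AddSubgroup.add_mem_sup hu ⟨v, hv, rfl⟩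

lemma GradedFamily.le_supSMul (U V : GradedFamily k n E) (j : Fin (n + 1)) :
    U ≤ U.supSMul V j := fun d => le_sup_left (a := U.piece d)

lemma GradedFamily.supSMul_le {U V : GradedFamily k n E} (h : U ≤ V) (j : Fin (n + 1)) :
    U.supSMul V j ≤ V := by
  intro d x hx
  obtain ⟨u, hu, v, hv, rfl⟩ := mem_supSMul.1 hx
  exact add_mem (h _ hu) (V.mem_piece_of_eq (by ring) (V.X_smul_mem j hv))

lemma GradedFamily.X_smul_mem_sections_supSMul {U V : GradedFamily k n E} {j : Fin (n + 1)}
    {σ : Finset (Fin (n + 1))} {d : ℤ} {x : E} (hx : x ∈ V.sections σ d) :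
    (X j : CoordRing k n) • x ∈ (U.supSMul V j).sections σ (d + 1) := by
  obtain ⟨N, hN⟩ := hx
  refine ⟨N, mem_supSMul.2 ⟨0, zero_mem _, _, V.mem_piece_of_eq ?_ hN, ?_⟩⟩
  · ring
  · rw [zero_add, smul_comm]

end Families

/-! ### Multiplication by a variable -/

section Regular

variable {k : Type u} [Field k] {n : ℕ} {E : Type*} [AddCommGroup E]
  [Module (CoordRing k n) E] [Module (FracField k n) E]
  [IsScalarTower (CoordRing k n) (FracField k n) E]

open GradedFamily

lemma smul_left_cancel_of_ne_zero {f : CoordRing k n} (hf : f ≠ 0) {x y : E}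
    (h : f • x = f • y) : x = y := by
  rw [← algebraMap_smul (FracField k n) f x, ← algebraMap_smul (FracField k n) f y] at h
  exact (smul_right_injective E (isUnit_algebraMap hf).ne_zero) h

lemma exists_smul_eq_of_ne_zero {f : CoordRing k n} (hf : f ≠ 0) (x : E) : ∃ z : E, f • z = x :=
  ⟨(algebraMap _ (FracField k n) f)⁻¹ • x, by
    rw [← algebraMap_smul (FracField k n) f, smul_smul,
      mul_inv_cancel₀ (isUnit_algebraMap hf).ne_zero, one_smul]⟩

lemma GradedFamily.exists_of_mem_sections_supSMul {U V : GradedFamily k n E} {j : Fin (n + 1)}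
    {σ : Finset (Fin (n + 1))} {d : ℤ} {x : E} (hx : x ∈ (U.supSMul V j).sections σ (d + 1)) :
    ∃ v ∈ V.sections σ d, x - (X j : CoordRing k n) • v ∈ U.sections σ (d + 1) := by
  obtain ⟨N, hN⟩ := hx
  obtain ⟨u, hu, v, hv, hx⟩ := mem_supSMul.1 hN
  have h0 : faceMonomial k σ ^ N ≠ 0 := pow_ne_zero _ (faceMonomial_ne_zero σ)
  obtain ⟨w, rfl⟩ := exists_smul_eq_of_ne_zero h0 v
  refine ⟨w, ⟨N, V.mem_piece_of_eq (by ring) hv⟩, ⟨N, ?_⟩⟩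
  rwa [smul_sub, hx, smul_comm (faceMonomial k σ ^ N), add_sub_cancel_right]

/-- If `x_j` is a nonzerodivisor on `V / U` and the cohomology of the cokernel of `x_j` on `V / U`
vanishes one step below and in all large degrees, then the cohomology of `V / U` vanishes: by the
long exact sequence `x_j` is injective on it, while every class is killed by a power of `x_j`. -/
lemma Acyclic.of_regular {U V : GradedFamily k n E} (j : Fin (n + 1))
    (hreg : ∀ d x, x ∈ V.piece d → (X j : CoordRing k n) • x ∈ U.piece (d + 1) → x ∈ U.piece d)
    {q : ℕ} {d : ℤ}
    (h : ∀ q', q' + 1 = q → ∀ d' ≥ d, Acyclic (U.supSMul V j) V q' (d' + 1)) :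
    Acyclic U V q d := by
  have hreg' : ∀ σ d x, x ∈ V.sections σ d → (X j : CoordRing k n) • x ∈ U.sections σ (d + 1) →
      x ∈ U.sections σ d := by
    rintro σ d x ⟨N, hN⟩ ⟨M, hM⟩
    refine ⟨N + M, hreg _ _ (V.pow_smul_mem_of_le (by omega) hN) ?_⟩
    rw [smul_comm]
    exact U.mem_piece_of_eq (by ring) (U.pow_smul_mem_of_le (M := N + M) (by omega) hM)
  have hX : ∀ (e : Finset (Fin (n + 1)) → E) τ,
      coboundary (fun σ => (X j : CoordRing k n) • e σ) τ =
        (X j : CoordRing k n) • coboundary e τ :=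
    fun e τ => coboundary_comp (DistribSMul.toAddMonoidHom E (X j : CoordRing k n)) _ τ
  -- `x_j` acts injectively on cohomology
  have key : ∀ d' ≥ d, ∀ c : Finset (Fin (n + 1)) → E,
      (∀ σ, σ.card = q → c σ ∈ V.sections σ d') →
      IsCoboundary U V q (d' + 1) (fun σ => (X j : CoordRing k n) • c σ) →
      IsCoboundary U V q d' c := by
    rintro d' hd' c hc ⟨e, he, hce⟩
    obtain _ | q := q
    · refine ⟨0, fun σ _ => zero_mem _, fun σ hσ => ?_⟩
      obtain rfl := Finset.card_eq_zero.1 hσ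
      have := hce ∅ hσ
      rw [coboundary_apply, Finset.sum_empty, sub_zero] at this
      simpa using hreg' _ _ _ (hc ∅ hσ) this
    · obtain ⟨e₂, he₂, hee₂⟩ := h q rfl d' hd' e (fun σ hσ => he σ (by rw [hσ])) fun τ hτ => by
        have h1 := X_smul_mem_sections_supSMul (U := U) (j := j) (hc τ hτ)
        have h2 := sections_mono (U.le_supSMul V j) _ _ (hce τ hτ)
        simpa using sub_mem h1 h2
      have h3 : ∀ σ : Finset (Fin (n + 1)), ∃ v : E, σ.card = q → v ∈ V.sections σ d' ∧
          (e - coboundary e₂) σ - (X j : CoordRing k n) • v ∈ U.sections σ (d' + 1) := by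
        intro σ
        by_cases hσ : σ.card = q
        · obtain ⟨v, hv, hv'⟩ := exists_of_mem_sections_supSMul (hee₂ σ hσ)
          exact ⟨v, fun _ => ⟨hv, hv'⟩⟩
        · exact ⟨0, fun h => absurd h hσ⟩
      choose e₃ he₃ using h3
      refine ⟨e₃, fun σ hσ => (he₃ σ (by omega)).1, fun τ hτ => ?_⟩
      refine hreg' _ _ _ (sub_mem (hc τ hτ) (coboundary_mem_sections
        (fun σ hσ => (he₃ σ hσ).1) hτ)) ?_
      have h4 := add_mem (hce τ hτ) (coboundary_mem_sections
        (c := e - coboundary e₂ - fun σ => (X j : CoordRing k n) • e₃ σ)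
        (fun σ hσ => (he₃ σ hσ).2) hτ)
      rw [map_sub, map_sub, coboundary_coboundary, sub_zero, Pi.sub_apply, hX,
        sub_add_sub_cancel] at h4
      rwa [smul_sub]
  intro c hc hδ
  obtain ⟨N, hN⟩ := exists_isCoboundary_pow_smul j hc hδ
  clear hδ
  induction N with
  | zero => simpa using hN
  | succ N ih =>
    refine ih (key (d + N) (by omega) _ (fun σ hσ => ?_) ?_)
    · exact smul_mem_sections (X_pow_mem_grading j N) (hc σ hσ)
    · have e1 : d + (N + 1 : ℕ) = d + N + 1 := by push_cast; ring
      rw [e1] at hN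
      simpa only [smul_smul, ← pow_succ'] using hN

end Regular

end

end LinearSyzygies

namespace LinearSyzygies

noncomputable section

attribute [local instance] MvPolynomial.gradedAlgebra

/-! ### Vanishing above the dimension of the support -/

section Devissage

variable {k : Type u} [Field k] {n : ℕ} {E : Type*} [AddCommGroup E]
  [Module (CoordRing k n) E]

open GradedFamily

lemma coe_decompose_eq_homogeneousComponent (f : CoordRing k n) (i : ℕ) :
    (DirectSum.decompose (grading k n) f i : CoordRing k n) = homogeneousComponent i f :=
  decomposition.decompose'_apply f i

lemma homogeneousComponent_mul_of_mem {i : ℕ} {g : CoordRing k n} (hg : g ∈ grading k n i)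
    (f : CoordRing k n) (e : ℕ) : homogeneousComponent e (g * f) =
      if i ≤ e then g * homogeneousComponent (e - i) f else 0 := by
  have h := DirectSum.coe_decompose_mul_of_left_mem (b := f) (grading k n) e hg
  simpa only [coe_decompose_eq_homogeneousComponent] using h

/-- The ideal of those `f` all of whose homogeneous components carry `x`, regarded as an element of
degree `d`, into `U`. -/
def GradedFamily.colon (U : GradedFamily k n E) (d : ℤ) (x : E) : Ideal (CoordRing k n) where
  carrier := {f | ∀ e : ℕ, homogeneousComponent e f • x ∈ U.piece (d + e)}
  zero_mem' e := by rw [map_zero, zero_smul]; exact zero_mem _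
  add_mem' hf hg e := by rw [map_add, add_smul]; exact add_mem (hf e) (hg e)
  smul_mem' g f hf e := by
    rw [smul_eq_mul, ← sum_homogeneousComponent g, Finset.sum_mul, map_sum, Finset.sum_smul]
    refine sum_mem fun i _ => ?_
    rw [homogeneousComponent_mul_of_mem (homogeneousComponent_mem i g)]
    split_ifs with h
    · rw [mul_smul]
      refine U.mem_piece_of_eq ?_ (U.smul_mem (homogeneousComponent_mem i g) (hf (e - i)))
      omega
    · rw [zero_smul]; exact zero_mem _

lemma GradedFamily.mem_colon {U : GradedFamily k n E} {d : ℤ} {x : E} {f : CoordRing k n} :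
    f ∈ U.colon d x ↔ ∀ e : ℕ, homogeneousComponent e f • x ∈ U.piece (d + e) := Iff.rfl

lemma GradedFamily.mem_colon_iff {U : GradedFamily k n E} {d : ℤ} {x : E} {f : CoordRing k n}
    {e : ℕ} (hf : f ∈ grading k n e) : f ∈ U.colon d x ↔ f • x ∈ U.piece (d + e) := by
  rw [mem_colon]
  constructor
  · intro h
    simpa [homogeneousComponent_of_mem hf] using h e
  · intro h e'
    rw [homogeneousComponent_of_mem hf]
    split_ifs with he
    · rwa [he]
    · rw [zero_smul]; exact zero_mem _

lemma GradedFamily.colon_mono {U W : GradedFamily k n E} (h : U ≤ W) (d : ℤ) (x : E) :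
    U.colon d x ≤ W.colon d x := fun _ hf e => h _ (hf e)

lemma GradedFamily.colon_le_colon_smul (U : GradedFamily k n E) {d : ℤ} {x : E} {e : ℕ}
    {f : CoordRing k n} (hf : f ∈ grading k n e) : U.colon d x ≤ U.colon (d + e) (f • x) := by
  intro g hg i
  rw [smul_comm]
  exact U.mem_piece_of_eq (by ring) (U.smul_mem hf (hg i))

lemma GradedFamily.colon_inf_le (U : GradedFamily k n E) (d : ℤ) (x y : E) :
    U.colon d x ⊓ U.colon d y ≤ U.colon d (x + y) := by
  rintro g ⟨hx, hy⟩ i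
  rw [smul_add]
  exact add_mem (hx i) (hy i)

lemma GradedFamily.colon_eq_top {U : GradedFamily k n E} {d : ℤ} {x : E} (hx : x ∈ U.piece d) :
    U.colon d x = ⊤ := by
  rw [Ideal.eq_top_iff_one, mem_colon_iff (SetLike.one_mem_graded (grading k n))]
  simpa using hx

/-- The elements of `V` that are carried into `U` by a power of `a`. -/
def GradedFamily.torsion (U V : GradedFamily k n E) (a : CoordRing k n) : GradedFamily k n E where
  piece d :=
    { carrier := {x | x ∈ V.piece d ∧ a ∈ (U.colon d x).radical}
      zero_mem' := ⟨zero_mem _, by rw [colon_eq_top (zero_mem _), Ideal.radical_top]; trivial⟩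
      add_mem' := by
        rintro x y ⟨hx, hx'⟩ ⟨hy, hy'⟩
        refine ⟨add_mem hx hy, Ideal.radical_mono (U.colon_inf_le d x y) ?_⟩
        rw [Ideal.radical_inf]
        exact ⟨hx', hy'⟩
      neg_mem' := by
        rintro x ⟨hx, hx'⟩
        refine ⟨neg_mem hx, Ideal.radical_mono (fun g hg i => ?_) hx'⟩
        rw [smul_neg]
        exact neg_mem (hg i) }
  smul_mem hf hx := ⟨V.smul_mem hf hx.1, Ideal.radical_mono (U.colon_le_colon_smul hf) hx.2⟩

lemma GradedFamily.torsion_le (U V : GradedFamily k n E) (a : CoordRing k n) :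
    U.torsion V a ≤ V := fun _ _ hx => hx.1

lemma GradedFamily.le_torsion {U V : GradedFamily k n E} (h : U ≤ V) (a : CoordRing k n) :
    U ≤ U.torsion V a := fun _ _ hx => ⟨h _ hx, by
  rw [colon_eq_top hx, Ideal.radical_top]; trivial⟩

lemma isHomogeneous_sup_span_singleton {A : Ideal (CoordRing k n)}
    (hA : A.IsHomogeneous (grading k n)) {a : CoordRing k n} {e : ℕ} (ha : a ∈ grading k n e) :
    (A ⊔ Ideal.span {a}).IsHomogeneous (grading k n) :=
  hA.sup (Ideal.homogeneous_span _ _ fun x hx => by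
    rw [Set.mem_singleton_iff.1 hx]; exact ⟨e, ha⟩)

variable [Module (FracField k n) E] [IsScalarTower (CoordRing k n) (FracField k n) E]

/-- The inductive step of `acyclic_of_torsion`: the case of smaller dimension is the hypothesis
`ih`, and the ideal is treated by Noetherian induction. -/
lemma acyclic_of_torsion_step (D : ℕ) (ih : ∀ D', D' + 1 = D → ∀ A : Ideal (CoordRing k n),
      A.IsHomogeneous (grading k n) →
      (∀ s : LTSeries (ProjectiveSpectrum (grading k n)),
        A ≤ s.head.asHomogeneousIdeal.toIdeal → s.length < D') →
      ∀ U V : GradedFamily k n E, U ≤ V →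
      (∀ d x, x ∈ V.piece d → A ≤ (U.colon d x).radical) →
      ∀ q, D' < q → ∀ d : ℤ, Acyclic U V q d)
    (A : Ideal (CoordRing k n)) (hA : A.IsHomogeneous (grading k n))
    (hchain : ∀ s : LTSeries (ProjectiveSpectrum (grading k n)),
      A ≤ s.head.asHomogeneousIdeal.toIdeal → s.length < D)
    (U V : GradedFamily k n E) (hUV : U ≤ V)
    (htors : ∀ d x, x ∈ V.piece d → A ≤ (U.colon d x).radical)
    (q : ℕ) (hq : D < q) (d : ℤ) : Acyclic U V q d := by
  induction A using WellFoundedGT.induction generalizing U V d with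
  | ind A ihA =>
  have hlt : ∀ {a}, a ∉ A → A < A ⊔ Ideal.span {a} := fun {a} ha =>
    lt_of_le_of_ne le_sup_left fun h => ha (by
      rw [h]; exact Ideal.mem_sup_right (Ideal.mem_span_singleton_self a))
  have hchain' : ∀ a, ∀ s : LTSeries (ProjectiveSpectrum (grading k n)),
      A ⊔ Ideal.span {a} ≤ s.head.asHomogeneousIdeal.toIdeal → s.length < D :=
    fun a s hs => hchain s (le_sup_left.trans hs)
  by_cases hirr : ∀ i, X i ∈ A
  · -- `V / U` is supported at the vertex of the cone and has no sections on the `D₊(x_i)`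
    refine Acyclic.of_sections_le fun σ hσ x hx => ?_
    obtain ⟨i, hi⟩ : σ.Nonempty := Finset.card_pos.1 (by omega)
    have hm : faceMonomial k σ ∈ A :=
      Ideal.mem_of_dvd A (Finset.dvd_prod_of_mem _ hi) (hirr i)
    obtain ⟨N, hN⟩ := hx
    obtain ⟨M, hM⟩ := htors _ _ hN hm
    rw [mem_colon_iff (faceMonomial_pow_mem σ M), smul_smul, ← pow_add] at hM
    exact ⟨M + N, U.mem_piece_of_eq (by push_cast; ring) hM⟩
  obtain ⟨j, hj⟩ := not_forall.1 hirr
  by_cases hprime : A.IsPrime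
  · let p : ProjectiveSpectrum (grading k n) := ⟨⟨A, hA⟩, hprime, fun h =>
      hj (h (HomogeneousIdeal.mem_irrelevant_of_mem _ one_pos (X_mem_grading j)))⟩
    have hcons : ∀ s : LTSeries (ProjectiveSpectrum (grading k n)),
        A ⊔ Ideal.span {X j} ≤ s.head.asHomogeneousIdeal.toIdeal → s.length + 1 < D := by
      intro s hs
      have hp : p < s.head := (hlt hj).trans_le hs
      simpa using hchain (s.cons p hp) (by simp [p])
    refine Acyclic.trans (U.le_torsion hUV (X j)) (U.torsion_le V (X j))
      (ihA _ (hlt hj) (isHomogeneous_sup_span_singleton hA (X_mem_grading j)) (hchain' _) _ _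
        (U.le_torsion hUV (X j)) (fun d x hx => sup_le (htors d x hx.1) ?_) d)
      (Acyclic.of_regular j ?_ ?_)
    · rw [Ideal.span_singleton_le_iff_mem]; exact hx.2
    · rintro d x hx ⟨-, N, hN⟩
      rw [mem_colon_iff (X_pow_mem_grading j N), smul_smul, ← pow_succ] at hN
      refine ⟨hx, N + 1, (mem_colon_iff (X_pow_mem_grading j (N + 1))).2 ?_⟩
      exact U.mem_piece_of_eq (by push_cast; ring) hN
    · rintro q' rfl d' -
      obtain _ | D := D
      · exact absurd (hchain (RelSeries.singleton _ p) le_rfl) (by simp)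
      · refine ih D rfl _ (isHomogeneous_sup_span_singleton hA (X_mem_grading j))
          (fun s hs => by have := hcons s hs; omega) _ _ (supSMul_le (U.torsion_le V _) j)
          (fun d x hx => sup_le ((htors d x hx).trans (Ideal.radical_mono (colon_mono
            (fun d x hx => le_supSMul _ _ _ _ (U.le_torsion hUV _ _ hx)) d x))) ?_)
          q' (by omega) _
        rw [Ideal.span_singleton_le_iff_mem]
        refine Ideal.le_radical ((mem_colon_iff (X_mem_grading j)).2
          (mem_supSMul.2 ⟨0, zero_mem _, x, V.mem_piece_of_eq (by simp) hx, by simp⟩))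
  · obtain ⟨a, b, e, e', ha, hb, hab, haA, hbA⟩ : ∃ a b, ∃ e e', a ∈ grading k n e ∧
        b ∈ grading k n e' ∧ a * b ∈ A ∧ a ∉ A ∧ b ∉ A := by
      by_contra! h
      refine hprime (hA.isPrime_of_homogeneous_mem_or_mem
        (fun h => hj (h ▸ Submodule.mem_top)) ?_)
      rintro x y ⟨e, he⟩ ⟨e', he'⟩ hxy
      by_cases hx : x ∈ A
      · exact Or.inl hx
      · exact Or.inr (h x y e e' he he' hxy hx)
    refine Acyclic.trans (U.le_torsion hUV a) (U.torsion_le V a)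
      (ihA _ (hlt haA) (isHomogeneous_sup_span_singleton hA ha) (hchain' _) _ _
        (U.le_torsion hUV a) (fun d x hx => sup_le (htors d x hx.1) ?_) d)
      (ihA _ (hlt hbA) (isHomogeneous_sup_span_singleton hA hb) (hchain' _) _ _
        (U.torsion_le V a) (fun d x hx => sup_le ((htors d x hx).trans
          (Ideal.radical_mono (colon_mono (U.le_torsion hUV a) d x))) ?_) d)
    · rw [Ideal.span_singleton_le_iff_mem]; exact hx.2
    · rw [Ideal.span_singleton_le_iff_mem]
      obtain ⟨N, hN⟩ := htors d x hx hab
      have haN : a ^ N ∈ grading k n (N * e) := by simpa using SetLike.pow_mem_graded N ha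
      have hbN : b ^ N ∈ grading k n (N * e') := by simpa using SetLike.pow_mem_graded N hb
      rw [mul_pow, mem_colon_iff (SetLike.mul_mem_graded haN hbN), mul_smul] at hN
      refine ⟨N, (mem_colon_iff hbN).2 ⟨V.smul_mem hbN hx, N, (mem_colon_iff haN).2 ?_⟩⟩
      exact U.mem_piece_of_eq (by push_cast; ring) hN

/-- Grothendieck vanishing: if every element of `V / U` is killed by powers of the elements of the
homogeneous ideal `A`, and chains of points in the closed subset of `ℙⁿ` defined by `A` have fewer
than `D + 1` members, then the sheaf of `V / U` has no cohomology in degrees `≥ D`.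

By Noetherian induction `A` may be taken to be prime: if `ab ∈ A`, then `V / U` is an extension of
the `b`-torsion module `V / T` by the `a`-torsion module `T / U`. For prime `A` and `x_j ∉ A`, the
`x_j`-torsion submodule is supported on a smaller closed set, and on the quotient by it `x_j` is
injective with a cokernel of smaller dimension. -/
theorem acyclic_of_torsion (D : ℕ) (A : Ideal (CoordRing k n))
    (hA : A.IsHomogeneous (grading k n))
    (hchain : ∀ s : LTSeries (ProjectiveSpectrum (grading k n)),
      A ≤ s.head.asHomogeneousIdeal.toIdeal → s.length < D)
    (U V : GradedFamily k n E) (hUV : U ≤ V)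
    (htors : ∀ d x, x ∈ V.piece d → A ≤ (U.colon d x).radical)
    (q : ℕ) (hq : D < q) (d : ℤ) : Acyclic U V q d := by
  induction D generalizing A U V q d with
  | zero =>
    exact acyclic_of_torsion_step 0 (fun D' h => absurd h (by omega)) A hA hchain U V hUV htors
      q hq d
  | succ D ih =>
    refine acyclic_of_torsion_step (D + 1) (fun D' h => ?_) A hA hchain U V hUV htors q hq d
    obtain rfl : D' = D := by omega
    exact ih

end Devissage

end

end LinearSyzygies

namespace LinearSyzygies

noncomputable section

attribute [local instance] MvPolynomial.gradedAlgebra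

/-! ### Ideals and free modules as graded families -/

section IdealFamily

variable {k : Type u} [Field k] {n : ℕ}

open GradedFamily

/-- The homogeneous component of degree `d ∈ ℤ` of a polynomial; it is zero for `d < 0`. -/
def intComponent (d : ℤ) : CoordRing k n →ₗ[k] CoordRing k n :=
  if 0 ≤ d then homogeneousComponent d.toNat else 0

lemma intComponent_natCast (e : ℕ) (f : CoordRing k n) :
    intComponent (e : ℤ) f = homogeneousComponent e f := by simp [intComponent]

lemma intComponent_of_neg {d : ℤ} (h : d < 0) (f : CoordRing k n) : intComponent d f = 0 := by
  simp [intComponent, h.not_ge]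

lemma intComponent_of_mem {e : ℕ} {f : CoordRing k n} (hf : f ∈ grading k n e) :
    intComponent (e : ℤ) f = f := by
  rw [intComponent_natCast, homogeneousComponent_of_mem hf, if_pos rfl]

lemma intComponent_mul {e : ℕ} {g : CoordRing k n} (hg : g ∈ grading k n e) (f : CoordRing k n)
    (d : ℤ) : intComponent (d + e) (g * f) = g * intComponent d f := by
  rcases lt_or_ge d 0 with hd | hd
  · rw [intComponent_of_neg hd, mul_zero]
    rcases lt_or_ge (d + e) 0 with hde | hde
    · rw [intComponent_of_neg hde]
    · obtain ⟨c, hc⟩ := Int.eq_ofNat_of_zero_le hde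
      rw [hc, intComponent_natCast, homogeneousComponent_mul_of_mem hg, if_neg (by omega)]
  · obtain ⟨c, rfl⟩ := Int.eq_ofNat_of_zero_le hd
    rw [← Nat.cast_add, intComponent_natCast, intComponent_natCast,
      homogeneousComponent_mul_of_mem hg, if_pos (by omega), Nat.add_sub_cancel]

lemma intComponent_idem (d : ℤ) (f : CoordRing k n) :
    intComponent d (intComponent d f) = intComponent d f := by
  rcases lt_or_ge d 0 with hd | hd
  · simp [intComponent_of_neg hd]
  · obtain ⟨c, rfl⟩ := Int.eq_ofNat_of_zero_le hd
    simp only [intComponent_natCast]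
    rw [homogeneousComponent_of_mem (homogeneousComponent_mem c f), if_pos rfl]

/-- A polynomial is homogeneous of degree `d ∈ ℤ` if it agrees with its component. -/
lemma mem_grading_of_intComponent_eq {e : ℕ} {f : CoordRing k n}
    (hf : intComponent (e : ℤ) f = f) : f ∈ grading k n e := by
  rw [← hf, intComponent_natCast]; exact homogeneousComponent_mem e f

lemma intComponent_mul_of_right {d : ℤ} {f : CoordRing k n} (hf : intComponent d f = f)
    (g : CoordRing k n) (e : ℕ) :
    intComponent (d + e) (g * f) = homogeneousComponent e g * f := by
  rcases lt_or_ge d 0 with hd | hd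
  · rw [← hf, intComponent_of_neg hd, mul_zero, mul_zero, map_zero]
  · obtain ⟨c, rfl⟩ := Int.eq_ofNat_of_zero_le hd
    rw [add_comm (c : ℤ), mul_comm g, intComponent_mul (mem_grading_of_intComponent_eq hf),
      intComponent_natCast, mul_comm]

lemma intComponent_mem {J : Ideal (CoordRing k n)} (hJ : J.IsHomogeneous (grading k n)) (d : ℤ)
    {f : CoordRing k n} (hf : f ∈ J) : intComponent d f ∈ J := by
  rcases lt_or_ge d 0 with hd | hd
  · rw [intComponent_of_neg hd]; exact zero_mem J
  · obtain ⟨c, rfl⟩ := Int.eq_ofNat_of_zero_le hd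
    rw [intComponent_natCast, ← coe_decompose_eq_homogeneousComponent]
    exact hJ c hf

/-- The homogeneous elements of an ideal, as elements of the field of fractions. -/
def idealFamily (J : Ideal (CoordRing k n)) : GradedFamily k n (FracField k n) where
  piece d :=
    { carrier := {x | ∃ f ∈ J, intComponent d f = f ∧ algebraMap _ (FracField k n) f = x}
      zero_mem' := ⟨0, zero_mem J, map_zero _, map_zero _⟩
      add_mem' := by
        rintro _ _ ⟨f, hf, hf', rfl⟩ ⟨g, hg, hg', rfl⟩
        exact ⟨f + g, add_mem hf hg, by rw [map_add, hf', hg'], map_add _ _ _⟩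
      neg_mem' := by
        rintro _ ⟨f, hf, hf', rfl⟩
        exact ⟨-f, neg_mem hf, by rw [map_neg, hf'], map_neg _ _⟩ }
  smul_mem := by
    rintro d e g _ hg ⟨f, hf, hf', rfl⟩
    exact ⟨g * f, J.mul_mem_left g hf, by rw [intComponent_mul hg, hf'], by
      rw [map_mul, Algebra.smul_def]⟩

lemma idealFamily_mono {I J : Ideal (CoordRing k n)} (h : I ≤ J) :
    idealFamily I ≤ idealFamily J := by
  rintro d _ ⟨f, hf, hf', rfl⟩
  exact ⟨f, h hf, hf', rfl⟩

lemma algebraMap_mem_idealFamily {J : Ideal (CoordRing k n)} {d : ℤ} {f : CoordRing k n}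
    (hf : intComponent d f = f) :
    algebraMap _ (FracField k n) f ∈ (idealFamily J).piece d ↔ f ∈ J := by
  refine ⟨?_, fun h => ⟨f, h, hf, rfl⟩⟩
  rintro ⟨g, hg, -, h⟩
  rwa [← IsFractionRing.injective _ (FracField k n) h]

lemma Acyclic.congr_left {E : Type*} [AddCommGroup E] [Module (CoordRing k n) E]
    {U U' V : GradedFamily k n E} (h : U ≤ U') (h' : U' ≤ U) {q : ℕ} {d : ℤ}
    (hU : Acyclic U V q d) : Acyclic U' V q d := by
  intro c hc hδ
  obtain ⟨e, he, hce⟩ := hU c hc fun τ hτ => sections_mono h' _ _ (hδ τ hτ)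
  exact ⟨e, he, fun σ hσ => sections_mono h _ _ (hce σ hσ)⟩

lemma mem_sections_bot {E : Type*} [AddCommGroup E] [Module (CoordRing k n) E]
    [Module (FracField k n) E] [IsScalarTower (CoordRing k n) (FracField k n) E]
    {σ : Finset (Fin (n + 1))} {d : ℤ} {x : E} :
    x ∈ (⊥ : GradedFamily k n E).sections σ d ↔ x = 0 := by
  refine ⟨?_, fun h => h ▸ zero_mem _⟩
  rintro ⟨N, hN⟩
  refine smul_left_cancel_of_ne_zero (pow_ne_zero N (faceMonomial_ne_zero (k := k) σ)) ?_
  rw [smul_zero]; exact hN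

lemma mem_span_X_of_X_mul_mem {T : Set (Fin (n + 1))} {j : Fin (n + 1)} (hj : j ∉ T)
    {f : CoordRing k n} (h : X j * f ∈ Ideal.span (X '' T)) : f ∈ Ideal.span (X '' T) := by
  rw [mem_ideal_span_X_image] at h ⊢
  intro m hm
  obtain ⟨i, hi, hmi⟩ := h (Finsupp.single j 1 + m) (by
    rw [mem_support_iff] at hm ⊢; rwa [coeff_X_mul])
  have hij : j ≠ i := fun e => hj (e ▸ hi)
  refine ⟨i, hi, ?_⟩
  simpa [Finsupp.single_apply, hij] using hmi

lemma isHomogeneous_span_X (T : Set (Fin (n + 1))) :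
    (Ideal.span (X '' T : Set (CoordRing k n))).IsHomogeneous (grading k n) :=
  Ideal.homogeneous_span _ _ fun x hx => by
    obtain ⟨i, -, rfl⟩ := hx
    exact ⟨1, X_mem_grading i⟩

/-- The quotients `k[x_0, …, x_n] / (x_i : i ∈ T)` have Castelnuovo–Mumford regularity zero. The set
`T` is removed one variable at a time, starting from the residue field. -/
lemma acyclic_span_X (T : Finset (Fin (n + 1))) {q : ℕ} {d : ℤ} (hd : -(q : ℤ) < d) :
    Acyclic (idealFamily (k := k) (Ideal.span (X '' (T : Set (Fin (n + 1)))))) (idealFamily ⊤)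
      q d := by
  induction hs : (Finset.univ \ T).card generalizing T q d with
  | zero =>
    have hT : ∀ i, i ∈ T := by simpa [Finset.card_eq_zero, Finset.ext_iff] using hs
    refine Acyclic.of_sections_le fun σ hσ x hx => ?_
    obtain ⟨N, f, -, hf, hfx⟩ := hx
    obtain _ | q := q
    · obtain rfl := Finset.card_eq_zero.1 hσ
      refine ⟨N, f, ?_, hf, hfx⟩
      rw [mem_ideal_span_X_image]
      intro m hm
      by_contra! hm0
      have hm0 : m = 0 := by
        ext i; exact hm0 i (hT i)
      simp only [Finset.card_empty, mul_zero, Nat.cast_zero, add_zero] at hf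
      obtain ⟨c, rfl⟩ := Int.eq_ofNat_of_zero_le (show 0 ≤ d by simp at hd; omega)
      have h2 := mem_grading_of_intComponent_eq hf (mem_support_iff.1 hm)
      simp [hm0] at h2
      simp [← h2] at hd
    · obtain ⟨i, hi⟩ : σ.Nonempty := Finset.card_pos.1 (by omega)
      refine ⟨1 + N, faceMonomial k σ * f, Ideal.mul_mem_right _ _
        (Ideal.mem_of_dvd _ (Finset.dvd_prod_of_mem _ hi) (Ideal.subset_span ⟨i, hT i, rfl⟩)),
        ?_, ?_⟩
      · have e1 : d + ((1 + N) * σ.card : ℕ) = d + (N * σ.card : ℕ) + σ.card := by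
          push_cast; ring
        rw [e1, intComponent_mul (faceMonomial_mem σ), hf]
      · rw [map_mul, hfx, ← Algebra.smul_def, pow_add, pow_one, mul_smul]
  | succ s ih =>
    obtain ⟨j, hj⟩ := Finset.card_pos.1 (by omega : 0 < (Finset.univ \ T).card)
    have hjT : j ∉ T := (Finset.mem_sdiff.1 hj).2
    refine Acyclic.of_regular j ?_ ?_
    · rintro d _ ⟨f, -, hf, rfl⟩ hX
      rw [algebraMap_mem_idealFamily hf]
      rw [Algebra.smul_def, ← map_mul, algebraMap_mem_idealFamily] at hX
      · exact mem_span_X_of_X_mul_mem hjT hX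
      · simpa [hf] using intComponent_mul (X_mem_grading j) f d
    · rintro q' rfl d' hd'
      have hcard : (Finset.univ \ insert j T).card = s := by
        have h : Finset.univ \ insert j T = (Finset.univ \ T).erase j := by
          ext i; simp
        rw [h, Finset.card_erase_of_mem hj, hs]; rfl
      have hspan : Ideal.span (X '' ((insert j T : Finset (Fin (n + 1))) : Set (Fin (n + 1)))) =
          Ideal.span {X j} ⊔ Ideal.span (X '' (T : Set (Fin (n + 1))) : Set (CoordRing k n)) := by
        rw [Finset.coe_insert, Set.image_insert_eq, Ideal.span_insert]
      refine (ih (insert j T) (q := q') (d := d' + 1) (by push_cast at hd; omega)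
        hcard).congr_left ?_ ?_
      · rintro d _ ⟨f, hf, hf', rfl⟩
        rw [hspan] at hf
        obtain ⟨u, hu, v, hv, rfl⟩ := Submodule.mem_sup.1 hf
        obtain ⟨w, rfl⟩ := Ideal.mem_span_singleton'.1 hu
        refine mem_supSMul.2 ⟨_, ⟨intComponent d v, intComponent_mem (isHomogeneous_span_X _) d hv,
          intComponent_idem d v, rfl⟩, _, ⟨intComponent (d - 1) w, trivial,
          intComponent_idem _ w, rfl⟩, ?_⟩
        have := intComponent_mul (X_mem_grading j) w (d - 1)
        rw [Nat.cast_one, sub_add_cancel] at this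
        rw [← hf', map_add, map_add, mul_comm w, this, map_mul, Algebra.smul_def, add_comm]
      · rintro d x hx
        obtain ⟨_, ⟨u, hu, hu', rfl⟩, _, ⟨v, -, hv', rfl⟩, rfl⟩ := mem_supSMul.1 hx
        refine ⟨u + X j * v, ?_, ?_, ?_⟩
        · rw [hspan]
          exact add_mem (Ideal.mem_sup_right hu) (Ideal.mem_sup_left
            (Ideal.mul_mem_right _ _ (Ideal.mem_span_singleton_self _)))
        · have := intComponent_mul (X_mem_grading j) v (d - 1)
          rw [Nat.cast_one, sub_add_cancel] at this
          rw [map_add, hu', this, hv']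
        · rw [map_add, map_mul, Algebra.smul_def]

/-- The cohomology of `𝒪(d)` on projective space vanishes in the range of degrees needed for
`𝒪` to be regular. -/
lemma acyclic_bot_top {q : ℕ} {d : ℤ} (hd : -(q : ℤ) < d) :
    Acyclic ⊥ (idealFamily (k := k) (n := n) ⊤) q d := by
  refine (acyclic_span_X (k := k) ∅ hd).congr_left ?_ (bot_le _)
  rintro d _ ⟨f, hf, -, rfl⟩
  simp only [Finset.coe_empty, Set.image_empty, Ideal.span_empty, Ideal.mem_bot] at hf
  rw [hf, map_zero]; exact zero_mem _

variable {ι : Type*}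

/-- The graded free module `⨁_j S(-deg j)`. -/
def freeFamily (deg : ι → ℕ) : GradedFamily k n (ι → FracField k n) where
  piece d :=
    { carrier := {v | ∀ j, v j ∈ (idealFamily (⊤ : Ideal (CoordRing k n))).piece (d - deg j)}
      zero_mem' j := zero_mem _
      add_mem' hv hw j := add_mem (hv j) (hw j)
      neg_mem' hv j := neg_mem (hv j) }
  smul_mem hf hv j := mem_piece_of_eq _ (by ring) ((idealFamily _).smul_mem hf (hv j))

lemma mem_sections_freeFamily [Fintype ι] {deg : ι → ℕ} {σ : Finset (Fin (n + 1))} {d : ℤ}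
    {v : ι → FracField k n} : v ∈ (freeFamily deg).sections σ d ↔
      ∀ j, v j ∈ (idealFamily (⊤ : Ideal (CoordRing k n))).sections σ (d - deg j) := by
  constructor
  · rintro ⟨N, hN⟩ j
    exact ⟨N, mem_piece_of_eq _ (by ring) (hN j)⟩
  · intro h
    choose N hN using h
    refine ⟨Finset.univ.sup N, fun j => ?_⟩
    exact mem_piece_of_eq _ (by ring)
      (pow_smul_mem_of_le _ (Finset.le_sup (Finset.mem_univ j)) (hN j))

lemma acyclic_bot_freeFamily [Fintype ι] {deg : ι → ℕ} {q : ℕ} {d : ℤ}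
    (hd : ∀ j, -(q : ℤ) < d - deg j) :
    Acyclic ⊥ (freeFamily (k := k) (n := n) deg) q d := by
  intro c hc hδ
  have hev : ∀ (c : Finset (Fin (n + 1)) → ι → FracField k n) (τ : Finset (Fin (n + 1))) (j : ι),
      coboundary (fun σ => c σ j) τ = coboundary c τ j := fun c τ j =>
    coboundary_comp (Pi.evalAddMonoidHom _ j) c τ
  have h : ∀ j, IsCoboundary ⊥ (idealFamily (⊤ : Ideal (CoordRing k n))) q (d - deg j)
      (fun σ => c σ j) := fun j => by
    refine acyclic_bot_top (hd j) _ (fun σ hσ => mem_sections_freeFamily.1 (hc σ hσ) j)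
      fun τ hτ => ?_
    rw [hev, mem_sections_bot.1 (hδ τ hτ)]
    exact zero_mem _
  choose e he hce using h
  refine ⟨fun σ j => e j σ, fun σ hσ => mem_sections_freeFamily.2 fun j => he j σ hσ,
    fun σ hσ => mem_sections_bot.2 (funext fun j => ?_)⟩
  rw [Pi.sub_apply, ← hev]
  exact mem_sections_bot.1 (hce j σ hσ)

end IdealFamily

end

end LinearSyzygies

namespace LinearSyzygies

noncomputable section

attribute [local instance] MvPolynomial.gradedAlgebra

/-! ### Kernels and images -/

section KerMap

variable {k : Type u} [Field k] {n : ℕ} {E F : Type*} [AddCommGroup E]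
  [Module (CoordRing k n) E] [Module (FracField k n) E]
  [IsScalarTower (CoordRing k n) (FracField k n) E] [AddCommGroup F]
  [Module (CoordRing k n) F] [Module (FracField k n) F]
  [IsScalarTower (CoordRing k n) (FracField k n) F]

open GradedFamily

lemma map_coordRing_smul (φ : E →ₗ[FracField k n] F) (f : CoordRing k n) (x : E) :
    φ (f • x) = f • φ x := by
  rw [← algebraMap_smul (FracField k n) f, map_smul, algebraMap_smul]

/-- The kernel of a linear map on a graded family. -/
def GradedFamily.ker (V : GradedFamily k n E) (φ : E →ₗ[FracField k n] F) :
    GradedFamily k n E where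
  piece d := V.piece d ⊓ φ.toAddMonoidHom.ker
  smul_mem := by
    rintro d e f x hf ⟨hx, hx0⟩
    refine ⟨V.smul_mem hf hx, ?_⟩
    have h0 : φ x = 0 := hx0
    change φ (f • x) = 0
    rw [map_coordRing_smul, h0, smul_zero]

/-- The image of a graded family under a linear map. -/
def GradedFamily.map (V : GradedFamily k n E) (φ : E →ₗ[FracField k n] F) :
    GradedFamily k n F where
  piece d := (V.piece d).map φ.toAddMonoidHom
  smul_mem := by
    rintro d e f _ hf ⟨x, hx, rfl⟩
    exact ⟨f • x, V.smul_mem hf hx, map_coordRing_smul φ f x⟩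

variable {V : GradedFamily k n E} {φ : E →ₗ[FracField k n] F}

lemma GradedFamily.mem_ker {d : ℤ} {x : E} :
    x ∈ (V.ker φ).piece d ↔ x ∈ V.piece d ∧ φ x = 0 := Iff.rfl

lemma GradedFamily.mem_map {d : ℤ} {y : F} :
    y ∈ (V.map φ).piece d ↔ ∃ x ∈ V.piece d, φ x = y := Iff.rfl

lemma GradedFamily.exists_of_mem_sections_map {σ : Finset (Fin (n + 1))} {d : ℤ} {y : F}
    (hy : y ∈ (V.map φ).sections σ d) : ∃ x ∈ V.sections σ d, φ x = y := by
  obtain ⟨N, v, hv, hvy⟩ := hy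
  have h0 : faceMonomial k σ ^ N ≠ 0 := pow_ne_zero _ (faceMonomial_ne_zero σ)
  obtain ⟨w, rfl⟩ := exists_smul_eq_of_ne_zero h0 v
  exact ⟨w, ⟨N, hv⟩, smul_left_cancel_of_ne_zero h0 ((map_coordRing_smul φ _ w).symm.trans hvy)⟩

lemma GradedFamily.map_mem_sections_map {σ : Finset (Fin (n + 1))} {d : ℤ} {x : E}
    (hx : x ∈ V.sections σ d) : φ x ∈ (V.map φ).sections σ d := by
  obtain ⟨N, hN⟩ := hx
  exact ⟨N, mem_map.2 ⟨_, hN, map_coordRing_smul φ _ x⟩⟩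

lemma GradedFamily.mem_sections_ker {σ : Finset (Fin (n + 1))} {d : ℤ} {x : E} :
    x ∈ (V.ker φ).sections σ d ↔ x ∈ V.sections σ d ∧ φ x = 0 := by
  have h0 : ∀ N, faceMonomial k σ ^ N ≠ 0 := fun N => pow_ne_zero _ (faceMonomial_ne_zero σ)
  constructor
  · rintro ⟨N, hN⟩
    obtain ⟨h1, h2⟩ := mem_ker.1 hN
    refine ⟨⟨N, h1⟩, smul_left_cancel_of_ne_zero (h0 N) ?_⟩
    rw [← map_coordRing_smul, h2, smul_zero]
  · rintro ⟨⟨N, hN⟩, h2⟩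
    exact ⟨N, mem_ker.2 ⟨hN, by rw [map_coordRing_smul, h2, smul_zero]⟩⟩

/-- The piece `H^q(V) → H^q(φ(V)) → H^{q+1}(ker φ)` of the long exact sequence. -/
lemma Acyclic.map {q : ℕ} {d : ℤ} (hV : Acyclic ⊥ V q d) (hK : Acyclic ⊥ (V.ker φ) (q + 1) d) :
    Acyclic ⊥ (V.map φ) q d := by
  intro c hc hδ
  have hφ : ∀ (c : Finset (Fin (n + 1)) → E) τ, coboundary (fun σ => φ (c σ)) τ =
      φ (coboundary c τ) := fun c τ => coboundary_comp φ.toAddMonoidHom c τ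
  have h1 : ∀ σ : Finset (Fin (n + 1)), ∃ x, (σ.card = q → x ∈ V.sections σ d) ∧
      (σ.card = q → φ x = c σ) := by
    intro σ
    by_cases hσ : σ.card = q
    · obtain ⟨x, hx, hxc⟩ := exists_of_mem_sections_map (hc σ hσ)
      exact ⟨x, fun _ => hx, fun _ => hxc⟩
    · exact ⟨0, fun h => absurd h hσ, fun h => absurd h hσ⟩
  choose b hb hbc using h1
  have hcb : ∀ τ : Finset (Fin (n + 1)), τ.card = q + 1 → φ (coboundary b τ) = 0 := by
    intro τ hτ
    rw [← hφ, ← mem_sections_bot.1 (hδ τ hτ)]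
    refine Finset.sum_congr rfl fun i hi => ?_
    dsimp only
    rw [hbc _ (by rw [Finset.card_erase_of_mem hi, hτ]; rfl)]
  obtain ⟨e, he, hbe⟩ := hK (coboundary b)
    (fun τ hτ => mem_sections_ker.2 ⟨coboundary_mem_sections hb hτ, hcb τ hτ⟩)
    fun τ _ => by rw [coboundary_coboundary]; exact zero_mem _
  obtain ⟨e', he', hbe'⟩ := hV (b - e)
    (fun σ hσ => sub_mem (hb σ hσ) (mem_sections_ker.1 (he σ (by omega))).1)
    fun τ hτ => by rw [map_sub]; exact hbe τ hτ
  refine ⟨fun σ => φ (e' σ), fun σ hσ => map_mem_sections_map (he' σ hσ), fun σ hσ => ?_⟩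
  have h2 := mem_sections_bot.1 (hbe' σ hσ)
  have h3 : φ (e σ) = 0 := (mem_sections_ker.1 (he σ (by omega))).2
  have h4 := congrArg φ h2
  rw [Pi.sub_apply, map_sub, map_sub, h3, sub_zero, map_zero] at h4
  rw [mem_sections_bot, hφ, ← hbc σ hσ, h4]

end KerMap

/-! ### Restricting a linear resolution -/

section Resolution

variable {k : Type u} [Field k] {r : ℕ}

open GradedFamily Matrix

namespace MinimalFreeResolution

variable {I : Ideal (CoordRing k r)} (F : MinimalFreeResolution I)

lemma diff_mul_diff (t : ℕ) : F.diff t * F.diff (t + 1) = 0 := by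
  refine Matrix.ext fun i j => ?_
  have h := (F.exact_succ t ((F.diff (t + 1)).mulVec (Pi.single j 1))).2 ⟨_, rfl⟩
  rw [mulVec_mulVec] at h
  simpa using congrFun h i

lemma gen_vecMul_diff : F.gen ᵥ* F.diff 0 = 0 := by
  funext j
  have h := (F.exact_zero ((F.diff 0).mulVec (Pi.single j 1))).2 ⟨_, rfl⟩
  rw [dotProduct_comm, dotProduct_mulVec] at h
  simpa using h

lemma exists_mul_diff_zero_eq {a : ℕ} (M : Matrix (Fin (F.rank 0)) (Fin a) (CoordRing k r))
    (hM : F.gen ᵥ* M = 0) :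
    ∃ A : Matrix (Fin (F.rank 1)) (Fin a) (CoordRing k r), F.diff 0 * A = M := by
  have h : ∀ j, ∃ w, (F.diff 0).mulVec w = M.col j := fun j =>
    (F.exact_zero _).1 (by rw [dotProduct_comm]; exact congrFun hM j)
  choose w hw using h
  exact ⟨Matrix.of fun i j => w j i, Matrix.ext fun i j => congrFun (hw j) i⟩

lemma exists_mul_diff_succ_eq {t a : ℕ}
    (M : Matrix (Fin (F.rank (t + 1))) (Fin a) (CoordRing k r))
    (hM : F.diff t * M = 0) :
    ∃ A : Matrix (Fin (F.rank (t + 2))) (Fin a) (CoordRing k r), F.diff (t + 1) * A = M := by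
  have h : ∀ j, ∃ w, (F.diff (t + 1)).mulVec w = M.col j := fun j =>
    (F.exact_succ t _).1 (funext fun i => congrFun (congrFun hM i) j)
  choose w hw using h
  exact ⟨Matrix.of fun i j => w j i, Matrix.ext fun i j => congrFun (hw j) i⟩

/-- Multiplication by an element of `I` is null-homotopic on `⋯ → F_1 → F_0 → S`: the homotopy at
`F_0`. -/
lemma exists_homotopy_zero {a : CoordRing k r} (ha : a ∈ I) :
    ∃ (A : Matrix (Fin (F.rank 1)) (Fin (F.rank 0)) (CoordRing k r))
      (w : Fin (F.rank 0) → CoordRing k r),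
      a • (1 : Matrix (Fin (F.rank 0)) (Fin (F.rank 0)) (CoordRing k r)) =
        F.diff 0 * A + vecMulVec w F.gen := by
  rw [← F.span_gen, Ideal.mem_span_range_iff_exists_fun] at ha
  obtain ⟨w, hw⟩ := ha
  obtain ⟨A, hA⟩ := F.exists_mul_diff_zero_eq (a • 1 - vecMulVec w F.gen) (by
    rw [vecMul_sub, vecMul_smul, vecMul_one, vecMul_vecMulVec, dotProduct_comm]
    have : w ⬝ᵥ F.gen = a := hw
    rw [this, sub_eq_zero])
  exact ⟨A, w, by rw [hA, sub_add_cancel]⟩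

lemma exists_homotopy_step {t : ℕ} {a : CoordRing k r}
    {A : Matrix (Fin (F.rank (t + 1))) (Fin (F.rank t)) (CoordRing k r)}
    (hA : F.diff t * A * F.diff t = a • F.diff t) :
    ∃ B : Matrix (Fin (F.rank (t + 2))) (Fin (F.rank (t + 1))) (CoordRing k r),
      a • (1 : Matrix (Fin (F.rank (t + 1))) (Fin (F.rank (t + 1))) (CoordRing k r)) =
      F.diff (t + 1) * B + A * F.diff t := by
  obtain ⟨B, hB⟩ := F.exists_mul_diff_succ_eq (a • 1 - A * F.diff t) (by
    rw [Matrix.mul_sub, Matrix.mul_smul, Matrix.mul_one, ← Matrix.mul_assoc, hA, sub_self])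
  exact ⟨B, by rw [hB, sub_add_cancel]⟩

/-- Multiplication by an element of `I` is null-homotopic on `⋯ → F_1 → F_0 → S`: the homotopy at
`F_{t+1}`. -/
lemma exists_homotopy_succ (t : ℕ) {a : CoordRing k r} (ha : a ∈ I) :
    ∃ (B : Matrix (Fin (F.rank (t + 2))) (Fin (F.rank (t + 1))) (CoordRing k r))
      (A : Matrix (Fin (F.rank (t + 1))) (Fin (F.rank t)) (CoordRing k r)),
      a • (1 : Matrix (Fin (F.rank (t + 1))) (Fin (F.rank (t + 1))) (CoordRing k r)) =
        F.diff (t + 1) * B + A * F.diff t := by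
  suffices h : ∃ A : Matrix (Fin (F.rank (t + 1))) (Fin (F.rank t)) (CoordRing k r),
      F.diff t * A * F.diff t = a • F.diff t by
    obtain ⟨A, hA⟩ := h
    obtain ⟨B, hB⟩ := F.exists_homotopy_step hA
    exact ⟨B, A, hB⟩
  induction t with
  | zero =>
    obtain ⟨A, w, hA⟩ := F.exists_homotopy_zero ha
    refine ⟨A, ?_⟩
    rw [eq_sub_of_add_eq hA.symm, Matrix.sub_mul, Matrix.smul_mul, Matrix.one_mul,
      vecMulVec_mul, F.gen_vecMul_diff]
    exact sub_eq_self.2 (Matrix.ext fun i j => mul_zero (w i))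
  | succ t ih =>
    obtain ⟨A, hA⟩ := ih
    obtain ⟨B, hB⟩ := F.exists_homotopy_step hA
    refine ⟨B, ?_⟩
    rw [eq_sub_of_add_eq hB.symm, Matrix.sub_mul, Matrix.smul_mul, Matrix.one_mul,
      Matrix.mul_assoc, F.diff_mul_diff, Matrix.mul_zero, sub_zero]

variable {m : ℕ} (b : Fin (m + 1) → Fin (r + 1) → k)

/-- Substitution of linear forms, followed by the inclusion in the field of fractions. -/
def substFrac : CoordRing k r →+* FracField k m :=
  (algebraMap (CoordRing k m) (FracField k m)).comp
    (linearSubst b : CoordRing k r →+* CoordRing k m)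

/-- The differential `F_{t+1} → F_t`, restricted to the linear subspace. -/
def restrictedDiff (t : ℕ) :
    (Fin (F.rank (t + 1)) → FracField k m) →ₗ[FracField k m] (Fin (F.rank t) → FracField k m) :=
  ((F.diff t).map (substFrac b)).mulVecLin

/-- The map `F_0 → S` given by the generators of the ideal, restricted to the linear subspace. -/
def restrictedGen : (Fin (F.rank 0) → FracField k m) →ₗ[FracField k m] FracField k m :=
  Fintype.linearCombination (FracField k m) fun j => substFrac b (F.gen j)

/-- The cycles of the restriction of the complex `⋯ → F_1 → F_0 → S` to the linear subspace. -/
def cycles : (t : ℕ) → GradedFamily k m (Fin (F.rank t) → FracField k m)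
  | 0 => (freeFamily (F.deg 0)).ker (F.restrictedGen b)
  | t + 1 => (freeFamily (F.deg (t + 1))).ker (F.restrictedDiff b t)

/-- The boundaries of the restriction of the complex `⋯ → F_1 → F_0 → S` to the linear subspace. -/
def boundaries (t : ℕ) : GradedFamily k m (Fin (F.rank t) → FracField k m) :=
  (freeFamily (F.deg (t + 1))).map (F.restrictedDiff b t)

lemma linearSubst_mem {e : ℕ} {f : CoordRing k r} (hf : f.IsHomogeneous e) :
    linearSubst b f ∈ grading k m e :=
  (linearSubst b).map_mem ((mem_homogeneousSubmodule e f).2 hf)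

lemma intComponent_diff_mul (t : ℕ) (i : Fin (F.rank t)) (j : Fin (F.rank (t + 1))) (d : ℤ)
    (g : CoordRing k m) : intComponent (d - F.deg t i) (linearSubst b (F.diff t i j) * g) =
      linearSubst b (F.diff t i j) * intComponent (d - F.deg (t + 1) j) g := by
  rcases F.diff_homogeneous t i j with h | ⟨e, he, h⟩
  · simp [h]
  · rw [← intComponent_mul (linearSubst_mem b h)]
    congr 2
    rw [← he]; push_cast; ring

lemma restrictedDiff_algebraMap (t : ℕ) (g : Fin (F.rank (t + 1)) → CoordRing k m)
    (i : Fin (F.rank t)) : F.restrictedDiff b t (fun j => algebraMap _ (FracField k m) (g j)) i =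
      algebraMap _ (FracField k m) (∑ j, linearSubst b (F.diff t i j) * g j) := by
  simp [restrictedDiff, mulVec, dotProduct, substFrac]

lemma exists_of_mem_freeFamily {ι : Type*} {deg : ι → ℕ} {d : ℤ} {v : ι → FracField k m}
    (hv : v ∈ (freeFamily deg).piece d) : ∃ f : ι → CoordRing k m,
      (∀ j, intComponent (d - deg j) (f j) = f j) ∧ v = fun j => algebraMap _ _ (f j) := by
  choose f _ hf hfv using hv
  exact ⟨f, hf, funext fun j => (hfv j).symm⟩

lemma cycles_le_freeFamily (t : ℕ) : F.cycles b t ≤ freeFamily (F.deg t) := by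
  cases t <;> exact fun d x hx => hx.1

lemma boundaries_le_cycles (t : ℕ) : F.boundaries b t ≤ F.cycles b t := by
  rintro d _ ⟨v, hv, rfl⟩
  obtain ⟨f, hf, rfl⟩ := exists_of_mem_freeFamily hv
  have h1 : F.restrictedDiff b t (fun j => algebraMap _ _ (f j)) ∈
      (freeFamily (F.deg t)).piece d := by
    intro i
    rw [restrictedDiff_algebraMap]
    refine ⟨_, trivial, ?_, rfl⟩
    rw [map_sum]
    refine Finset.sum_congr rfl fun j _ => ?_
    rw [intComponent_diff_mul, hf]
  cases t with
  | zero =>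
    refine ⟨h1, ?_⟩
    change F.restrictedGen b (F.restrictedDiff b 0 _) = 0
    have h2 : (fun j => substFrac b (F.gen j)) ᵥ* (F.diff 0).map (substFrac b) = 0 := by
      ext j
      have := congrArg (substFrac b) (congrFun F.gen_vecMul_diff j)
      simpa [vecMul, dotProduct] using this
    have h3 : ∀ v : Fin (F.rank 0) → FracField k m,
        F.restrictedGen b v = (fun j => substFrac b (F.gen j)) ⬝ᵥ v := fun v => by
      simp [restrictedGen, Fintype.linearCombination_apply, dotProduct, mul_comm]
    rw [h3, restrictedDiff, mulVecLin_apply, dotProduct_mulVec, h2, zero_dotProduct]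
  | succ t =>
    refine ⟨h1, ?_⟩
    change F.restrictedDiff b t (F.restrictedDiff b (t + 1) _) = 0
    rw [restrictedDiff, restrictedDiff, mulVecLin_apply, mulVecLin_apply, mulVec_mulVec,
      ← Matrix.map_mul, F.diff_mul_diff]
    simp

/-- The homology of the restricted complex is killed by `I`. -/
lemma linearSubst_mem_colon {t : ℕ} {a : CoordRing k r} (ha : a ∈ I) {d : ℤ}
    {x : Fin (F.rank t) → FracField k m} (hx : x ∈ (F.cycles b t).piece d) :
    linearSubst b a ∈ (F.boundaries b t).colon d x := by
  obtain ⟨f, hf, rfl⟩ := exists_of_mem_freeFamily (F.cycles_le_freeFamily b t d hx)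
  -- a homotopy expresses `a x` as a boundary, of which the components are taken
  obtain ⟨g, hg⟩ : ∃ g : Fin (F.rank (t + 1)) → CoordRing k m,
      ∀ i, linearSubst b a * f i = ∑ j, linearSubst b (F.diff t i j) * g j := by
    have hinj := IsFractionRing.injective (CoordRing k m) (FracField k m)
    cases t with
    | zero =>
      obtain ⟨A, w, hA⟩ := F.exists_homotopy_zero ha
      refine ⟨fun j => ∑ l, linearSubst b (A j l) * f l, fun i => ?_⟩
      have h0 : ∑ l, linearSubst b (F.gen l) * f l = 0 := by
        apply hinj
        have : F.restrictedGen b _ = 0 := hx.2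
        rw [map_zero, ← this]
        simp [restrictedGen, Fintype.linearCombination_apply, substFrac, mul_comm]
      have h1 : ∀ l, linearSubst b ((a • (1 : Matrix _ _ (CoordRing k r))) i l) * f l =
          (∑ j, linearSubst b (F.diff 0 i j) * linearSubst b (A j l)) * f l +
            linearSubst b (w i) * (linearSubst b (F.gen l) * f l) := by
        intro l
        rw [hA, Matrix.add_apply, Matrix.mul_apply, vecMulVec_apply, map_add, map_sum, map_mul,
          add_mul, mul_assoc]
        simp_rw [map_mul]
      have h2 := Finset.sum_congr rfl fun l (_ : l ∈ Finset.univ) => h1 l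
      rw [Finset.sum_add_distrib, ← Finset.mul_sum, h0, mul_zero, add_zero] at h2
      rw [Finset.sum_eq_single i (by
        intro l _ hl; simp [hl.symm]) (by simp)] at h2
      simp only [Matrix.smul_apply, Matrix.one_apply_eq, smul_eq_mul, mul_one] at h2
      rw [h2]
      simp_rw [Finset.sum_mul, Finset.mul_sum]
      rw [Finset.sum_comm]
      simp_rw [mul_assoc]
    | succ t =>
      obtain ⟨B, A, hA⟩ := F.exists_homotopy_succ t ha
      refine ⟨fun j => ∑ l, linearSubst b (B j l) * f l, fun i => ?_⟩
      have h0 : ∀ s, ∑ l, linearSubst b (F.diff t s l) * f l = 0 := by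
        intro s
        apply hinj
        have : F.restrictedDiff b t _ = 0 := hx.2
        rw [map_zero, ← restrictedDiff_algebraMap, this]; rfl
      have h1 : ∀ l, linearSubst b ((a • (1 : Matrix _ _ (CoordRing k r))) i l) * f l =
          (∑ j, linearSubst b (F.diff (t + 1) i j) * linearSubst b (B j l)) * f l +
            ∑ s, linearSubst b (A i s) * (linearSubst b (F.diff t s l) * f l) := by
        intro l
        rw [hA, Matrix.add_apply, Matrix.mul_apply, Matrix.mul_apply, map_add, map_sum, map_sum,
          add_mul, Finset.sum_mul (f := fun s => linearSubst b (A i s * F.diff t s l))]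
        simp_rw [map_mul, mul_assoc]
      have h2 := Finset.sum_congr rfl fun l (_ : l ∈ Finset.univ) => h1 l
      have h3 : ∑ l, ∑ s, linearSubst b (A i s) * (linearSubst b (F.diff t s l) * f l) = 0 := by
        rw [Finset.sum_comm]
        exact Finset.sum_eq_zero fun s _ => by rw [← Finset.mul_sum, h0, mul_zero]
      rw [Finset.sum_add_distrib, h3, add_zero] at h2
      rw [Finset.sum_eq_single i (by
        intro l _ hl; simp [hl.symm]) (by simp)] at h2
      simp only [Matrix.smul_apply, Matrix.one_apply_eq, smul_eq_mul, mul_one] at h2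
      rw [h2]
      simp_rw [Finset.sum_mul, Finset.mul_sum]
      rw [Finset.sum_comm]
      simp_rw [mul_assoc]
  intro e
  refine ⟨fun j => algebraMap _ _ (intComponent (d + e - F.deg (t + 1) j) (g j)),
    fun j => ⟨_, trivial, intComponent_idem _ _, rfl⟩, funext fun i => ?_⟩
  refine (F.restrictedDiff_algebraMap b t _ i).trans ?_
  rw [Pi.smul_apply, Algebra.smul_def, ← map_mul]
  congr 1
  have h := intComponent_mul_of_right (hf i) (linearSubst b a) e
  rw [← h, hg, map_sum]
  refine Finset.sum_congr rfl fun j _ => ?_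
  rw [← intComponent_diff_mul]
  congr 2
  ring

/-- The image of `F_0` in the coordinate ring of the linear subspace is the restriction of `I`. -/
lemma map_restrictedGen_eq (d : ℤ) (x : FracField k m) :
    x ∈ ((freeFamily (F.deg 0)).map (F.restrictedGen b)).piece d ↔
      x ∈ (idealFamily (I.map (linearSubst b))).piece d := by
  have hgen : ∀ f : Fin (F.rank 0) → CoordRing k m,
      F.restrictedGen b (fun j => algebraMap _ _ (f j)) =
        algebraMap _ _ (∑ j, linearSubst b (F.gen j) * f j) := fun f => by
    simp [restrictedGen, Fintype.linearCombination_apply, substFrac, mul_comm]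
  have hcomp : ∀ (f : Fin (F.rank 0) → CoordRing k m), intComponent d
      (∑ j, linearSubst b (F.gen j) * f j) =
        ∑ j, linearSubst b (F.gen j) * intComponent (d - F.deg 0 j) (f j) := fun f => by
    rw [map_sum]
    refine Finset.sum_congr rfl fun j _ => ?_
    rw [← intComponent_mul (linearSubst_mem b (F.gen_homogeneous j)), sub_add_cancel]
  constructor
  · rintro ⟨v, hv, rfl⟩
    obtain ⟨f, hf, rfl⟩ := exists_of_mem_freeFamily hv
    refine ⟨_, ?_, ?_, (hgen f).symm⟩
    · refine Ideal.sum_mem _ fun j _ => Ideal.mul_mem_right _ _ (Ideal.mem_map_of_mem _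
        (F.span_gen.le (Ideal.subset_span ⟨j, rfl⟩)))
    · rw [hcomp]
      exact Finset.sum_congr rfl fun j _ => by rw [hf]
  · rintro ⟨h, hI, hd, rfl⟩
    rw [← F.span_gen, Ideal.map_span, ← Set.range_comp, Ideal.mem_span_range_iff_exists_fun] at hI
    obtain ⟨f, rfl⟩ := hI
    refine ⟨fun j => algebraMap _ _ (intComponent (d - F.deg 0 j) (f j)),
      fun j => ⟨_, trivial, intComponent_idem _ _, rfl⟩, ?_⟩
    refine (hgen _).trans ?_
    rw [← hd, ← hcomp]
    simp [mul_comm]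

/-- The cohomology of the sheaf of cycles in the restriction of a resolution that is linear for
`p` steps, for a linear subspace of dimension `m ≤ p` that meets the closed subscheme in dimension
at most one. The homology of the restricted complex is supported on the intersection and thus has
no cohomology in degrees `≥ 2`, so that classes move along the complex until they reach degrees
above `m`. -/
theorem acyclic_cycles {p : ℕ} (hF : ∀ t < p, ∀ j, F.deg t j = t + 2) (hm : m ≤ p)
    (hJ : (I.map (linearSubst b)).IsHomogeneous (grading k m))
    (hchain : ∀ s : LTSeries (ProjectiveSpectrum (grading k m)),
      I.map (linearSubst b) ≤ s.head.asHomogeneousIdeal.toIdeal → s.length < 2)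
    (t q : ℕ) (hq : t + 3 ≤ q) : Acyclic ⊥ (F.cycles b t) q (t + 4 - q) := by
  induction hs : m + 2 - q generalizing t q with
  | zero => exact Acyclic.of_card_lt _ (by omega)
  | succ s ih =>
    refine Acyclic.trans (bot_le _) (F.boundaries_le_cycles b t) (Acyclic.map ?_ ?_)
      (acyclic_of_torsion 2 _ hJ hchain _ _ (F.boundaries_le_cycles b t) (fun d x hx => ?_)
        q (by omega) _)
    · refine acyclic_bot_freeFamily fun j => ?_
      rw [hF (t + 1) (by omega)]
      push_cast; omega
    · have h := ih (t + 1) (q + 1) (by omega) (by omega)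
      have e : ((t + 1 : ℕ) : ℤ) + 4 - (q + 1 : ℕ) = t + 4 - q := by push_cast; ring
      rwa [e] at h
    · rw [Ideal.map_le_iff_le_comap]
      exact fun a ha => Ideal.le_radical (F.linearSubst_mem_colon b ha hx)

/-- The restriction to the linear subspace of an ideal with a resolution that is linear for `p`
steps has vanishing cohomology `H^{q-1}` in degree `3 - q`, although the restricted complex need not be
exact. -/
theorem acyclic_idealFamily {p : ℕ} (hp : 1 ≤ p) (hF : ∀ t < p, ∀ j, F.deg t j = t + 2)
    (hm : m ≤ p) (hJ : (I.map (linearSubst b)).IsHomogeneous (grading k m))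
    (hchain : ∀ s : LTSeries (ProjectiveSpectrum (grading k m)),
      I.map (linearSubst b) ≤ s.head.asHomogeneousIdeal.toIdeal → s.length < 2)
    (q : ℕ) (hq : 2 ≤ q) :
    Acyclic ⊥ (idealFamily (I.map (linearSubst b))) q (3 - q) := by
  have h : Acyclic ⊥ ((freeFamily (F.deg 0)).map (F.restrictedGen b)) q (3 - q) := by
    refine Acyclic.map (acyclic_bot_freeFamily fun j => ?_) ?_
    · rw [hF 0 hp]; push_cast; omega
    · have h := F.acyclic_cycles b hF hm hJ hchain 0 (q + 1) (by omega)
      have e : ((0 : ℕ) : ℤ) + 4 - (q + 1 : ℕ) = 3 - q := by push_cast; ring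
      rwa [e] at h
  have heq : (freeFamily (F.deg 0)).map (F.restrictedGen b) =
      idealFamily (I.map (linearSubst b)) := by
    have : ∀ U V : GradedFamily k m (FracField k m), (∀ d x, x ∈ U.piece d ↔ x ∈ V.piece d) →
        U = V := by
      rintro ⟨U, _⟩ ⟨V, _⟩ h
      congr
      ext d x
      exact h d x
    exact this _ _ (F.map_restrictedGen_eq b)
  rwa [heq] at h

end MinimalFreeResolution

end Resolution

end

end LinearSyzygies

namespace LinearSyzygies

noncomputable section

attribute [local instance] MvPolynomial.gradedAlgebra

/-! ### Base change of the ideal of a closed subscheme -/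

lemma specMap_comp_fromSpec_appLE {X : Scheme.{u}} {U : X.Opens} (hU : IsAffineOpen U)
    {Q : CommRingCat.{u}} (q : Γ(X, U) ⟶ Q) (h : ⊤ ≤ (Spec.map q ≫ hU.fromSpec) ⁻¹ᵁ U) :
    (Spec.map q ≫ hU.fromSpec).appLE U ⊤ h = q ≫ (Scheme.ΓSpecIso Q).inv := by
  have h' : ⊤ ≤ Spec.map q ⁻¹ᵁ hU.fromSpec ⁻¹ᵁ U := h
  have h1 : (Spec.map q ≫ hU.fromSpec).appLE U ⊤ h =
      hU.fromSpec.app U ≫ (Spec.map q).appLE _ ⊤ h' := Scheme.Hom.comp_appLE ..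
  rw [h1, hU.fromSpec_app_self, Category.assoc, Scheme.Hom.map_appLE,
    Scheme.ΓSpecIso_inv_naturality]
  simp only [Scheme.Hom.appLE]
  exact congrArg (_ ≫ ·) ((congrArg ((Spec.map q).app ⊤ ≫ ·)
    ((Spec _).presheaf.map_id _)).trans (Category.comp_id _))

/-- The ideal of a base change of a closed subscheme, over affine open sets, is generated by the
ideal of the closed subscheme. -/
lemma mem_map_ker_of_pullback_snd {X Y P : Scheme.{u}} (ι : X ⟶ P) [IsClosedImmersion ι]
    (g : Y ⟶ P) {U : P.Opens} (hU : IsAffineOpen U) {V : Y.Opens} (hV : IsAffineOpen V)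
    (e : V ≤ g ⁻¹ᵁ U) (s : Γ(Y, V)) (hs : ((pullback.snd ι g).app V).hom s = 0) :
    s ∈ (RingHom.ker (ι.app U).hom).map (g.appLE U V e).hom := by
  -- With `I` the ideal on the right, the map from the spectrum of `Γ(Y, V) / I` to `P` kills the
  -- ideal of `X`, hence factors through `X` and lifts to the fibre product.
  let I := (RingHom.ker (ι.app U).hom).map (g.appLE U V e).hom
  let q : Γ(Y, V) ⟶ CommRingCat.of (Γ(Y, V) ⧸ I) := CommRingCat.ofHom (Ideal.Quotient.mk I)
  let w := Spec.map (g.appLE U V e ≫ q)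
  have H : ι.ker ≤ (w ≫ hU.fromSpec).ker := by
    rw [← Scheme.IdealSheafData.map_ker, Scheme.IdealSheafData.le_map_iff_comap_le]
    apply Scheme.IdealSheafData.le_of_isAffine
    rw [Scheme.IdealSheafData.ideal_comap_of_isOpenImmersion, Scheme.Hom.ker_apply,
      Scheme.Hom.ker_apply]
    intro s hs
    have hs' : (ι.app (hU.fromSpec ''ᵁ ⊤)).hom ((hU.fromSpec.appIso ⊤).inv.hom s) = 0 := hs
    have hle : U ≤ hU.fromSpec ''ᵁ ⊤ := by
      rw [Scheme.Hom.image_top_eq_opensRange, hU.opensRange_fromSpec]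
    have htop : ⊤ ≤ (w ≫ hU.fromSpec) ⁻¹ᵁ U := by
      rw [Scheme.Hom.comp_preimage, hU.fromSpec_preimage_self]; exact le_rfl
    have key : (hU.fromSpec.appIso ⊤).inv ≫ P.presheaf.map (homOfLE hle).op ≫
        (w ≫ hU.fromSpec).appLE U ⊤ htop = w.app ⊤ := by
      rw [Scheme.Hom.map_appLE, ← Scheme.Hom.appLE_comp_appLE w hU.fromSpec _ ⊤ ⊤
        (by rw [Scheme.Hom.preimage_image_eq]) le_top, Scheme.Hom.appIso_inv_appLE_assoc]
      simp only [Scheme.Hom.appLE]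
      exact (congrArg (w.app ⊤ ≫ ·) ((Spec _).presheaf.map_id _)).trans (Category.comp_id _)
    have hβ : P.presheaf.map (homOfLE hle).op ((hU.fromSpec.appIso ⊤).inv.hom s) ∈
        RingHom.ker (ι.app U).hom := by
      have h1 := congr($(ι.naturality (homOfLE hle).op).hom
        ((hU.fromSpec.appIso ⊤).inv.hom s))
      exact h1.trans ((congrArg (X.presheaf.map ((TopologicalSpace.Opens.map ι.base).map
        (homOfLE hle).op.unop).op).hom hs').trans (RingHom.map_zero _))
    have h2 := congr($(specMap_comp_fromSpec_appLE hU (g.appLE U V e ≫ q) htop).hom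
      (P.presheaf.map (homOfLE hle).op ((hU.fromSpec.appIso ⊤).inv.hom s)))
    have h3 : q.hom ((g.appLE U V e).hom
        (P.presheaf.map (homOfLE hle).op ((hU.fromSpec.appIso ⊤).inv.hom s))) = 0 :=
      Ideal.Quotient.eq_zero_iff_mem.2 (Ideal.mem_map_of_mem _ hβ)
    have h4 := congr($(key).hom s)
    exact h4.symm.trans (h2.trans ((congrArg (Scheme.ΓSpecIso _).inv.hom h3).trans (map_zero _)))
  let v := IsClosedImmersion.lift ι _ H
  let z := pullback.lift v (Spec.map q ≫ hV.fromSpec) (by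
    rw [IsClosedImmersion.lift_fac, Category.assoc, ← hU.SpecMap_appLE_fromSpec g hV e,
      ← Category.assoc, ← Spec.map_comp])
  have hz : z ≫ pullback.snd ι g = Spec.map q ≫ hV.fromSpec := pullback.lift_snd _ _ _
  have htop : ⊤ ≤ (Spec.map q ≫ hV.fromSpec) ⁻¹ᵁ V := by
    rw [Scheme.Hom.comp_preimage, hV.fromSpec_preimage_self]; exact le_rfl
  have h1 := congr($(specMap_comp_fromSpec_appLE hV q htop).hom s)
  have h2 : ((Spec.map q ≫ hV.fromSpec).appLE V ⊤ htop).hom s = 0 := by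
    have htop' : ⊤ ≤ (z ≫ pullback.snd ι g) ⁻¹ᵁ V := by rw [hz]; exact htop
    have h3 : (Spec.map q ≫ hV.fromSpec).appLE V ⊤ htop =
        (z ≫ pullback.snd ι g).appLE V ⊤ htop' := by simp only [hz]
    rw [h3, Scheme.Hom.comp_appLE]
    exact (congrArg (z.appLE (pullback.snd ι g ⁻¹ᵁ V) ⊤ htop').hom hs).trans (RingHom.map_zero _)
  have h4 : (Scheme.ΓSpecIso (CommRingCat.of (Γ(Y, V) ⧸ I))).inv.hom (q.hom s) = 0 :=
    h1.symm.trans h2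
  have h5 : q.hom s = 0 := by
    have := congrArg (Scheme.ΓSpecIso (CommRingCat.of (Γ(Y, V) ⧸ I))).hom.hom h4
    rw [map_zero] at this
    rw [← this]
    exact congr($((Scheme.ΓSpecIso (CommRingCat.of (Γ(Y, V) ⧸ I))).inv_hom_id).hom (q.hom s)).symm
  exact Ideal.Quotient.eq_zero_iff_mem.1 h5

/-- On a quasi-compact open set, functions vanishing where `f` is invertible are killed by a power
of `f`. -/
lemma exists_pow_mul_mem_ker {X P : Scheme.{u}} (ι : X ⟶ P) [QuasiCompact ι] {U W : P.Opens}
    (hU : IsAffineOpen U) (hW : W ≤ U) (f s : Γ(P, U)) (hf : P.basicOpen f ≤ W)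
    (hs : (ι.app W).hom ((P.presheaf.map (homOfLE hW).op).hom s) = 0) :
    ∃ M : ℕ, (ι.app U).hom (f ^ M * s) = 0 := by
  have hcomp : IsCompact (ι ⁻¹ᵁ U).1 := QuasiCompact.isCompact_preimage (f := ι) _ U.2 hU.isCompact
  obtain ⟨M, hM⟩ := exists_pow_mul_eq_zero_of_res_basicOpen_eq_zero_of_isCompact X hcomp
    ((ι.app U).hom s) ((ι.app U).hom f) (by
      have hle : X.basicOpen ((ι.app U).hom f) ≤ ι ⁻¹ᵁ W := by
        rw [← Scheme.preimage_basicOpen]; exact ι.preimage_mono hf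
      have h1 := congr($(ι.naturality (homOfLE hW).op).hom s)
      have h2 : (X.presheaf.map ((TopologicalSpace.Opens.map ι.base).map
          (homOfLE hW)).op).hom ((ι.app U).hom s) = 0 := h1.symm.trans hs
      have h3 : X.presheaf.map (homOfLE (X.basicOpen_le ((ι.app U).hom f))).op =
          X.presheaf.map ((TopologicalSpace.Opens.map ι.base).map (homOfLE hW)).op ≫
            X.presheaf.map (homOfLE hle).op := by
        rw [← Functor.map_comp]; rfl
      change (X.presheaf.map (homOfLE (X.basicOpen_le ((ι.app U).hom f))).op).hom _ = 0
      rw [h3]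
      exact (congrArg (X.presheaf.map (homOfLE hle).op).hom h2).trans (RingHom.map_zero _))
  exact ⟨M, by rw [map_mul, map_pow]; exact hM⟩

lemma eq_zero_of_cover {X P : Scheme.{u}} (ι : X ⟶ P) {U : P.Opens} {J : Type*} (W : J → P.Opens)
    (hW : ∀ j, W j ≤ U) (hcov : U ≤ ⨆ j, W j) (s : Γ(P, U))
    (hs : ∀ j, (ι.app (W j)).hom ((P.presheaf.map (homOfLE (hW j)).op).hom s) = 0) :
    (ι.app U).hom s = 0 := by
  refine X.sheaf.eq_of_locally_eq' (fun j => ι ⁻¹ᵁ W j) (ι ⁻¹ᵁ U)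
    (fun j => homOfLE (ι.preimage_mono (hW j))) ?_ _ _ fun j => ?_
  · rw [← Scheme.Hom.preimage_iSup]; exact ι.preimage_mono hcov
  · have h1 := congr($(ι.naturality (homOfLE (hW j)).op).hom s)
    exact (h1.symm.trans (hs j)).trans (map_zero _).symm

end

end LinearSyzygies

namespace LinearSyzygies

noncomputable section

attribute [local instance] MvPolynomial.gradedAlgebra

open HomogeneousLocalization (Away awayMap)

variable {k : Type u} [Field k] {n : ℕ}

/-! ### The ideal sheaf of a closed subscheme and its homogeneous ideal -/

lemma awayToFrac_injective {f : CoordRing k n} (hf : f ≠ 0) :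
    Function.Injective (awayToFrac f hf) := by
  refine Function.Injective.comp (g := Localization.awayLift _ f (isUnit_algebraMap hf)) ?_
    (HomogeneousLocalization.val_injective _)
  rw [injective_iff_map_eq_zero]
  intro x hx
  obtain ⟨a, s, rfl⟩ := IsLocalization.exists_mk'_eq (Submonoid.powers f) x
  rw [Localization.awayLift, IsLocalization.Away.lift, IsLocalization.lift_mk'] at hx
  have h1 := (Units.mul_left_eq_zero _).1 hx
  rw [map_eq_zero_iff _ (IsFractionRing.injective (CoordRing k n) (FracField k n))] at h1
  rw [h1, IsLocalization.mk'_zero]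

/-- The open sets `D₊(f x_i)` cover `D₊(f)`. -/
lemma dPlus_le_iSup (f : CoordRing k n) : dPlus f ≤ ⨆ i, dPlus (f * X i) := by
  intro x hx
  by_contra h
  refine x.not_irrelevant_le ?_
  rw [HomogeneousIdeal.irrelevant_le]
  intro d hd g hg
  have hX : ∀ i, X i ∈ x.asHomogeneousIdeal.toIdeal := fun i => by
    by_contra hi
    refine h (TopologicalSpace.Opens.mem_iSup.2 ⟨i, fun hfi => ?_⟩)
    rcases x.isPrime.mem_or_mem hfi with h' | h'
    · exact hx h'
    · exact hi h'
  have h1 : g ∈ Ideal.span (Set.range (X : Fin (n + 1) → CoordRing k n)) := by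
    rw [← Set.image_univ, mem_ideal_span_X_image]
    intro s hs
    by_contra! h0
    have h2 : s = 0 := by ext i; simpa using h0 i trivial
    have h3 := ((mem_homogeneousSubmodule _ _).1 hg) (mem_support_iff.1 hs)
    rw [h2, map_zero] at h3
    omega
  exact Ideal.span_le.2 (Set.range_subset_iff.2 hX) h1

/-- Sections of the ideal sheaf are detected on the open cover by the `D₊(f x_i)`. -/
lemma mem_idealSections_of_forall {Z : Scheme.{u}} (ι : Z ⟶ ProjSpace k n) {f : CoordRing k n}
    (a : Away (grading k n) f)
    (h : ∀ i, awayMap (grading k n) (X_mem_grading i) rfl a ∈ idealSections ι (f * X i)) :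
    a ∈ idealSections ι f := by
  refine eq_zero_of_cover ι (fun i => dPlus (f * X i))
    (fun i => Proj.basicOpen_mono (grading k n) f _ ⟨X i, rfl⟩) (dPlus_le_iSup f)
    ((Proj.awayToSection (grading k n) f).hom a) fun i => ?_
  have h1 := congr($(Proj.awayMap_awayToSection (grading k n) (f := f) (X_mem_grading i) rfl).hom a)
  exact (congrArg (ι.app (dPlus (f * X i))).hom h1).symm.trans (h i)

lemma basicOpen_awayToSection_le {f h : CoordRing k n} {d : ℕ} (hf : f ∈ grading k n d) (N : ℕ)
    (hh : h ∈ grading k n (N • d)) :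
    (ProjSpace k n).basicOpen ((Proj.awayToSection (grading k n) f).hom
      (Away.mk (grading k n) hf N h hh)) ≤ dPlus (f * h) := by
  intro x hx
  have hxf : x ∈ dPlus f := Scheme.basicOpen_le _ _ hx
  rw [Scheme.mem_basicOpen _ _ _ hxf] at hx
  intro hfh
  have hprime : x.asHomogeneousIdeal.toIdeal.IsPrime := x.isPrime
  have hxh : h ∈ x.asHomogeneousIdeal.toIdeal := (x.isPrime.mem_or_mem hfh).resolve_left hxf
  have h1 := congr($(ProjectiveSpectrum.Proj.awayToSection_germ (grading k n) f x hxf).hom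
    (Away.mk (grading k n) hf N h hh))
  have h2 : IsUnit ((AlgebraicGeometry.Proj.stalkIso' (grading k n) x).toCommRingCatIso.inv.hom
    (HomogeneousLocalization.mapId (grading k n) (Submonoid.powers_le.mpr hxf)
      (Away.mk (grading k n) hf N h hh))) := by
    exact (congrArg IsUnit h1).mp hx
  have h3 : IsUnit (HomogeneousLocalization.mapId (grading k n) (Submonoid.powers_le.mpr hxf)
      (Away.mk (grading k n) hf N h hh)) :=
    (MulEquiv.isUnit_map (AlgebraicGeometry.Proj.stalkIso' (grading k n) x).symm).1 h2
  rw [← HomogeneousLocalization.isUnit_iff_isUnit_val] at h3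
  have h4 : IsUnit (IsLocalization.mk' (Localization.AtPrime x.asHomogeneousIdeal.toIdeal) h
      (⟨f ^ N, fun hN => hxf (x.isPrime.mem_of_pow_mem _ hN)⟩ :
        x.asHomogeneousIdeal.toIdeal.primeCompl)) := by
    rw [← Localization.mk_eq_mk']
    exact h3
  exact (IsLocalization.AtPrime.isUnit_mk'_iff _ x.asHomogeneousIdeal.toIdeal _ _).1 h4 hxh

/-- A section of the ideal sheaf over `D₊(x_i h)` extends to `D₊(x_i)` after multiplication by a
power of `h / x_i ^ e`. -/
lemma exists_pow_mul_mem_idealSections {Z : Scheme.{u}} (ι : Z ⟶ ProjSpace k n) [QuasiCompact ι]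
    (i : Fin (n + 1)) {h : CoordRing k n} {e : ℕ} (hh : h ∈ grading k n e)
    (a : Away (grading k n) (X i : CoordRing k n))
    (ha : awayMap (grading k n) hh rfl a ∈ idealSections ι (X i * h)) :
    ∃ M : ℕ, Away.mk (grading k n) (X_mem_grading i) e h (by simpa using hh) ^ M * a ∈
      idealSections ι (X i) := by
  have h1 := congr($(Proj.awayMap_awayToSection (grading k n) (f := X i) hh rfl).hom a)
  obtain ⟨M, hM⟩ := exists_pow_mul_mem_ker ι
    (Proj.isAffineOpen_basicOpen (grading k n) (X i) (X_mem_grading i) one_pos)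
    (Proj.basicOpen_mono (grading k n) (X i) (X i * h) ⟨h, rfl⟩)
    ((Proj.awayToSection (grading k n) (X i)).hom
      (Away.mk (grading k n) (X_mem_grading i) e h (by simpa using hh)))
    ((Proj.awayToSection (grading k n) (X i)).hom a)
    (basicOpen_awayToSection_le (X_mem_grading i) e (h := h) (by simpa using hh))
    ((congrArg (ι.app (dPlus (X i * h))).hom h1).symm.trans ha)
  refine ⟨M, ?_⟩
  change (ι.app _).hom ((Proj.awayToSection (grading k n) (X i)).hom _) = 0
  rw [map_mul, map_pow]
  exact hM

/-- If `a / h ^ N` is a section of the ideal sheaf over `D₊(h)`, then some `h ^ M a` belongs to the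
homogeneous ideal. -/
lemma exists_pow_mul_mem_homogeneousIdeal {Z : Scheme.{u}} (ι : Z ⟶ ProjSpace k n)
    [QuasiCompact ι] {h : CoordRing k n} (h0 : h ≠ 0) {e : ℕ} (hh : h ∈ grading k n e) {N : ℕ}
    {a : CoordRing k n} (ha : a ∈ grading k n (N • e))
    (hmem : Away.mk (grading k n) hh N a ha ∈ idealSections ι h) :
    ∃ M : ℕ, h ^ M * a ∈ homogeneousIdeal ι := by
  have hpow : ∀ M : ℕ, h ^ M * a ∈ grading k n ((M + N) * e) := fun M => by
    rw [add_mul]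
    exact SetLike.mul_mem_graded (by simpa using SetLike.pow_mem_graded M hh) ha
  have h1 : ∀ i, ∃ M₀, ∀ M ≥ M₀, Away.mk (grading k n) (X_mem_grading i) ((M + N) * e) (h ^ M * a)
      (by simpa using hpow M) ∈ idealSections ι (X i) := by
    intro i
    have hres : awayMap (grading k n) hh rfl (Away.mk (grading k n) (X_mem_grading i) (N * e) a
        (by simpa using ha)) ∈ idealSections ι (X i * h) := by
      have h2 := awayMap_mem_idealSections ι (X_mem_grading i) (mul_comm (X i) h) hmem
      have hv : h ^ (N * e + N) ∈ grading k n ((N * e) • (1 + e)) := by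
        have := SetLike.pow_mem_graded (N * e + N) hh
        convert this using 1
        simp only [smul_eq_mul]
        ring_nf
      have hXh := SetLike.mul_mem_graded (X_mem_grading (k := k) i) hh
      convert Ideal.mul_mem_left _ (Away.mk (grading k n) hXh (N * e) _ hv) h2 using 1
      have hX := (isUnit_algebraMap (X_ne_zero (R := k) i)).ne_zero
      have hh0 := (isUnit_algebraMap h0).ne_zero
      refine awayToFrac_injective (mul_ne_zero (X_ne_zero i) h0) ?_
      rw [map_mul, awayToFrac_awayMap (X_ne_zero i) _ (X_mem_grading i),
        awayToFrac_awayMap h0 _ hh, awayToFrac_mk, awayToFrac_mk, awayToFrac_mk, map_mul, map_pow,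
        mul_pow, pow_add]
      field_simp
    obtain ⟨M₀, hM₀⟩ := exists_pow_mul_mem_idealSections ι i hh _ hres
    refine ⟨M₀, fun M hM => ?_⟩
    obtain ⟨L, rfl⟩ := Nat.exists_eq_add_of_le' hM
    have h3 := Ideal.mul_mem_left _ (Away.mk (grading k n) (X_mem_grading i) e h
      (by simpa using hh) ^ L) hM₀
    rw [← mul_assoc, ← pow_add] at h3
    convert h3 using 1
    refine awayToFrac_injective (X_ne_zero i) ?_
    have := (isUnit_algebraMap (X_ne_zero (R := k) i)).ne_zero
    rw [map_mul, map_pow, awayToFrac_mk, awayToFrac_mk, awayToFrac_mk, map_mul, map_pow, add_mul,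
      pow_add _ ((L + M₀) * e), mul_comm (L + M₀) e, pow_mul, div_pow, div_mul_div_comm]
  choose M₀ hM₀ using h1
  refine ⟨Finset.univ.sup M₀, Ideal.subset_span ⟨_, hpow _, fun i => ?_⟩⟩
  exact hM₀ i _ (Finset.le_sup (Finset.mem_univ i))

/-- A form vanishing on a closed subscheme vanishes there also with respect to the chart defined by
an arbitrary linear form. -/
lemma mk_mem_idealSections_of_linear {Z : Scheme.{u}} (ι : Z ⟶ ProjSpace k n) {f : CoordRing k n}
    {d : ℕ} (hf : f ∈ grading k n d)
    (h : ∀ i, Away.mk (grading k n) (X_mem_grading i) d f (by simpa using hf) ∈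
      idealSections ι (X i)) {l : CoordRing k n} (hl : l ∈ grading k n 1) (hl0 : l ≠ 0) :
    Away.mk (grading k n) hl d f (by simpa using hf) ∈ idealSections ι l := by
  refine mem_idealSections_of_forall ι _ fun i => ?_
  have hlX := SetLike.mul_mem_graded hl (X_mem_grading (k := k) i)
  have h1 := awayMap_mem_idealSections ι hl (mul_comm l (X i)) (h i)
  have hv : (X i ^ (2 * d) : CoordRing k n) ∈ grading k n (d • (1 + 1)) := by
    have := SetLike.pow_mem_graded (2 * d) (X_mem_grading (k := k) i)
    convert this using 1
    simp only [smul_eq_mul]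
    ring_nf
  convert Ideal.mul_mem_left _ (Away.mk (grading k n) hlX d _ hv) h1 using 1
  have hX := (isUnit_algebraMap (X_ne_zero (R := k) i)).ne_zero
  have hl' := (isUnit_algebraMap hl0).ne_zero
  refine awayToFrac_injective (mul_ne_zero hl0 (X_ne_zero i)) ?_
  rw [map_mul, awayToFrac_awayMap hl0 _ hl, awayToFrac_awayMap (X_ne_zero i) _ (X_mem_grading i),
    awayToFrac_mk, awayToFrac_mk, awayToFrac_mk, map_mul, map_pow, mul_pow]
  field_simp
  ring

/-! ### The ideal of a linear section -/

section LinearSection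

variable {m r : ℕ} {X' : Scheme.{u}} (ι : X' ⟶ ProjSpace k r)
  (b : Fin (m + 1) → Fin (r + 1) → k)

lemma awayMap_mem_idealSections_pullback_snd (hb : LinearIndependent k b) {l : CoordRing k r}
    (hl : l ∈ grading k r 1)
    {a : Away (grading k r) l} (ha : a ∈ idealSections ι l) :
    Away.map (linearSubst b) l a ∈
      idealSections (pullback.snd ι (linearSubspace b hb)) (linearSubst b l) := by
  have h1 := congr($(Proj.awayToSection_comp_appLE (linearSubst b)
    (irrelevant_le_map_linearSubst hb) hl).hom a)
  have e₁ : pullback.snd ι (linearSubspace b hb) ⁻¹ᵁ dPlus (linearSubst b l) ≤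
      (pullback.snd ι (linearSubspace b hb) ≫ linearSubspace b hb) ⁻¹ᵁ dPlus l := le_rfl
  have e₂ : pullback.snd ι (linearSubspace b hb) ⁻¹ᵁ dPlus (linearSubst b l) ≤
      (pullback.fst ι (linearSubspace b hb) ≫ ι) ⁻¹ᵁ dPlus l := by
    rw [pullback.condition]; exact e₁
  have h2 : (pullback.snd ι (linearSubspace b hb) ≫ linearSubspace b hb).appLE (dPlus l) _ e₁ =
      (pullback.fst ι (linearSubspace b hb) ≫ ι).appLE (dPlus l) _ e₂ := by
    simp only [pullback.condition]
  rw [Scheme.Hom.comp_appLE, Scheme.Hom.comp_appLE] at h2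
  have h3 := congr($(h2).hom ((Proj.awayToSection (grading k r) l).hom a))
  have h4 : ((pullback.snd ι (linearSubspace b hb)).app (dPlus (linearSubst b l))).hom
      (((linearSubspace b hb).app (dPlus l)).hom
        ((Proj.awayToSection (grading k r) l).hom a)) = 0 := by
    have h5 : (pullback.snd ι (linearSubspace b hb)).appLE _ _ e₁ =
      (pullback.snd ι (linearSubspace b hb)).app (dPlus (linearSubst b l)) :=
        Scheme.Hom.appLE_eq_app _
    rw [← h5]
    refine Eq.trans h3 ?_
    exact (congrArg (((pullback.fst ι (linearSubspace b hb)).appLE (ι ⁻¹ᵁ dPlus l) _ e₂).hom)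
      ha).trans (RingHom.map_zero _)
  have h6 : (linearSubspace b hb).appLE (dPlus l) (dPlus (linearSubst b l)) le_rfl =
      (linearSubspace b hb).app (dPlus l) := Scheme.Hom.appLE_eq_app _
  rw [← h6] at h4
  exact (congrArg ((pullback.snd ι (linearSubspace b hb)).app _).hom h1).symm.trans h4

lemma exists_linearSubst_eq (hb : LinearIndependent k b) {d : ℕ} {a : CoordRing k m}
    (ha : a ∈ grading k m d) :
    ∃ f ∈ grading k r d, linearSubst b f = a := by
  obtain ⟨f, hf⟩ := linearSubst_surjective hb a
  refine ⟨_, (DirectSum.decompose (grading k r) f d).2, ?_⟩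
  rw [map_directSumDecompose (grading k r) (grading k m), hf]
  exact DirectSum.decompose_of_mem_same (grading k m) ha

lemma away_map_surjective (hb : LinearIndependent k b) {l : CoordRing k r}
    (hl : l ∈ grading k r 1) :
    Function.Surjective (Away.map (linearSubst b) l) := by
  have hl' : linearSubst b l ∈ grading k m 1 := (linearSubst b).2 hl
  intro a
  obtain ⟨N, a, ha, rfl⟩ := Away.mk_surjective (grading k m) hl' a
  obtain ⟨f, hf, rfl⟩ := exists_linearSubst_eq b hb ha
  exact ⟨Away.mk (grading k r) hl N f hf, HomogeneousLocalization.Away.map_mk ..⟩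

lemma mem_map_idealSections_of_pullback_snd (hb : LinearIndependent k b) [IsClosedImmersion ι]
    {l : CoordRing k r} (hl : l ∈ grading k r 1)
    {a : Away (grading k m) (linearSubst b l)}
    (ha : a ∈ idealSections (pullback.snd ι (linearSubspace b hb)) (linearSubst b l)) :
    a ∈ (idealSections ι l).map (Away.map (linearSubst b) l) := by
  have hl' : linearSubst b l ∈ grading k m 1 := (linearSubst b).2 hl
  have h1 := mem_map_ker_of_pullback_snd ι (linearSubspace b hb)
    (Proj.isAffineOpen_basicOpen (grading k r) l hl one_pos)
    (Proj.isAffineOpen_basicOpen (grading k m) (linearSubst b l) hl' one_pos) le_rfl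
    ((Proj.awayToSection (grading k m) _).hom a) ha
  have h2 : RingHom.ker (ι.app (dPlus l)).hom =
      (idealSections ι l).map (Proj.awayToSection (grading k r) l).hom := by
    have hs : Function.Surjective (Proj.awayToSection (grading k r) l).hom :=
      (ConcreteCategory.bijective_of_isIso (Proj.basicOpenIsoAway (grading k r) l hl one_pos).hom).2
    have : idealSections ι l = (RingHom.ker (ι.app (dPlus l)).hom).comap
      (Proj.awayToSection (grading k r) l).hom := rfl
    rw [this, Ideal.map_comap_of_surjective _ hs]
  rw [h2, Ideal.map_map] at h1
  have h3 := congr($(Proj.awayToSection_comp_appLE (linearSubst b)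
    (irrelevant_le_map_linearSubst hb) hl).hom)
  have h4 : (Proj.awayToSection (grading k m) (linearSubst b l)).hom a ∈
      (idealSections ι l).map (CommRingCat.ofHom (Away.map (linearSubst b) l) ≫
        Proj.awayToSection (grading k m) (linearSubst b l)).hom := by
    rw [← h3]; exact h1
  rw [CommRingCat.hom_comp, ← Ideal.map_map, ← Ideal.mem_comap, Ideal.comap_map_of_bijective] at h4
  · exact h4
  · exact ConcreteCategory.bijective_of_isIso
      (Proj.basicOpenIsoAway (grading k m) (linearSubst b l) hl' one_pos).hom

end LinearSection

end

end LinearSyzygies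

namespace LinearSyzygies

noncomputable section

attribute [local instance] MvPolynomial.gradedAlgebra

open HomogeneousLocalization (Away awayMap)

variable {k : Type u} [Field k] {n : ℕ}

/-! ### Sections of twisted ideal sheaves -/

lemma fracX_ne_zero (i : Fin (n + 1)) : (fracX i : FracField k n) ≠ 0 :=
  (isUnit_algebraMap (X_ne_zero i)).ne_zero

/-- The graded family of the elements `x_i ^ d g`, where `g` is a section of the ideal sheaf over
`D₊(x_i)`. -/
def chartFamily {Z : Scheme.{u}} (ι : Z ⟶ ProjSpace k n) (i : Fin (n + 1)) :
    GradedFamily k n (FracField k n) where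
  piece d :=
    { carrier := {x | ∃ g ∈ idealSections ι (X i),
        x = fracX i ^ d * awayToFrac (X i) (X_ne_zero i) g}
      zero_mem' := ⟨0, zero_mem _, by simp⟩
      add_mem' := by
        rintro _ _ ⟨g, hg, rfl⟩ ⟨h, hh, rfl⟩
        exact ⟨g + h, add_mem hg hh, by rw [map_add, mul_add]⟩
      neg_mem' := by
        rintro _ ⟨g, hg, rfl⟩
        exact ⟨-g, neg_mem hg, by rw [map_neg, mul_neg]⟩ }
  smul_mem := by
    rintro d e f _ hf ⟨g, hg, rfl⟩
    refine ⟨Away.mk (grading k n) (X_mem_grading i) e f (by simpa using hf) * g,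
      Ideal.mul_mem_left _ _ hg, ?_⟩
    have := fracX_ne_zero (k := k) i
    rw [map_mul, awayToFrac_mk, Algebra.smul_def, zpow_add₀ this, zpow_natCast]
    change _ = _ * (_ / fracX i ^ e * _)
    field_simp

/-- The forms that vanish on a closed subscheme in the chart `D₊(x_i)` are those of an ideal, the
colon ideal of `chartFamily` at `1`. -/
lemma mem_colon_chartFamily {Z : Scheme.{u}} (ι : Z ⟶ ProjSpace k n) (i : Fin (n + 1)) {d : ℕ}
    {f : CoordRing k n} (hf : f ∈ grading k n d) :
    f ∈ (chartFamily ι i).colon 0 1 ↔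
      Away.mk (grading k n) (X_mem_grading i) d f (by simpa using hf) ∈ idealSections ι (X i) := by
  have h0 := fracX_ne_zero (k := k) i
  rw [GradedFamily.mem_colon_iff hf]
  constructor
  · rintro ⟨g, hg, h⟩
    convert hg using 1
    refine awayToFrac_injective (X_ne_zero i) ?_
    rw [awayToFrac_mk]
    rw [Algebra.smul_def, mul_one, zero_add, zpow_natCast] at h
    rw [h]
    change fracX i ^ d * _ / fracX i ^ d = _
    field_simp
  · refine fun h => ⟨_, h, ?_⟩
    rw [Algebra.smul_def, mul_one, zero_add, zpow_natCast, awayToFrac_mk]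
    change _ = fracX i ^ d * (_ / fracX i ^ d)
    field_simp

/-- A section of the ideal sheaf over `D₊(x_i h)` extends to `D₊(x_i)` after multiplication by a
power of `h`, up to a power of the unit `x_i`. -/
lemma exists_mk_mem_idealSections {Z : Scheme.{u}} (ι : Z ⟶ ProjSpace k n) [QuasiCompact ι]
    (i : Fin (n + 1)) {h x : CoordRing k n} (h0 : h ≠ 0) {e d : ℕ} (hh : h ∈ grading k n e)
    (hx : X i * h = x) (hd : 1 + e = d) (hxd : x ∈ grading k n d) {N : ℕ} {a : CoordRing k n}
    (ha : a ∈ grading k n (N • d)) (hmem : Away.mk (grading k n) hxd N a ha ∈ idealSections ι x) :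
    ∃ (M : ℕ) (hM : h ^ M * a ∈ grading k n ((M * e + N * d) • 1)),
      Away.mk (grading k n) (X_mem_grading i) (M * e + N * d) (h ^ M * a) hM ∈
        idealSections ι (X i) := by
  subst hx hd
  have hX := fracX_ne_zero (k := k) i
  have hX' : algebraMap (CoordRing k n) (FracField k n) (X i) ≠ 0 := hX
  have hh0 := (isUnit_algebraMap h0).ne_zero
  have hv : h ^ (N * e + N) ∈ grading k n ((N * e) • (1 + e)) := by
    have := SetLike.pow_mem_graded (N * e + N) hh
    convert this using 1
    simp only [smul_eq_mul]
    ring_nf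
  have hres : awayMap (grading k n) hh rfl (Away.mk (grading k n) (X_mem_grading i) (N * (1 + e)) a
      (by simpa using ha)) ∈ idealSections ι (X i * h) := by
    convert Ideal.mul_mem_left _ (Away.mk (grading k n) hxd (N * e) _ hv) hmem using 1
    refine awayToFrac_injective (mul_ne_zero (X_ne_zero i) h0) ?_
    rw [map_mul, awayToFrac_awayMap (X_ne_zero i) _ (X_mem_grading i), awayToFrac_mk, awayToFrac_mk,
      awayToFrac_mk, map_mul, map_pow, mul_pow, mul_pow, pow_add, mul_add, pow_add, mul_one]
    field_simp
  obtain ⟨M, hM⟩ := exists_pow_mul_mem_idealSections ι i hh _ hres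
  refine ⟨M, ?_, ?_⟩
  · rw [smul_eq_mul, mul_one]
    exact SetLike.mul_mem_graded (by simpa using SetLike.pow_mem_graded M hh) (by simpa using ha)
  · convert hM using 1
    refine awayToFrac_injective (X_ne_zero i) ?_
    rw [map_mul, map_pow, awayToFrac_mk, awayToFrac_mk, awayToFrac_mk, map_mul, map_pow,
      pow_add _ (M * e), mul_comm M e, pow_mul _ e, div_pow, div_mul_div_comm]

section LinearSection

variable {m r : ℕ} {Z : Scheme.{u}} (ι : Z ⟶ ProjSpace k r)
  (b : Fin (m + 1) → Fin (r + 1) → k)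

/-- The extension to `k[y_0, …, y_m]` of the homogeneous ideal of a closed subscheme of `ℙʳ`. It
defines the intersection of this subscheme with a linear subspace, but it need not be saturated. -/
abbrev restrictedIdeal : Ideal (CoordRing k m) := (homogeneousIdeal ι).map (linearSubst b)

lemma isHomogeneous_restrictedIdeal : (restrictedIdeal ι b).IsHomogeneous (grading k m) := by
  rw [restrictedIdeal, homogeneousIdeal, Ideal.map_span]
  refine Ideal.homogeneous_span _ _ ?_
  rintro _ ⟨f, ⟨d, hd, -⟩, rfl⟩
  exact ⟨d, (linearSubst b).2 hd⟩

lemma mk_mem_idealSections_of_mem_restrictedIdeal (hb : LinearIndependent k b) (i : Fin (m + 1))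
    {f : CoordRing k m} (hf : f ∈ restrictedIdeal ι b) {d : ℕ} (hd : f ∈ grading k m d) :
    Away.mk (grading k m) (X_mem_grading i) d f (by simpa using hd) ∈
      idealSections (pullback.snd ι (linearSubspace b hb)) (X i) := by
  rw [← mem_colon_chartFamily _ i hd]
  refine Ideal.map_le_iff_le_comap.2 (Ideal.span_le.2 ?_) hf
  rintro g ⟨e, hg, hvan⟩
  change linearSubst b g ∈ (chartFamily (pullback.snd ι (linearSubspace b hb)) i).colon 0 1
  have hg' : linearSubst b g ∈ grading k m e := (linearSubst b).2 hg
  rw [mem_colon_chartFamily _ i hg']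
  obtain ⟨l, hl, hlX⟩ := exists_linearSubst_eq b hb (X_mem_grading (k := k) i)
  have hl0 : l ≠ 0 := by
    rintro rfl
    exact X_ne_zero (R := k) i (by rw [← hlX, map_zero])
  have key : ∀ y, linearSubst b l = y → ∀ hy : y ∈ grading k m 1,
      Away.mk (grading k m) hy e (linearSubst b g) (by simpa using (linearSubst b).2 hg) ∈
        idealSections (pullback.snd ι (linearSubspace b hb)) y := by
    rintro _ rfl hy
    have := awayMap_mem_idealSections_pullback_snd ι b hb hl
      (mk_mem_idealSections_of_linear ι hg hvan hl hl0)
    rwa [HomogeneousLocalization.Away.map_mk] at this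
  exact key _ hlX _

lemma exists_X_pow_mul_mem_restrictedIdeal [IsClosedImmersion ι] (hb : LinearIndependent k b)
    (i : Fin (m + 1)) {a : CoordRing k m} {N : ℕ} (ha : a ∈ grading k m (N • 1))
    (h : Away.mk (grading k m) (X_mem_grading i) N a ha ∈
      idealSections (pullback.snd ι (linearSubspace b hb)) (X i)) :
    ∃ M : ℕ, X i ^ M * a ∈ restrictedIdeal ι b := by
  obtain ⟨l, hl, hlX⟩ := exists_linearSubst_eq b hb (X_mem_grading (k := k) i)
  have key : ∀ y, linearSubst b l = y → y ≠ 0 → ∀ hy : y ∈ grading k m 1,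
      Away.mk (grading k m) hy N a ha ∈
        idealSections (pullback.snd ι (linearSubspace b hb)) y →
      ∃ M : ℕ, y ^ M * a ∈ restrictedIdeal ι b := by
    rintro _ rfl hy0 hy hmem
    have hl0 : l ≠ 0 := by rintro rfl; exact hy0 (map_zero _)
    obtain ⟨c, hc, hca⟩ := (Ideal.mem_map_iff_of_surjective _ (away_map_surjective b hb hl)).1
      (mem_map_idealSections_of_pullback_snd ι b hb hl hmem)
    obtain ⟨M, c, hcM, rfl⟩ := Away.mk_surjective (grading k r) hl c
    obtain ⟨L, hL⟩ := exists_pow_mul_mem_homogeneousIdeal ι hl0 hl hcM hc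
    have h1 := Ideal.mem_map_of_mem (linearSubst b) hL
    refine ⟨M + L, ?_⟩
    rw [HomogeneousLocalization.Away.map_mk] at hca
    have h2 := congrArg (awayToFrac _ hy0) hca
    rw [awayToFrac_mk, awayToFrac_mk] at h2
    have hu := (isUnit_algebraMap hy0).ne_zero
    rw [div_eq_div_iff (pow_ne_zero _ hu) (pow_ne_zero _ hu)] at h2
    have h3 : linearSubst b c * linearSubst b l ^ N = a * linearSubst b l ^ M := by
      apply IsFractionRing.injective (CoordRing k m) (FracField k m)
      simpa only [map_mul, map_pow] using h2
    have h4 : linearSubst b l ^ (M + L) * a =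
        linearSubst b l ^ N * (linearSubst b l ^ L * linearSubst b c) := by
      linear_combination (-linearSubst b l ^ L) * h3
    rw [h4, ← map_pow (linearSubst b) l L, ← map_mul]
    exact Ideal.mul_mem_left _ _ h1
  exact key _ hlX (X_ne_zero i) _ h

/-- The sections of a twist of the ideal sheaf of a linear section are given by the restricted
ideal. -/
lemma mem_twistedSections_iff [IsClosedImmersion ι] (hb : LinearIndependent k b)
    {σ : Finset (Fin (m + 1))} (hσ : σ.Nonempty) (d : ℤ) {s : FracField k m} :
    s ∈ twistedSections (pullback.snd ι (linearSubspace b hb)) d σ ↔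
      s ∈ (idealFamily (restrictedIdeal ι b)).sections σ d := by
  constructor
  · intro hs
    obtain ⟨i, hi⟩ := hσ
    obtain ⟨g, hg, rfl⟩ := hs i hi
    obtain ⟨N, a, ha, rfl⟩ := Away.mk_surjective (grading k m) (faceMonomial_mem σ) g
    have hcard : 1 + (σ.erase i).card = σ.card := by
      rw [add_comm]; exact Finset.card_erase_add_one hi
    obtain ⟨M, hM, hmem⟩ := exists_mk_mem_idealSections _ i (faceMonomial_ne_zero (σ.erase i))
      (faceMonomial_mem _) (Finset.mul_prod_erase σ _ hi) hcard (faceMonomial_mem σ) ha hg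
    obtain ⟨L, hL⟩ := exists_X_pow_mul_mem_restrictedIdeal ι b hb i hM hmem
    have hX := fracX_ne_zero (k := k) i
    have hXh : faceMonomial k σ = X i * faceMonomial k (σ.erase i) :=
      (Finset.mul_prod_erase σ _ hi).symm
    have hf0 := (isUnit_algebraMap (faceMonomial_ne_zero (k := k) σ)).ne_zero
    obtain ⟨p, q, rfl⟩ : ∃ p q : ℕ, d = p - q := ⟨d.toNat, (-d).toNat, by omega⟩
    have hmemJ : faceMonomial k σ ^ (M + L) * a *
        (X i ^ p * faceMonomial k (σ.erase i) ^ q) ∈ restrictedIdeal ι b := by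
      refine Ideal.mul_mem_right _ _ ?_
      have h1 : faceMonomial k σ ^ (M + L) * a = X i ^ M * faceMonomial k (σ.erase i) ^ L *
          (X i ^ L * (faceMonomial k (σ.erase i) ^ M * a)) := by
        rw [hXh]; ring
      rw [h1]
      exact Ideal.mul_mem_left _ _ hL
    have hdeg := SetLike.mul_mem_graded (SetLike.mul_mem_graded
      (GradedFamily.faceMonomial_pow_mem (k := k) σ (M + L)) ha) (SetLike.mul_mem_graded
        (GradedFamily.X_pow_mem_grading (k := k) i p)
        (GradedFamily.faceMonomial_pow_mem (k := k) (σ.erase i) q))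
    refine ⟨N + M + L + q, ?_⟩
    have h2 := (algebraMap_mem_idealFamily (J := restrictedIdeal ι b)
      (intComponent_of_mem hdeg)).2 hmemJ
    convert GradedFamily.mem_piece_of_eq _ ?_ h2 using 1
    · rw [Algebra.smul_def, awayToFrac_mk, zpow_sub₀ hX, zpow_natCast, zpow_natCast]
      have h3 : algebraMap (CoordRing k m) (FracField k m) (faceMonomial k σ) =
        fracX i * algebraMap _ _ (faceMonomial k (σ.erase i)) := by rw [hXh, map_mul]; rfl
      have h4 : algebraMap (CoordRing k m) (FracField k m) (X i) = fracX i := rfl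
      simp only [map_mul, map_pow, h4]
      rw [pow_add _ (N + M + L) q]
      rw [show algebraMap (CoordRing k m) (FracField k m) (faceMonomial k σ) ^ q =
        fracX i ^ q * algebraMap _ _ (faceMonomial k (σ.erase i)) ^ q by rw [h3, mul_pow]]
      field_simp
      ring
    · rw [← hcard]
      simp only [smul_eq_mul]
      push_cast
      ring
  · rintro ⟨N, f, hf, hfd, hfs⟩ i hi
    have hXh : faceMonomial k σ = X i * faceMonomial k (σ.erase i) :=
      (Finset.mul_prod_erase σ _ hi).symm
    have hX := fracX_ne_zero (k := k) i
    have hf0 := (isUnit_algebraMap (faceMonomial_ne_zero (k := k) σ)).ne_zero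
    rw [Algebra.smul_def, map_pow] at hfs
    rcases lt_or_ge (d + (N * σ.card : ℕ)) 0 with hneg | hpos
    · rw [intComponent_of_neg hneg] at hfd
      rw [← hfd, map_zero, eq_comm, mul_eq_zero, or_iff_right (pow_ne_zero _ hf0)] at hfs
      exact ⟨0, zero_mem _, by rw [hfs, map_zero, mul_zero]⟩
    · obtain ⟨E, hE⟩ := Int.eq_ofNat_of_zero_le hpos
      rw [hE] at hfd
      have hfE := mem_grading_of_intComponent_eq hfd
      have h1 := awayMap_mem_idealSections _ (faceMonomial_mem (k := k) (σ.erase i))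
        hXh (mk_mem_idealSections_of_mem_restrictedIdeal ι b hb i hf hfE)
      have hXN : (X i ^ (N * σ.card) : CoordRing k m) ∈ grading k m (N • σ.card) :=
        GradedFamily.X_pow_mem_grading i _
      refine ⟨_, Ideal.mul_mem_left _ (Away.mk (grading k m) (faceMonomial_mem σ) N _ hXN) h1, ?_⟩
      rw [map_mul, awayToFrac_awayMap (X_ne_zero i) _ (X_mem_grading i), awayToFrac_mk,
        awayToFrac_mk, hfs, map_pow]
      have h4 : algebraMap (CoordRing k m) (FracField k m) (X i) = fracX i := rfl
      have h5 : (fracX i : FracField k m) ^ d * fracX i ^ (N * σ.card) = fracX i ^ E := by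
        rw [← zpow_natCast, ← zpow_add₀ hX, hE]; exact zpow_natCast _ _
      rw [h4]
      field_simp
      linear_combination (-s) * h5

end LinearSection

end

end LinearSyzygies

namespace LinearSyzygies

noncomputable section

attribute [local instance] MvPolynomial.gradedAlgebra

variable {k : Type u} [Field k] {n : ℕ}

/-! ### Čech cohomology of the ideal sheaf -/

lemma coe_cechDiff {Z : Scheme.{u}} (τ : Z ⟶ ProjSpace k n) (d : ℤ) (q : ℕ) (c : CechCochain τ d q)
    (C : Finset (Fin (n + 1)) → FracField k n) (hC : ∀ σ : Face n q, C σ.1 = c σ)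
    (σ : Face n (q + 1)) : (cechDiff τ d q c σ : FracField k n) = coboundary C σ.1 := by
  rw [coboundary_apply, ← Finset.sum_coe_sort]
  change ((∑ i : {i // i ∈ σ.1}, (-1 : ℤ) ^ (σ.1.filter (· < i.1)).card •
    AddSubgroup.inclusion _ (c (σ.erase i)) : twistedSections τ d σ.1) : FracField k n) = _
  rw [AddSubgroup.val_finsetSum]
  refine Finset.sum_congr rfl fun i _ => ?_
  rw [AddSubgroup.coe_zsmul, AddSubgroup.coe_inclusion, ← hC]
  rfl

lemma subsingleton_idealCohomology {Z : Scheme.{u}} (τ : Z ⟶ ProjSpace k n)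
    {V : GradedFamily k n (FracField k n)} {d : ℤ} {q : ℕ}
    (hV : ∀ σ : Finset (Fin (n + 1)), σ.Nonempty →
      ∀ s, s ∈ twistedSections τ d σ ↔ s ∈ V.sections σ d)
    (h : Acyclic ⊥ V (q + 2) d) : Subsingleton (IdealCohomology τ d (q + 1)) := by
  classical
  suffices key : (cechCoboundaries τ d (q + 1)).addSubgroupOf (cechDiff τ d (q + 1)).ker = ⊤ by
    rw [IdealCohomology, key]
    exact QuotientAddGroup.subsingleton_quotient_top
  rw [eq_top_iff]
  rintro ⟨c, hc⟩ -
  rw [AddSubgroup.mem_addSubgroupOf]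
  have hmem : ∀ {q : ℕ} {σ : Finset (Fin (n + 1))}, σ.card = q + 1 → σ.Nonempty := fun h =>
    Finset.card_pos.1 (by omega)
  let C : Finset (Fin (n + 1)) → FracField k n := fun σ =>
    if hσ : σ.card = q + 2 then (c ⟨σ, hσ⟩ : FracField k n) else 0
  have hC : ∀ σ : Face n (q + 1), C σ.1 = c σ := fun σ => dif_pos σ.2
  obtain ⟨e, he, hCe⟩ := h C (fun σ hσ => (hV σ (hmem hσ) _).1 (by
      rw [hC ⟨σ, hσ⟩]; exact (c ⟨σ, hσ⟩).2))
    (fun σ hσ => by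
      rw [mem_sections_bot, ← coe_cechDiff τ d (q + 1) c C hC ⟨σ, hσ⟩, (hc : cechDiff _ _ _ c = 0)]
      rfl)
  refine ⟨fun σ => ⟨e σ.1, (hV σ.1 σ.nonempty _).2 (he σ.1 (by rw [σ.2]))⟩, ?_⟩
  ext σ
  rw [coe_cechDiff τ d q _ e (fun _ => rfl), ← hC]
  have := hCe σ.1 σ.2
  rw [mem_sections_bot, sub_eq_zero] at this
  exact this.symm

/-! ### Points of a linear section -/

lemma idealSections_eq_top {Z : Scheme.{u}} (ι : Z ⟶ ProjSpace k n) {f : CoordRing k n}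
    (hf : ∀ z : Z, ι z ∉ dPlus f) : idealSections ι f = ⊤ := by
  have h1 : ι ⁻¹ᵁ dPlus f = ⊥ := by
    ext z
    simpa using hf z
  rw [Ideal.eq_top_iff_one]
  change (ι.app (dPlus f)).hom ((Proj.awayToSection (grading k n) f).hom 1) = 0
  have : Subsingleton Γ(Z, ι ⁻¹ᵁ dPlus f) := by
    rw [h1]; infer_instance
  exact Subsingleton.elim _ _

/-- A point of projective space whose prime contains the homogeneous ideal of a closed subscheme
lies on this subscheme. -/
lemma mem_range_of_homogeneousIdeal_le {Z : Scheme.{u}} (ι : Z ⟶ ProjSpace k n)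
    [IsClosedImmersion ι] (p : ProjectiveSpectrum (grading k n))
    (hp : homogeneousIdeal ι ≤ p.asHomogeneousIdeal.toIdeal) : p ∈ Set.range ι := by
  classical
  by_contra hmem
  obtain ⟨T, hT⟩ := (ProjectiveSpectrum.isClosed_iff_zeroLocus (grading k n) _).1
    ι.isClosedEmbedding.isClosed_range
  rw [hT] at hmem
  obtain ⟨f, hfT, hfp⟩ := Set.not_subset.1 (hmem : ¬ T ⊆ (p.asHomogeneousIdeal : Set _))
  obtain ⟨d, hd⟩ : ∃ d, (DirectSum.decompose (grading k n) f d : CoordRing k n) ∉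
      p.asHomogeneousIdeal.toIdeal := by
    by_contra! h
    refine hfp ?_
    rw [← DirectSum.sum_support_decompose (grading k n) f]
    exact sum_mem fun d _ => h d
  set g : CoordRing k n := (DirectSum.decompose (grading k n) f d : CoordRing k n)
  have hg : g ∈ grading k n d := (DirectSum.decompose (grading k n) f d).2
  have h0 : g ≠ 0 := fun h => hd (h ▸ zero_mem _)
  have htop : idealSections ι g = ⊤ := idealSections_eq_top ι fun z hz => hz (by
    have h1 : ι z ∈ ProjectiveSpectrum.zeroLocus (grading k n) T := hT ▸ ⟨z, rfl⟩
    exact (ι z).asHomogeneousIdeal.isHomogeneous d (h1 hfT))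
  obtain ⟨M, hM⟩ := exists_pow_mul_mem_homogeneousIdeal ι h0 hg (N := 0) (a := 1)
    (by
      rw [zero_smul]; exact (mem_homogeneousSubmodule 0 _).2 (isHomogeneous_one _ k))
    (htop ▸ Submodule.mem_top)
  rw [mul_one] at hM
  exact hd (p.isPrime.mem_of_pow_mem _ (hp hM))

lemma mem_range_snd_of_restrictedIdeal_le {m r : ℕ} {Z : Scheme.{u}} (ι : Z ⟶ ProjSpace k r)
    [IsClosedImmersion ι] (b : Fin (m + 1) → Fin (r + 1) → k) (hb : LinearIndependent k b)
    (p : ProjectiveSpectrum (grading k m))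
    (hp : restrictedIdeal ι b ≤ p.asHomogeneousIdeal.toIdeal) :
    ∃ z, pullback.snd ι (linearSubspace b hb) z = p := by
  have h1 : linearSubspace b hb p ∈ Set.range ι :=
    mem_range_of_homogeneousIdeal_le ι _ (Ideal.map_le_iff_le_comap.1 hp)
  have h2 : p ∈ linearSubspace b hb ⁻¹' Set.range ι := h1
  rwa [← Scheme.Pullback.range_snd] at h2

/-- Chains of homogeneous primes over the restricted ideal are chains of irreducible closed subsets
of the linear section. -/
lemma length_le_topologicalKrullDim {m r : ℕ} {Z : Scheme.{u}} (ι : Z ⟶ ProjSpace k r)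
    [IsClosedImmersion ι] (b : Fin (m + 1) → Fin (r + 1) → k) (hb : LinearIndependent k b)
    (s : LTSeries (ProjectiveSpectrum (grading k m)))
    (hs : restrictedIdeal ι b ≤ s.head.asHomogeneousIdeal.toIdeal) :
    (s.length : WithBot ℕ∞) ≤ topologicalKrullDim ↥(pullback ι (linearSubspace b hb)) := by
  have hex : ∀ i, ∃ z, pullback.snd ι (linearSubspace b hb) z = s i := fun i =>
    mem_range_snd_of_restrictedIdeal_le ι b hb _
      (hs.trans (show s.head.asHomogeneousIdeal ≤ (s i).asHomogeneousIdeal from s.head_le i))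
  choose z hz using hex
  have hlt : ∀ i j, s i < s j → z j ∈ closure {z i} ∧ z i ∉ closure {z j} := by
    have hspec : ∀ i j, z i ∈ closure {z j} ↔ s j ≤ s i := fun i j => by
      rw [← specializes_iff_mem_closure, ←
        (pullback.snd ι (linearSubspace b hb)).isClosedEmbedding.isInducing.specializes_iff]
      rw [hz, hz, ProjectiveSpectrum.le_iff_mem_closure, ← specializes_iff_mem_closure]
      rfl
    intro i j hij
    rw [hspec, hspec]
    exact ⟨hij.le, hij.not_ge⟩
  let F : Fin (s.length + 1) → TopologicalSpace.IrreducibleCloseds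
      ↥(pullback ι (linearSubspace b hb)) := fun i =>
    ⟨closure {z i.rev}, isIrreducible_singleton.closure, isClosed_closure⟩
  have hF : StrictMono F := by
    intro i j hij
    have h1 := hlt _ _ (s.strictMono (Fin.rev_lt_rev.2 hij))
    refine lt_of_le_of_ne ?_ fun he => ?_
    · exact closure_minimal (Set.singleton_subset_iff.2 h1.1) isClosed_closure
    · have : closure {z i.rev} = closure {z j.rev} := congrArg (·.carrier) he
      exact h1.2 (this ▸ subset_closure rfl)
  exact Order.LTSeries.length_le_krullDim (LTSeries.mk s.length F hF)

end

end LinearSyzygies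

namespace LinearSyzygies

noncomputable section

attribute [local instance] MvPolynomial.gradedAlgebra

open HomogeneousLocalization (Away awayMap)

variable {k : Type u} [Field k] {n : ℕ}

/-! ### Finite linear sections: functions come from linear forms -/

lemma GradedFamily.mem_sections_of_X_pow_smul {E : Type*} [AddCommGroup E]
    [Module (CoordRing k n) E] {V : GradedFamily k n E} {σ : Finset (Fin (n + 1))}
    {i : Fin (n + 1)} (hi : i ∈ σ) {d : ℤ} {A : ℕ} {x : E}
    (h : (X i ^ A : CoordRing k n) • x ∈ V.sections σ (d + A)) : x ∈ V.sections σ d := by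
  obtain ⟨N, hN⟩ := h
  have hσ : faceMonomial k σ = faceMonomial k (σ.erase i) * X i := by
    rw [mul_comm]; exact (Finset.mul_prod_erase σ _ hi).symm
  have hcard : (σ.card : ℤ) = (σ.erase i).card + 1 := by
    exact_mod_cast (Finset.card_erase_add_one hi).symm
  refine ⟨N + A, ?_⟩
  rw [show faceMonomial k σ ^ (N + A) = faceMonomial k (σ.erase i) ^ A *
    (faceMonomial k σ ^ N * X i ^ A) by rw [pow_add, hσ]; ring, mul_smul, mul_smul]
  refine V.mem_piece_of_eq ?_ (V.smul_mem (faceMonomial_pow_mem (σ.erase i) A) hN)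
  push_cast
  rw [hcard]
  ring

/-- The vanishing of `H¹(ℙⁿ, 𝓘(1))` and `H¹(ℙⁿ, 𝒪(1))` in augmented form: sections of `𝒪(1)` on the
charts that agree modulo `J` on the overlaps come from a linear form. -/
lemma exists_linear_of_acyclic {J : Ideal (CoordRing k n)}
    (hJ : Acyclic ⊥ (idealFamily J) 2 1) (u : Fin (n + 1) → FracField k n)
    (hu : ∀ i, u i ∈ (idealFamily (⊤ : Ideal (CoordRing k n))).sections {i} 1)
    (huv : ∀ i j, u i - u j ∈ (idealFamily J).sections {i, j} 1) :
    ∃ l ∈ grading k n 1, ∀ i, u i - algebraMap _ _ l ∈ (idealFamily J).sections {i} 1 := by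
  classical
  -- only the values of this cochain on singletons matter
  let c : Finset (Fin (n + 1)) → FracField k n := fun σ => ∑ i ∈ σ, u i
  have hc1 : ∀ σ : Finset (Fin (n + 1)), σ.card = 1 →
      c σ ∈ (idealFamily (⊤ : Ideal (CoordRing k n))).sections σ 1 := by
    intro σ hσ
    obtain ⟨i, rfl⟩ := Finset.card_eq_one.1 hσ
    simpa [c] using hu i
  have hc2 : ∀ τ : Finset (Fin (n + 1)), τ.card = 2 →
      coboundary c τ ∈ (idealFamily J).sections τ 1 := by
    intro τ hτ
    obtain ⟨i, j, hij, rfl⟩ := Finset.card_eq_two.1 hτ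
    have h1 : coboundary c {i, j} = faceSign i {i, j} • u j + faceSign j {i, j} • u i := by
      rw [coboundary_apply, Finset.sum_pair hij, Finset.erase_insert (by simpa using hij),
        Finset.pair_comm i j, Finset.erase_insert (by simpa using hij.symm)]
      simp [c]
    have h2 : faceSign j {i, j} = - faceSign i {i, j} := by
      rcases lt_or_gt_of_ne hij with h | h <;>
        simp [faceSign, Finset.filter_insert, Finset.filter_singleton, h, h.not_gt]
    rw [h1, h2, neg_zsmul, ← sub_eq_add_neg, ← zsmul_sub]
    refine zsmul_mem ?_ _
    rw [Finset.pair_comm]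
    exact huv j i
  obtain ⟨e, he, hce⟩ := hJ (coboundary c) hc2 fun τ _ => by
    rw [coboundary_coboundary]; exact zero_mem _
  have he' : ∀ σ : Finset (Fin (n + 1)), σ.card = 1 → e σ ∈ (idealFamily J).sections σ 1 :=
    fun σ hσ => he σ (by omega)
  obtain ⟨g, hg, hgc⟩ := acyclic_bot_top (k := k) (n := n) (q := 1) (d := 1) (by norm_num) (c - e)
    (fun σ hσ => sub_mem (hc1 σ hσ)
      (GradedFamily.sections_mono (idealFamily_mono le_top) _ _ (he' σ hσ)))
    (fun τ hτ => by rw [map_sub]; exact hce τ hτ)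
  obtain ⟨l, -, hl, hle⟩ := GradedFamily.mem_sections_empty.1 (hg ∅ rfl)
  refine ⟨l, mem_grading_of_intComponent_eq hl, fun i => ?_⟩
  have h1 := hgc {i} rfl
  rw [mem_sections_bot, sub_eq_zero] at h1
  have h2 : coboundary g {i} = algebraMap _ _ l := by
    simp [coboundary_apply, faceSign, hle, Finset.filter_singleton]
  rw [h2] at h1
  rw [← h1]
  have : c {i} = u i := by simp [c]
  rw [Pi.sub_apply, this, sub_sub_cancel]
  exact he' _ rfl

/-- If a linear form `l` vanishes at no point of the scheme defined by `J`, and the relevant first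
cohomology groups vanish, then every quotient `a / l ^ (s + 1)` is congruent modulo `J` to some
`l' / l`. -/
lemma exists_linear_sub_mem {J : Ideal (CoordRing k n)} (hJh : J.IsHomogeneous (grading k n))
    (hJ : Acyclic ⊥ (idealFamily J) 2 1) {l : CoordRing k n} (hl : l ∈ grading k n 1)
    (hX : ∀ i, X i ∈ (J ⊔ Ideal.span {l}).radical) {s : ℕ} {a : CoordRing k n}
    (ha : a ∈ grading k n (s + 1)) :
    ∃ l' ∈ grading k n 1, ∀ i, ∃ M : ℕ, X i ^ M * (a - l ^ s * l') ∈ J := by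
  have h1 : ∀ i, ∃ M : ℕ, ∃ c ∈ grading k n M, X i ^ (M + 1) - l * c ∈ J := by
    intro i
    obtain ⟨M, hM⟩ := hX i
    obtain ⟨j, hj, y, hy, hjy⟩ := Submodule.mem_sup.1 hM
    obtain ⟨c, rfl⟩ := Ideal.mem_span_singleton'.1 hy
    refine ⟨M, homogeneousComponent M (X i * c), homogeneousComponent_mem _ _, ?_⟩
    have h2 : X i ^ (M + 1) - l * (X i * c) ∈ J := by
      have : X i ^ (M + 1) - l * (X i * c) = X i * j := by
        rw [pow_succ, ← hjy]; ring
      rw [this]; exact Ideal.mul_mem_left _ _ hj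
    have h3 := intComponent_mem hJh ((M + 1 : ℕ) : ℤ) h2
    have h4 := intComponent_mul hl (X i * c) M
    rw [map_sub, intComponent_of_mem (GradedFamily.X_pow_mem_grading i (M + 1))] at h3
    rw [intComponent_natCast] at h4
    push_cast at h3 h4
    rwa [h4] at h3
  choose M c hc hcJ using h1
  -- modulo `J`, the inverse of `l ^ s` on `D₊(x_i)` is `c_i ^ s / x_i ^ ((M_i + 1) s)`
  have hD : ∀ i, X i ^ ((M i + 1) * s) - l ^ s * c i ^ s ∈ J := fun i => by
    rw [pow_mul, ← mul_pow]
    exact J.mem_of_dvd (sub_dvd_pow_sub_pow _ _ s) (hcJ i)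
  have hXs : ∀ i, (fracX i : FracField k n) ^ ((M i + 1) * s) ≠ 0 := fun i =>
    pow_ne_zero _ (fracX_ne_zero i)
  have hac : ∀ i, a * c i ^ s ∈ grading k n (1 + (M i + 1) * s) := fun i => by
    have := SetLike.mul_mem_graded ha (SetLike.pow_mem_graded s (hc i))
    convert this using 1
    simp only [smul_eq_mul]
    ring_nf
  let u : Fin (n + 1) → FracField k n := fun i =>
    algebraMap _ _ (a * c i ^ s) / fracX i ^ ((M i + 1) * s)
  have hsmul : ∀ i, (X i ^ ((M i + 1) * s) : CoordRing k n) • u i =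
      algebraMap _ _ (a * c i ^ s) := fun i => by
    rw [Algebra.smul_def, map_pow]
    exact mul_div_cancel₀ _ (hXs i)
  have hpiece : ∀ {V : Ideal (CoordRing k n)} {σ : Finset (Fin (n + 1))} {e : ℕ} {d : ℤ}
      {f : CoordRing k n}, f ∈ grading k n e → d = e → f ∈ V →
      algebraMap _ (FracField k n) f ∈ (idealFamily V).sections σ d := by
    rintro V σ e _ f hf rfl hfV
    exact GradedFamily.piece_le_sections _ _
      ((algebraMap_mem_idealFamily (intComponent_of_mem hf)).2 hfV)
  obtain ⟨l', hl', h⟩ := exists_linear_of_acyclic hJ u (fun i => by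
      refine GradedFamily.mem_sections_of_X_pow_smul (Finset.mem_singleton_self i)
        (A := (M i + 1) * s) ?_
      rw [hsmul]
      exact hpiece (hac i) (by push_cast; ring) trivial)
    (fun i j => by
      refine GradedFamily.mem_sections_of_X_pow_smul (i := i) (by simp) (A := (M i + 1) * s) ?_
      refine GradedFamily.mem_sections_of_X_pow_smul (i := j) (by simp) (A := (M j + 1) * s) ?_
      have h2 : (X j ^ ((M j + 1) * s) : CoordRing k n) • (X i ^ ((M i + 1) * s) : CoordRing k n) •
          (u i - u j) = algebraMap _ _ (X j ^ ((M j + 1) * s) * (a * c i ^ s) -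
            X i ^ ((M i + 1) * s) * (a * c j ^ s)) := by
        rw [smul_sub, smul_sub, hsmul, smul_comm, hsmul, map_sub, Algebra.smul_def,
          Algebra.smul_def]
        exact congrArg₂ (· - ·) (map_mul _ _ _).symm (map_mul _ _ _).symm
      rw [h2]
      refine hpiece (e := (M j + 1) * s + (1 + (M i + 1) * s)) (sub_mem ?_ ?_) ?_ ?_
      · exact SetLike.mul_mem_graded (GradedFamily.X_pow_mem_grading j _) (hac i)
      · have := SetLike.mul_mem_graded
          (GradedFamily.X_pow_mem_grading (k := k) i ((M i + 1) * s)) (hac j)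
        convert this using 1
        ring_nf
      · push_cast; ring
      · have h3 : X j ^ ((M j + 1) * s) * (a * c i ^ s) - X i ^ ((M i + 1) * s) * (a * c j ^ s) =
            a * c i ^ s * (X j ^ ((M j + 1) * s) - l ^ s * c j ^ s) -
              a * c j ^ s * (X i ^ ((M i + 1) * s) - l ^ s * c i ^ s) := by ring
        rw [h3]
        exact sub_mem (Ideal.mul_mem_left _ _ (hD j)) (Ideal.mul_mem_left _ _ (hD i)))
  refine ⟨l', hl', fun i => ?_⟩
  obtain ⟨N, f, hf, -, hfe⟩ := h i
  refine ⟨(M i + 1) * s + N, ?_⟩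
  have h4 : X i ^ ((M i + 1) * s) * f = X i ^ N * (a * c i ^ s - X i ^ ((M i + 1) * s) * l') := by
    apply IsFractionRing.injective (CoordRing k n) (FracField k n)
    rw [map_mul, hfe, map_mul, map_sub, ← hsmul, map_mul, faceMonomial, Finset.prod_singleton]
    simp only [Algebra.smul_def]
    ring
  have h5 : X i ^ ((M i + 1) * s + N) * (a - l ^ s * l') =
      l ^ s * (X i ^ ((M i + 1) * s) * f) +
        X i ^ N * a * (X i ^ ((M i + 1) * s) - l ^ s * c i ^ s) := by
    rw [h4]; ring
  rw [h5]
  exact add_mem (Ideal.mul_mem_left _ _ (Ideal.mul_mem_left _ _ hf)) (Ideal.mul_mem_left _ _ (hD i))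

end

end LinearSyzygies

namespace LinearSyzygies

noncomputable section

attribute [local instance] MvPolynomial.gradedAlgebra

open HomogeneousLocalization (Away awayMap)

variable {k : Type u} [Field k] {n : ℕ}

/-- Over an infinite field, finitely many points of projective space avoid some hyperplane. -/
lemma exists_linear_forall_mem_dPlus [Infinite k] {T : Type*} [Finite T]
    (p : T → ProjSpace k n) : ∃ l ∈ grading k n 1, l ≠ 0 ∧ ∀ t, p t ∈ dPlus l := by
  classical
  have := Fintype.ofFinite T
  let V : Option T → Submodule k (grading k n 1) := fun o => o.elim ⊥ fun t =>
    ((p t).asHomogeneousIdeal.toIdeal.restrictScalars k).comap (grading k n 1).subtype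
  have hV : ∀ o, V o ≠ ⊤ := by
    rintro (_ | t) h
    · have h1 : (⟨X 0, X_mem_grading 0⟩ : grading k n 1) ∈ V none := by rw [h]; trivial
      have h2 : (⟨X 0, X_mem_grading 0⟩ : grading k n 1) = 0 := h1
      exact X_ne_zero (R := k) (0 : Fin (n + 1)) (congrArg Subtype.val h2)
    · have h1 : ∀ i, X i ∈ (p t).asHomogeneousIdeal.toIdeal := fun i => by
        have : (⟨X i, X_mem_grading i⟩ : grading k n 1) ∈ V (some t) := by rw [h]; trivial
        exact this
      obtain ⟨i, hi⟩ := TopologicalSpace.Opens.mem_iSup.1 (dPlus_le_iSup 1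
        (show p t ∈ dPlus 1 from fun h => (p t).isPrime.ne_top ((Ideal.eq_top_iff_one _).2 h)))
      rw [one_mul] at hi
      exact hi (h1 i)
  have h1 : ⋃ o, (V o : Set (grading k n 1)) ≠ Set.univ := fun h => by
    obtain ⟨o, ho⟩ := Subspace.exists_eq_top_of_iUnion_eq_univ h
    exact hV o ho
  obtain ⟨l, hl⟩ := (Set.ne_univ_iff_exists_notMem _).1 h1
  rw [Set.mem_iUnion, not_exists] at hl
  exact ⟨l, l.2, fun h => hl none (Subtype.ext h), fun t => hl (some t)⟩

/-- If a linear form vanishes at no point of the scheme defined by `J`, then `J` and this form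
generate an ideal containing a power of the irrelevant ideal. -/
lemma X_mem_radical_sup_span {J : Ideal (CoordRing k n)} (hJ : J.IsHomogeneous (grading k n))
    {l : CoordRing k n} (hl : l ∈ grading k n 1)
    (h : ∀ p : ProjectiveSpectrum (grading k n), J ≤ p.asHomogeneousIdeal.toIdeal →
      l ∉ p.asHomogeneousIdeal.toIdeal) (i : Fin (n + 1)) :
    X i ∈ (J ⊔ Ideal.span {l}).radical := by
  have hA : (J ⊔ Ideal.span {l}).IsHomogeneous (grading k n) :=
    hJ.sup (Ideal.homogeneous_span _ _ (by rintro _ rfl; exact ⟨1, hl⟩))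
  rw [hA.radical_eq, Ideal.mem_sInf]
  rintro P ⟨hP, hle, hprime⟩
  by_contra hi
  refine h ⟨⟨P, hP⟩, hprime, fun hirr => hi ?_⟩ (le_sup_left.trans hle)
    (hle (Ideal.mem_sup_right (Ideal.mem_span_singleton_self l)))
  exact hirr (HomogeneousIdeal.mem_irrelevant_of_mem _ one_pos (X_mem_grading i))

/-- Functions on a closed subscheme contained in the affine open set `D₊(l)` are restrictions of
functions on this open set. -/
lemma exists_surjective_of_forall_mem_dPlus {Z : Scheme.{u}} (ι : Z ⟶ ProjSpace k n)
    [IsClosedImmersion ι] {l : CoordRing k n} (hl : l ∈ grading k n 1)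
    (h : ∀ z, ι z ∈ dPlus l) :
    ∃ θ : Away (grading k n) l →+* Γ(Z, ⊤), Function.Surjective θ ∧
      ∀ a ∈ idealSections ι l, θ a = 0 := by
  have htop : ι ⁻¹ᵁ dPlus l = ⊤ := by
    ext z
    simpa using h z
  refine ⟨((Z.presheaf.map (eqToHom htop.symm).op).hom.comp (ι.app (dPlus l)).hom).comp
    (Proj.awayToSection (grading k n) l).hom, ?_, fun a ha => ?_⟩
  · have h1 : Function.Surjective (Proj.awayToSection (grading k n) l).hom :=
      (ConcreteCategory.bijective_of_isIso (Proj.basicOpenIsoAway (grading k n) l hl one_pos).hom).2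
    have h2 := ι.app_surjective (dPlus l) (Proj.isAffineOpen_basicOpen (grading k n) l hl one_pos)
    have h3 : Function.Surjective (Z.presheaf.map (eqToHom htop.symm).op).hom :=
      (ConcreteCategory.bijective_of_isIso (Z.presheaf.map (eqToHom htop.symm).op)).2
    exact (h3.comp h2).comp h1
  · exact (congrArg (Z.presheaf.map (eqToHom htop.symm).op).hom ha).trans (RingHom.map_zero _)

/-- A quotient of `k[x_0, …, x_n]_(l)` in which all elements are represented by fractions `l' / l`,
with `l'` a linear form, has length at most `n + 1`. -/
lemma length_le_of_forall_exists_linear {A : Type u} [CommRing A] {l : CoordRing k n}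
    (hl : l ∈ grading k n 1) (hl0 : l ≠ 0) (θ : Away (grading k n) l →+* A)
    (hθ : ∀ x : A, ∃ (l' : CoordRing k n) (hl' : l' ∈ grading k n (1 • 1)),
      θ (Away.mk (grading k n) hl 1 l' hl') = x) :
    Module.length A A ≤ (n + 1 : ℕ) := by
  let κ : k →+* Away (grading k n) l :=
    (HomogeneousLocalization.fromZeroRingHom (grading k n) _).comp (algebraMap k (grading k n 0))
  have hκ : ∀ c, awayToFrac l hl0 (κ c) = algebraMap _ _ (C c : CoordRing k n) := fun c => by
    have h0 : (C c : CoordRing k n) ∈ grading k n (0 • 1) := by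
      rw [zero_smul]; exact (mem_homogeneousSubmodule _ _).2 (isHomogeneous_C _ c)
    have h1 : κ c = Away.mk (grading k n) hl 0 (C c) h0 := by
      ext
      simp [κ, HomogeneousLocalization.fromZeroRingHom, HomogeneousLocalization.Away.val_mk]
      rfl
    rw [h1, awayToFrac_mk, pow_zero, div_one]
  let _ : Algebra k A := (θ.comp κ).toAlgebra
  have hX : ∀ i, (X i : CoordRing k n) ∈ grading k n (1 • 1) := fun i => X_mem_grading i
  let μ : (Fin (n + 1) → k) →ₗ[k] A :=
    Fintype.linearCombination k fun i => θ (Away.mk (grading k n) hl 1 (X i) (hX i))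
  have hμ : Function.Surjective μ := by
    intro x
    obtain ⟨l', hl', rfl⟩ := hθ x
    have h1 : l' ∈ Submodule.span k (Set.range (X : Fin (n + 1) → CoordRing k n)) := by
      rw [← homogeneousSubmodule_one_eq_span_X]; exact hl'
    obtain ⟨c, rfl⟩ := (Submodule.mem_span_range_iff_exists_fun k).1 h1
    refine ⟨c, ?_⟩
    have h2 : Away.mk (grading k n) hl 1 _ hl' =
        ∑ i, κ (c i) * Away.mk (grading k n) hl 1 (X i) (hX i) := by
      refine awayToFrac_injective hl0 ?_
      rw [awayToFrac_mk, map_sum, map_sum, Finset.sum_div]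
      refine Finset.sum_congr rfl fun i _ => ?_
      rw [map_mul, hκ, awayToFrac_mk, smul_eq_C_mul, map_mul, mul_div_assoc]
    rw [h2, map_sum, Fintype.linearCombination_apply]
    refine Finset.sum_congr rfl fun i _ => ?_
    rw [map_mul, Algebra.smul_def]
    rfl
  have h1 : Module.length A A ≤ Module.length k A := by
    have := Submodule.length_le_length_restrictScalars (R := A) (M := A) k ⊤
    rwa [Submodule.restrictScalars_top, Module.length_top, Module.length_top] at this
  have h2 := Module.length_le_of_surjective μ hμ
  rw [Module.length_eq_finrank k (Fin (n + 1) → k), Module.finrank_fin_fun] at h2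
  exact h1.trans h2

section LinearSection

variable {m r : ℕ} {Z : Scheme.{u}} (ι : Z ⟶ ProjSpace k r) (b : Fin (m + 1) → Fin (r + 1) → k)

lemma length_linearSection_le [Infinite k] [IsClosedImmersion ι] (hb : LinearIndependent k b)
    [Finite ↥(pullback ι (linearSubspace b hb))]
    (h : Acyclic ⊥ (idealFamily (restrictedIdeal ι b)) 2 1) :
    Module.length Γ(pullback ι (linearSubspace b hb), ⊤) Γ(pullback ι (linearSubspace b hb), ⊤) ≤
      (m + 1 : ℕ) := by
  obtain ⟨l, hl, hl0, hlz⟩ :=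
    exists_linear_forall_mem_dPlus fun z => pullback.snd ι (linearSubspace b hb) z
  obtain ⟨θ, hθ, hθ0⟩ := exists_surjective_of_forall_mem_dPlus _ hl hlz
  refine length_le_of_forall_exists_linear hl hl0 θ fun x => ?_
  obtain ⟨a, rfl⟩ := hθ x
  obtain ⟨N, a, ha, rfl⟩ := Away.mk_surjective (grading k m) hl a
  have ha' : a * l ∈ grading k m (N + 1) := SetLike.mul_mem_graded (by simpa using ha) hl
  obtain ⟨l', hl', hJ⟩ := exists_linear_sub_mem (isHomogeneous_restrictedIdeal ι b) h hl
    (X_mem_radical_sup_span (isHomogeneous_restrictedIdeal ι b) hl fun p hp => by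
      obtain ⟨z, rfl⟩ := mem_range_snd_of_restrictedIdeal_le ι b hb p hp
      exact hlz z) ha'
  refine ⟨l', hl', ?_⟩
  have hf : a * l - l ^ N * l' ∈ grading k m (N + 1) :=
    sub_mem ha' (SetLike.mul_mem_graded (by simpa using SetLike.pow_mem_graded N hl) hl')
  have hmem : ∀ i, Away.mk (grading k m) (X_mem_grading i) (N + 1) (a * l - l ^ N * l')
      (by simpa using hf) ∈ idealSections (pullback.snd ι (linearSubspace b hb)) (X i) := by
    intro i
    obtain ⟨M, hM⟩ := hJ i
    have h1 := SetLike.mul_mem_graded (GradedFamily.X_pow_mem_grading (k := k) i M) hf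
    convert mk_mem_idealSections_of_mem_restrictedIdeal ι b hb i hM h1 using 1
    refine awayToFrac_injective (X_ne_zero i) ?_
    have := (isUnit_algebraMap (X_ne_zero (R := k) i)).ne_zero
    rw [awayToFrac_mk, awayToFrac_mk, map_mul _ (X i ^ M), map_pow, pow_add _ M,
      mul_div_mul_left _ _ (pow_ne_zero _ this)]
  have h2 := hθ0 _ (mk_mem_idealSections_of_linear _ hf hmem hl hl0)
  have h3 : Away.mk (grading k m) hl (N + 1) (a * l - l ^ N * l') (by simpa using hf) =
      Away.mk (grading k m) hl N a ha - Away.mk (grading k m) hl 1 l' hl' := by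
    refine awayToFrac_injective hl0 ?_
    have := (isUnit_algebraMap hl0).ne_zero
    rw [map_sub, awayToFrac_mk, awayToFrac_mk, awayToFrac_mk, map_sub, map_mul, map_mul, map_pow]
    field_simp
    ring
  rw [h3, map_sub, sub_eq_zero] at h2
  exact h2.symm

end LinearSection

end

end LinearSyzygies

/-- `X` is a closed subscheme of `ℙʳ` (via `ι`) satisfying `N_{2,p}`, and `Λ` is the linear subspace
of dimension `m ≤ p` spanned by the points `[b_0], …, [b_m]`, identified with `ℙᵐ`. The fibre product
`pullback ι (linearSubspace b hb)` is the scheme `X ∩ Λ`, and `pullback.snd` is its inclusion in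
`Λ`. -/
theorem theorem1p1 {k : Type u} [Field k] [IsAlgClosed k] {r p m : ℕ} (hp : 1 ≤ p)
    {X : Scheme.{u}} (ι : X ⟶ ProjSpace k r) [IsClosedImmersion ι]
    (hX : SatisfiesN2 (homogeneousIdeal ι) p)
    (b : Fin (m + 1) → Fin (r + 1) → k) (hb : LinearIndependent k b) (hm : m ≤ p)
    (hdim : topologicalKrullDim ↥(pullback ι (linearSubspace b hb)) ≤ 1) :
    IsCMRegular (pullback.snd ι (linearSubspace b hb)) 2 ∧
      (Finite ↥(pullback ι (linearSubspace b hb)) →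
        Module.length Γ(pullback ι (linearSubspace b hb), ⊤)
          Γ(pullback ι (linearSubspace b hb), ⊤) ≤ (m + 1 : ℕ)) := by
  obtain ⟨F, hF⟩ := hX.2
  have hacyc := F.acyclic_idealFamily b hp hF hm (isHomogeneous_restrictedIdeal ι b) fun s hs => by
    have h := (length_le_topologicalKrullDim ι b hb s hs).trans hdim
    have h1 : s.length ≤ 1 := by exact_mod_cast h
    omega
  refine ⟨fun q hq => ?_, fun hfin => length_linearSection_le ι b hb (hacyc 2 le_rfl)⟩
  obtain ⟨q, rfl⟩ := Nat.exists_eq_add_of_le' hq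
  refine subsingleton_idealCohomology _ (V := idealFamily (restrictedIdeal ι b))
    (fun σ hσ s => mem_twistedSections_iff ι b hb hσ _) ?_
  convert hacyc (q + 2) (by omega) using 1
  push_cast
  ring
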